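/- Let $\mathbb E=\mathbb C/\langle 1,\omega\rangle$ with $\omega\in\mathbb C\setminus\mathbb R$, let $A\in\mathbb Z^{d\times n}$ be an integer matrix of rank $d$ with nonzero columns $a_1,\dots,a_n$, $a_j=(a_{j,1},\dots,a_{j,d})$, and let $b_1,\dots,b_n\in\mathbb R/\mathbb Z$. Put $$\mathbf H_j=\Big\{z\in\mathbb E^d \,\Big|\, \sum_k a_{j,k}z_k=b_j+\omega b_j\Big\},\qquad H_j=\Big\{x\in(\mathbb R/\mathbb Z)^d \,\Big|\, \sum_k a_{j,k}x_k=b_j\Big\},\qquad M(\mathcal A_{\mathbb E})=\mathbb E^d\setminus\bigcup_j\mathbf H_j .$$ **Cells.** The preimages of the $H_j$ in $\mathbb R^d$ form a $\mathbb Z^d$-periodic hyperplane arrangement; the images of its (relatively open) faces in $(\mathbb R/\mathbb Z)^d$ are the cells of a complex $K_{\mathcal A}$. Cells of codimension $0$ and $1$ are called chambers and walls. For a cell $F$ let $\operatorname{supp}(F)=\{j\mid F\subseteq H_j\}$. Let $G_{\mathcal A}$ be the multigraph with the chambers as vertices and the walls as edges, where a wall joins the two (possibly equal) chambers on its two sides.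 Choose an orientation of every edge of $G_{\mathcal A}$, a spanning tree $T$ of $G_{\mathcal A}$ and a chamber $C_0$ (the root). **Edges.** Consider the graph whose vertices are the pairs of chambers and whose edges are the pairs $(a,C)$ and $(C,a)$ with $a$ a wall and $C$ a chamber; if $a$ is oriented from $A_0$ to $A_1$, then $(a,C)$ goes from $(A_0,C)$ to $(A_1,C)$ and $(C,a)$ goes from $(C,A_0)$ to $(C,A_1)$. Writing points of $\mathbb E^d$ as $x+\omega y$ with $x,y\in(\mathbb R/\mathbb Z)^d$, the vertex $(C,D)$ stands for the points of $M(\mathcal A_{\mathbb E})$ with $x\in C$, $y\in D$, and the edge $(a,C)$ (resp. $(C,a)$) for the paths in $M(\mathcal A_{\mathbb E})$ along which $y$ (resp. $x$) stays in $C$ while $x$ (resp. $y$) crosses the wall $a$ from its tail side to its head side. Let $$T_{\mathcal K}=\{(t,C_0)\mid t\in T\}\cup\{(C,t)\mid t\in T,\ C \text{ a chamber}\}.$$ **Theorem.** $T_{\mathcal K}$ is a spanning tree of this graph, and $\pi_1(M(\mathcal A_{\mathbb E}))$, based at a point over $(C_0,C_0)$, has the following finite presentation. The generators are the edges that are not in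 $T_{\mathcal K}$, that is, 1. $(a,C_0)$ for walls $a\notin T$, 2. $(a,C)$ for all walls $a$ and all chambers $C\neq C_0$, 3. $(C,a)$ for walls $a\notin T$ and all chambers $C$; the generator $e$ is the class of the closed path that runs in $T_{\mathcal K}$ from $(C_0,C_0)$ to the tail of $e$, then along $e$, and then in $T_{\mathcal K}$ from the head of $e$ back to $(C_0,C_0)$. Products are concatenations of paths from left to right. The relations, in which every edge that belongs to $T_{\mathcal K}$ is read as $1$, are * $(A_0,b)\,(a,B_1)=(a,B_0)\,(A_1,b)$ for all walls $a$ (oriented from $A_0$ to $A_1$) and $b$ (oriented from $B_0$ to $B_1$) with $\operatorname{supp}(a)\cap\operatorname{supp}(b)=\emptyset$; * $\prod_{i=1}^k (a_i,C)^{n_i}=1$ and $\prod_{i=1}^k (C,a_i)^{n_i}=1$ for every cell $p$ of codimension $2$ and every chamber $C$, where $a_1,\dots,a_k$ is a cyclic ordering of the walls around $p$ (taken around a lift of $p$ to $\mathbb R^d$, so that a wall of the torus may occur several times; any starting point and either direction may be chosen), and $n_i=1$ if $a_i$ is oriented in the direction of this ordering, $n_i=-1$ otherwise. -/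

import Mathlib

open scoped unitInterval

noncomputable section

/-- The data of an essential elliptic arrangement: the elliptic curve `ℂ / ⟨1, ω⟩`, an integer
matrix of full row rank whose columns define hypersurfaces, and one translation parameter
in `ℝ / ℤ` for each column. -/
structure EllipticArrangement (d n : ℕ) where
  ω : ℂ
  ω_not_real : ω.im ≠ 0
  A : Matrix (Fin d) (Fin n) ℤ
  full_row_rank : (A.map (fun m : ℤ => (m : ℝ))).rank = d
  column_ne_zero : ∀ j, ∃ k, A k j ≠ 0
  b : Fin n → UnitAddCircle

/-- `T` is a spanning tree of the multigraph with vertex set `V`, edge set `E` and end points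
`tail e`, `head e`: any two vertices are joined by edges of `T`, and the end points of an edge of
`T` are not joined by the other edges of `T` (so that `T` contains no cycle and no loop). -/
def IsSpanningTree {V E : Type} (tail head : E → V) (T : Set E) : Prop :=
  (∀ u v : V, Relation.EqvGen (fun x y => ∃ e ∈ T, tail e = x ∧ head e = y) u v) ∧
  ∀ e ∈ T, ¬ Relation.EqvGen (fun x y => ∃ f ∈ T \ {e}, tail f = x ∧ head f = y) (tail e) (head e)

namespace EllipticArrangement

variable {d n : ℕ} (𝒜 : EllipticArrangement d n)

/-! ### The elliptic arrangement and its complement -/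

/-- The lattice `⟨1, ω⟩`. -/
def lattice : AddSubgroup ℂ := AddSubgroup.closure {1, 𝒜.ω}

/-- The elliptic curve `ℂ / ⟨1, ω⟩`, with the quotient group structure and quotient topology. -/
abbrev Curve : Type := ℂ ⧸ 𝒜.lattice

/-- The point of the `d`-fold product of the curve with coordinates `x k + ω * y k`. -/
def point (x y : Fin d → ℝ) : Fin d → 𝒜.Curve :=
  fun k => QuotientAddGroup.mk ((x k : ℂ) + 𝒜.ω * (y k : ℂ))

/-- The `j`-th hypersurface `∑ k, a_{j,k} z_k = b_j + ω b_j`; the right-hand side does not depend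
on the real representative `β` of `b_j`. -/
def ellipticHypersurface (j : Fin n) : Set (Fin d → 𝒜.Curve) :=
  {z | ∃ β : ℝ, (β : UnitAddCircle) = 𝒜.b j ∧
    ∑ k, 𝒜.A k j • z k = QuotientAddGroup.mk ((β : ℂ) + 𝒜.ω * (β : ℂ))}

/-- The complement of the elliptic arrangement, with the subspace topology. -/
abbrev Complement : Type := {z : Fin d → 𝒜.Curve // ∀ j, z ∉ 𝒜.ellipticHypersurface j}

/-! ### The toric arrangement and the cells it defines -/

/-- The `j`-th hypersurface in the compact torus `(ℝ / ℤ)^d`. -/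
def toricHypersurface (j : Fin n) : Set (Fin d → UnitAddCircle) :=
  {x | ∑ k, 𝒜.A k j • x k = 𝒜.b j}

/-- The universal covering of the torus. -/
def proj (x : Fin d → ℝ) : Fin d → UnitAddCircle := fun k => (x k : UnitAddCircle)

/-- Two points of `ℝ^d` lie in the same face of the lifted periodic hyperplane arrangement, whose
hyperplanes are `∑ k, a_{j,k} x_k = β` for all `j` and all real representatives `β` of `b_j`. -/
def SameFace (x y : Fin d → ℝ) : Prop :=
  ∀ (j : Fin n) (β : ℝ), (β : UnitAddCircle) = 𝒜.b j →
    SignType.sign (∑ k, (𝒜.A k j : ℝ) * x k - β) = SignType.sign (∑ k, (𝒜.A k j : ℝ) * y k - β)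

/-- The (relatively open) faces of codimension `c` of the lifted arrangement in `ℝ^d`. -/
def LiftedFace (c : ℕ) : Type :=
  {F : Set (Fin d → ℝ) // (∃ x, F = {y | 𝒜.SameFace x y}) ∧
    Module.finrank ℝ (vectorSpan ℝ F) + c = d}

/-- The (open) cells of codimension `c` of the complex `K_𝒜` on the torus: the images of the faces
of codimension `c` of the lifted arrangement. -/
def Cell (c : ℕ) : Type :=
  {S : Set (Fin d → UnitAddCircle) // ∃ F : 𝒜.LiftedFace c, proj '' F.1 = S}

/-- Chambers are the cells of dimension `d`. -/
abbrev Chamber : Type := 𝒜.Cell 0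

/-- Walls are the cells of dimension `d - 1`. -/
abbrev Wall : Type := 𝒜.Cell 1

variable {𝒜}

/-- The cell covered by a lifted face. -/
def LiftedFace.toCell {c : ℕ} (F : 𝒜.LiftedFace c) : 𝒜.Cell c := ⟨proj '' F.1, F, rfl⟩

/-- Some lifted face covering the given cell. -/
def Cell.lift {c : ℕ} (S : 𝒜.Cell c) : 𝒜.LiftedFace c := S.2.choose

/-- The support of a cell: the set of (indices of) hypersurfaces that contain it. -/
def Cell.supp {c : ℕ} (S : 𝒜.Cell c) : Set (Fin n) := {j | S.1 ⊆ 𝒜.toricHypersurface j}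

variable (𝒜)

/-- An orientation of the graph with the chambers as vertices and the walls as edges. A lifted wall
lies in the closure of exactly two lifted chambers, and an orientation declares one of them to be
the tail and the other one to be the head, compatibly with translations by `ℤ^d`. -/
structure Orientation where
  tail : 𝒜.LiftedFace 1 → 𝒜.LiftedFace 0
  head : 𝒜.LiftedFace 1 → 𝒜.LiftedFace 0
  subset_closure_tail : ∀ W, W.1 ⊆ closure (tail W).1
  subset_closure_head : ∀ W, W.1 ⊆ closure (head W).1
  tail_ne_head : ∀ W, tail W ≠ head W
  translate : ∀ (v : Fin d → ℤ) (W W' : 𝒜.LiftedFace 1),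
    W'.1 = (fun x k => x k + (v k : ℝ)) '' W.1 →
      (tail W').1 = (fun x k => x k + (v k : ℝ)) '' (tail W).1 ∧
      (head W').1 = (fun x k => x k + (v k : ℝ)) '' (head W).1

variable {𝒜}

/-- The chamber at the tail of a wall; by equivariance the choice of the lift is irrelevant. -/
def Orientation.tailOf (o : 𝒜.Orientation) (a : 𝒜.Wall) : 𝒜.Chamber := (o.tail a.lift).toCell

/-- The chamber at the head of a wall; by equivariance the choice of the lift is irrelevant. -/
def Orientation.headOf (o : 𝒜.Orientation) (a : 𝒜.Wall) : 𝒜.Chamber := (o.head a.lift).toCell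

/-- A cyclic (clockwise or counter-clockwise) ordering of the walls around a cell `p` of
codimension two. It is given in the universal cover around a lift of `p`: all the lifted walls
containing the lift of `p` in their closure are listed without repetition as
`wall 0, …, wall len`, together with lifted chambers such that, cyclically, `wall i` separates
`chamber i` from `chamber (i + 1)`. The same wall of the torus may be listed more than once. -/
structure CyclicOrder (p : 𝒜.Cell 2) where
  face : 𝒜.LiftedFace 2
  toCell_face : face.toCell = p
  len : ℕ
  wall : Fin (len + 1) → 𝒜.LiftedFace 1
  chamber : Fin (len + 1) → 𝒜.LiftedFace 0
  wall_injective : Function.Injective wall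
  range_wall : Set.range wall = {W | face.1 ⊆ closure W.1}
  subset_closure : ∀ i, (wall i).1 ⊆ closure (chamber i).1
  subset_closure_next : ∀ i, (wall i).1 ⊆ closure (chamber (i + 1)).1
  chamber_ne_next : ∀ i, chamber i ≠ chamber (i + 1)

open Classical in
/-- The exponent of the `i`-th wall of a cyclic ordering: `1` if the wall is oriented in the
direction of the ordering and `-1` otherwise. -/
def CyclicOrder.exponent {p : 𝒜.Cell 2} (s : CyclicOrder p) (o : 𝒜.Orientation)
    (i : Fin (s.len + 1)) : ℤ :=
  if o.tail (s.wall i) = s.chamber i then 1 else -1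

/-! ### The `1`-skeleton of the complex `K(𝒜_𝔼)` -/

variable (𝒜)

/-- The vertices of `K(𝒜_𝔼)`: pairs of chambers. -/
abbrev Vertex : Type := 𝒜.Chamber × 𝒜.Chamber

/-- The edges of `K(𝒜_𝔼)`: pairs `(a, C)` and pairs `(C, a)` with `a` a wall, `C` a chamber. -/
inductive Edge : Type
  | fst (a : 𝒜.Wall) (C : 𝒜.Chamber)
  | snd (C : 𝒜.Chamber) (a : 𝒜.Wall)

variable {𝒜}

/-- The vertex at the tail of an edge. -/
def Edge.tail (o : 𝒜.Orientation) : 𝒜.Edge → 𝒜.Vertex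
  | .fst a C => (o.tailOf a, C)
  | .snd C a => (C, o.tailOf a)

/-- The vertex at the head of an edge. -/
def Edge.head (o : 𝒜.Orientation) : 𝒜.Edge → 𝒜.Vertex
  | .fst a C => (o.headOf a, C)
  | .snd C a => (C, o.headOf a)

/-- The tree `T_𝒦 = {(t, C₀) | t ∈ T} ∪ {(C, t) | t ∈ T, C a chamber}`. -/
def treeK (C₀ : 𝒜.Chamber) (T : Set 𝒜.Wall) : Set 𝒜.Edge :=
  {e | ∃ t ∈ T, e = .fst t C₀} ∪ {e | ∃ t ∈ T, ∃ C, e = .snd C t}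

/-- The generators: `(a, C₀)` for `a ∉ T`; `(a, C)` for `C ≠ C₀` and all `a`; `(C, a)` for `a ∉ T`
and all `C`. -/
def generators (C₀ : 𝒜.Chamber) (T : Set 𝒜.Wall) : Set 𝒜.Edge :=
  {e | ∃ a, a ∉ T ∧ e = .fst a C₀} ∪ {e | ∃ a C, C ≠ C₀ ∧ e = .fst a C} ∪
    {e | ∃ C a, a ∉ T ∧ e = .snd C a}

/-! ### The relations -/

open Classical in
/-- The symbol of an edge in the relations: the corresponding free generator, or `1` if the edge
is not one of the generators. -/
def sym (C₀ : 𝒜.Chamber) (T : Set 𝒜.Wall) (e : 𝒜.Edge) : FreeGroup (generators C₀ T) :=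
  if h : e ∈ generators C₀ T then FreeGroup.of ⟨e, h⟩ else 1

/-- The relators: `(A₀, b)(a, B₁) = (a, B₀)(A₁, b)` for walls `a` (from `A₀` to `A₁`) and `b` (from
`B₀` to `B₁`) with disjoint supports, and for every cell `p` of codimension two with walls
`a₁, …, a_k` in cyclic order and every chamber `C` the products `∏ (a_i, C)^{n_i}` and
`∏ (C, a_i)^{n_i}`. -/
def relators (o : 𝒜.Orientation) (C₀ : 𝒜.Chamber) (T : Set 𝒜.Wall)
    (ord : ∀ p : 𝒜.Cell 2, CyclicOrder p) : Set (FreeGroup (generators C₀ T)) :=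
  {r | ∃ a b : 𝒜.Wall, a.supp ∩ b.supp = ∅ ∧
    r = (sym C₀ T (.snd (o.tailOf a) b) * sym C₀ T (.fst a (o.headOf b))) *
      (sym C₀ T (.fst a (o.tailOf b)) * sym C₀ T (.snd (o.headOf a) b))⁻¹} ∪
  {r | ∃ (p : 𝒜.Cell 2) (C : 𝒜.Chamber),
    r = (List.ofFn fun i =>
      sym C₀ T (.fst ((ord p).wall i).toCell C) ^ (ord p).exponent o i).prod} ∪
  {r | ∃ (p : 𝒜.Cell 2) (C : 𝒜.Chamber),
    r = (List.ofFn fun i =>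
      sym C₀ T (.snd C ((ord p).wall i).toCell) ^ (ord p).exponent o i).prod}

/-! ### Closed walks in the complement -/

/-- The point `z = x + ω y` of the complement lies over the vertex `(C, D)`, that is, `x` lies in
the chamber `C` and `y` lies in the chamber `D`. -/
def LiesOver (z : 𝒜.Complement) (v : 𝒜.Vertex) : Prop :=
  ∃ x y : Fin d → ℝ, proj x ∈ v.1.1 ∧ proj y ∈ v.2.1 ∧ z.1 = 𝒜.point x y

/-- The path `x(t) + ω y(t)` in the complement travels along the edge `(a, C)`: lifted to the
universal cover, `y` stays in the chamber `C` and `x` passes from the tail chamber to the head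
chamber of `a` without leaving the union of `a` and of these two chambers. Similarly, with the
roles of `x` and `y` exchanged, for the edge `(C, a)`. -/
def Traverses (o : 𝒜.Orientation) (e : 𝒜.Edge) {z z' : 𝒜.Complement} (γ : Path z z') : Prop :=
  match e with
  | .fst a C => ∃ (W : 𝒜.LiftedFace 1) (D : 𝒜.LiftedFace 0), W.toCell = a ∧ D.toCell = C ∧
      ∃ x y : C(I, Fin d → ℝ), x 0 ∈ (o.tail W).1 ∧ x 1 ∈ (o.head W).1 ∧
        ∀ t, x t ∈ (o.tail W).1 ∪ W.1 ∪ (o.head W).1 ∧ y t ∈ D.1 ∧ (γ t).1 = 𝒜.point (x t) (y t)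
  | .snd C a => ∃ (W : 𝒜.LiftedFace 1) (D : 𝒜.LiftedFace 0), W.toCell = a ∧ D.toCell = C ∧
      ∃ x y : C(I, Fin d → ℝ), y 0 ∈ (o.tail W).1 ∧ y 1 ∈ (o.head W).1 ∧
        ∀ t, y t ∈ (o.tail W).1 ∪ W.1 ∪ (o.head W).1 ∧ x t ∈ D.1 ∧ (γ t).1 = 𝒜.point (x t) (y t)

/-- `IsWalk o S u v γ`: the path `γ` in the complement runs along a walk from the vertex `u` to the
vertex `v` whose edges, which may be used in both directions, all belong to `S`. -/
inductive IsWalk (o : 𝒜.Orientation) (S : Set 𝒜.Edge) :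
    𝒜.Vertex → 𝒜.Vertex → ∀ {z z' : 𝒜.Complement}, Path z z' → Prop
  | nil {v : 𝒜.Vertex} {z : 𝒜.Complement} : LiesOver z v → IsWalk o S v v (Path.refl z)
  | forward {u : 𝒜.Vertex} {e : 𝒜.Edge} {z z' z'' : 𝒜.Complement} {γ : Path z z'}
      {δ : Path z' z''} : IsWalk o S u (e.tail o) γ → e ∈ S → Traverses o e δ →
      IsWalk o S u (e.head o) (γ.trans δ)
  | backward {u : 𝒜.Vertex} {e : 𝒜.Edge} {z z' z'' : 𝒜.Complement} {γ : Path z z'}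
      {δ : Path z'' z'} : IsWalk o S u (e.head o) γ → e ∈ S → Traverses o e δ →
      IsWalk o S u (e.tail o) (γ.trans δ.symm)

end EllipticArrangement

end

/-! Writing `z = x + ω y` with real `x`, `y` presents the complement as the quotient, by the lattice
of pairs of integral vectors, of the space `Cover` of pairs `(x, y)` such that no family of
hyperplanes passes through both `x` and `y`. The quotient map is a covering. A point of `Cover` has
the product of the open stars of its two faces as a neighbourhood; this is convex, and the pairs of
lifted chambers in it are connected by crossing walls one at a time.

The central notion is a weight of the edges, with values in a group, that has local potentials
(`HasPotentials`): on every product of stars it is the difference of a function on pairs of lifted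
chambers. The theorem rests on two sources of such weights.

Holonomy. Paths of the complement get values in the fundamental group, gauged so that the tree is
trivial (`exists_holonomy`). Stars are simply connected, so the values of the edges have local
potentials (`hasPotentials_of_holonomy`). Around a square or a codimension-two cell the differences
of a potential cancel, so the relations hold (`HasPotentials.lift_relator`) and the map from the
presented group to the fundamental group is defined. It is surjective because a loop lifts to
`Cover`, and a path there decomposes into pieces inside stars, whose holonomy is generated by that
of the edges (`holonomy_mem`).

The presented group. Conversely, the tautological weight of the edges in the presented group has
local potentials (`hasPotentials_presentedGroup`). The codimension-two relations give them on stars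
in one variable, by induction on the number of hyperplanes (`exists_potential`); the commutation
relations extend them to products (`exists_potential_prod`), where exactly walls of disjoint support
occur. Potentials on overlapping stars differ by constants, so they form a bundle with discrete
fibre over `Cover` and define a transport along homotopy classes of paths (`exists_transport`).

Injectivity follows by comparing the two. Each word is realised by one path of `Cover` whose
holonomy is the image of the word and whose transport is multiplication by its class
(`exists_path_realizing`). If the holonomy is trivial, covering theory makes the path a
null-homotopic loop, so its transport is the identity and the class of the word is trivial. -/

noncomputable section

namespace EllipticArrangement
variable {d n : ℕ} (𝒜 : EllipticArrangement d n)

/-! ### The affine functions defining the lifted arrangement -/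

/-- A real representative of `b j`. -/
def shift (j : Fin n) : ℝ := (QuotientAddGroup.mk_surjective (𝒜.b j)).choose

theorem coe_shift (j : Fin n) : ((𝒜.shift j : ℝ) : UnitAddCircle) = 𝒜.b j :=
  (QuotientAddGroup.mk_surjective (𝒜.b j)).choose_spec

/-- The linear form given by the `j`-th column. -/
def ell (j : Fin n) : (Fin d → ℝ) →ₗ[ℝ] ℝ := ∑ k, (𝒜.A k j : ℝ) • LinearMap.proj k

theorem ell_apply (j : Fin n) (x : Fin d → ℝ) : 𝒜.ell j x = ∑ k, (𝒜.A k j : ℝ) * x k := by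
  simp [ell]

/-- The affine function whose integral level sets are the lifts of the `j`-th hypersurface. -/
def height (j : Fin n) (x : Fin d → ℝ) : ℝ := 𝒜.ell j x - 𝒜.shift j

theorem height_add (j : Fin n) (x w : Fin d → ℝ) :
    𝒜.height j (x + w) = 𝒜.height j x + 𝒜.ell j w := by
  simp [height]; ring

theorem height_sub_height (j : Fin n) (x y : Fin d → ℝ) :
    𝒜.height j y - 𝒜.height j x = 𝒜.ell j (y - x) := by
  simp [height]

theorem continuous_ell (j : Fin n) : Continuous (𝒜.ell j) :=
  LinearMap.continuous_of_finiteDimensional _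

theorem continuous_height (j : Fin n) : Continuous (𝒜.height j) :=
  (𝒜.continuous_ell j).sub continuous_const

theorem height_combo (j : Fin n) (x y : Fin d → ℝ) {a b : ℝ} (h : a + b = 1) :
    𝒜.height j (a • x + b • y) = a * 𝒜.height j x + b * 𝒜.height j y := by
  have : b = 1 - a := by linarith
  subst this
  simp [height]; ring

theorem ell_ne_zero (j : Fin n) : 𝒜.ell j ≠ 0 := by
  obtain ⟨k, hk⟩ := 𝒜.column_ne_zero j
  intro h
  have := LinearMap.congr_fun h (Pi.single k 1)
  simp [ell_apply, Pi.single_apply] at this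
  exact hk this

/-- Full row rank means independent rows, so multiplying the matrix by row vectors is injective.
This is the only use of the rank hypothesis; through it nonzero lattice translations move every
point to a different face. -/
theorem eq_zero_of_ell_eq_zero {x : Fin d → ℝ} (h : ∀ j, 𝒜.ell j x = 0) : x = 0 := by
  have hr := 𝒜.full_row_rank
  set B := 𝒜.A.map (fun m : ℤ => (m : ℝ)) with hB
  have h1 : LinearIndependent ℝ B.row := by
    rw [linearIndependent_iff_card_eq_finrank_span]
    rw [Set.finrank, ← Matrix.rank_eq_finrank_span_row, hr, Fintype.card_fin]
  have h2 := Matrix.vecMul_injective_iff.2 h1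
  apply h2
  ext j
  have := h j
  rw [ell_apply] at this
  simpa [Matrix.vecMul, dotProduct, hB, mul_comm] using this

theorem coe_eq_b_iff (j : Fin n) (β : ℝ) :
    (β : UnitAddCircle) = 𝒜.b j ↔ ∃ m : ℤ, β = 𝒜.shift j + m := by
  rw [← coe_shift, eq_comm]
  rw [QuotientAddGroup.eq, AddSubgroup.mem_zmultiples_iff]
  constructor
  · rintro ⟨m, hm⟩
    refine ⟨m, ?_⟩
    simp at hm
    linarith
  · rintro ⟨m, hm⟩
    exact ⟨m, by simp [hm]⟩

theorem sameFace_iff_sign {x y : Fin d → ℝ} : 𝒜.SameFace x y ↔ ∀ (j : Fin n) (m : ℤ),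
    SignType.sign (𝒜.height j x - m) = SignType.sign (𝒜.height j y - m) := by
  constructor
  · intro h j m
    have := h j (𝒜.shift j + m) ((𝒜.coe_eq_b_iff j _).2 ⟨m, rfl⟩)
    simpa only [← ell_apply, height, sub_sub] using this
  · intro h j β hβ
    obtain ⟨m, rfl⟩ := (𝒜.coe_eq_b_iff j _).1 hβ
    simpa only [← ell_apply, height, sub_sub] using h j m

/-- Floor and ceiling of the height record the position relative to all parallel hyperplanes of a
family at once, so a face is described by finitely many integers. -/
theorem sameFace_iff {x y : Fin d → ℝ} : 𝒜.SameFace x y ↔ ∀ j : Fin n,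
    ⌊𝒜.height j x⌋ = ⌊𝒜.height j y⌋ ∧ ⌈𝒜.height j x⌉ = ⌈𝒜.height j y⌉ := by
  rw [sameFace_iff_sign]
  refine forall_congr' fun j => ?_
  constructor
  · intro h
    have h1 : ∀ m : ℤ, (m : ℝ) ≤ 𝒜.height j x ↔ (m : ℝ) ≤ 𝒜.height j y := fun m => by
      rw [← sub_nonneg, ← sign_nonneg_iff, h m, sign_nonneg_iff, sub_nonneg]
    have h2 : ∀ m : ℤ, 𝒜.height j x ≤ m ↔ 𝒜.height j y ≤ m := fun m => by
      rw [← sub_nonpos, ← sign_nonpos_iff, h m, sign_nonpos_iff, sub_nonpos]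
    constructor
    · apply le_antisymm
      · exact Int.le_floor.2 ((h1 _).1 (Int.floor_le _))
      · exact Int.le_floor.2 ((h1 _).2 (Int.floor_le _))
    · apply le_antisymm
      · exact Int.ceil_le.2 ((h2 _).2 (Int.le_ceil _))
      · exact Int.ceil_le.2 ((h2 _).1 (Int.le_ceil _))
  · rintro ⟨h1, h2⟩ m
    have h3 : (m : ℝ) ≤ 𝒜.height j x ↔ (m : ℝ) ≤ 𝒜.height j y := by
      rw [← Int.le_floor, h1, Int.le_floor]
    have h4 : 𝒜.height j x ≤ m ↔ 𝒜.height j y ≤ m := by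
      rw [← Int.ceil_le, h2, Int.ceil_le]
    rcases lt_trichotomy (𝒜.height j x) m with h | h | h
    · have : 𝒜.height j y < m := by rw [← not_le, ← h3, not_le]; exact h
      rw [sign_neg (by linarith), sign_neg (by linarith)]
    · have : 𝒜.height j y = m := le_antisymm (h4.1 h.le) (h3.1 h.ge)
      rw [h, this]
    · have : (m : ℝ) < 𝒜.height j y := by rw [← not_le, ← h4, not_le]; exact h
      rw [sign_pos (by linarith), sign_pos (by linarith)]

variable {𝒜} in
theorem SameFace.refl (x : Fin d → ℝ) : 𝒜.SameFace x x := fun _ _ _ => rfl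

variable {𝒜} in
theorem SameFace.symm {x y : Fin d → ℝ} (h : 𝒜.SameFace x y) : 𝒜.SameFace y x :=
  fun j β hβ => (h j β hβ).symm

variable {𝒜} in
theorem SameFace.trans {x y z : Fin d → ℝ} (h : 𝒜.SameFace x y) (h' : 𝒜.SameFace y z) :
    𝒜.SameFace x z :=
  fun j β hβ => (h j β hβ).trans (h' j β hβ)

/-! ### Supports and stars of points -/

/-- The indices of the hyperplane families passing through a point. -/
def support (x : Fin d → ℝ) : Set (Fin n) := {j | ∃ m : ℤ, 𝒜.height j x = m}

/-- The open star of the face of `x`: all points whose face has `x` in its closure. -/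
def star (x : Fin d → ℝ) : Set (Fin d → ℝ) :=
  {y | ∀ j, (⌈𝒜.height j x⌉ : ℝ) - 1 < 𝒜.height j y ∧ 𝒜.height j y < ⌊𝒜.height j x⌋ + 1}

theorem mem_star_self (x : Fin d → ℝ) : x ∈ 𝒜.star x := fun j =>
  ⟨by linarith [Int.ceil_lt_add_one (𝒜.height j x)], Int.lt_floor_add_one _⟩

theorem isOpen_star (x : Fin d → ℝ) : IsOpen (𝒜.star x) := by
  have : 𝒜.star x = ⋂ j, {y | (⌈𝒜.height j x⌉ : ℝ) - 1 < 𝒜.height j y ∧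
      𝒜.height j y < ⌊𝒜.height j x⌋ + 1} := by
    ext y; simp [star]
  rw [this]
  refine isOpen_iInter_of_finite fun j => ?_
  exact (isOpen_lt continuous_const (𝒜.continuous_height j)).inter
    (isOpen_lt (𝒜.continuous_height j) continuous_const)

theorem convex_star (x : Fin d → ℝ) : Convex ℝ (𝒜.star x) := by
  intro y hy z hz a b ha hb hab j
  rw [height_combo _ _ _ _ hab]
  exact convex_Ioo _ _ (hy j) (hz j) ha hb hab

variable {𝒜}

theorem SameFace.star_eq {x y : Fin d → ℝ} (h : 𝒜.SameFace x y) : 𝒜.star x = 𝒜.star y := by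
  rw [sameFace_iff] at h
  simp only [star, (h _).1, (h _).2]

theorem SameFace.mem_star {x y : Fin d → ℝ} (h : 𝒜.SameFace x y) : y ∈ 𝒜.star x :=
  h.star_eq ▸ 𝒜.mem_star_self y

/-- Passing to a point of the star can only raise the ceilings and lower the floors of the heights,
so the intervals defining the star shrink. -/
theorem star_subset_star {x y : Fin d → ℝ} (h : y ∈ 𝒜.star x) : 𝒜.star y ⊆ 𝒜.star x := by
  intro z hz j
  have h1 := h j
  have h2 := hz j
  constructor
  · refine lt_of_le_of_lt ?_ h2.1
    have : ⌈𝒜.height j x⌉ - 1 < ⌈𝒜.height j y⌉ := by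
      rw [Int.lt_ceil]; push_cast; exact h1.1
    have : (⌈𝒜.height j x⌉ : ℝ) ≤ ⌈𝒜.height j y⌉ := by exact_mod_cast (by omega)
    linarith
  · refine lt_of_lt_of_le h2.2 ?_
    have : ⌊𝒜.height j y⌋ < ⌊𝒜.height j x⌋ + 1 := by
      rw [Int.floor_lt]; push_cast; exact h1.2
    have : (⌊𝒜.height j y⌋ : ℝ) ≤ ⌊𝒜.height j x⌋ := by exact_mod_cast (by omega)
    linarith

theorem mem_support_of_mem_star {x y : Fin d → ℝ} (h : y ∈ 𝒜.star x) {j : Fin n}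
    (hj : j ∈ 𝒜.support y) : j ∈ 𝒜.support x := by
  obtain ⟨m, hm⟩ := hj
  have h1 := h j
  rw [hm] at h1
  have h2 : ⌈𝒜.height j x⌉ ≤ m := by
    have : (⌈𝒜.height j x⌉ - 1 : ℤ) < m := by exact_mod_cast h1.1
    omega
  have h3 : m ≤ ⌊𝒜.height j x⌋ := by
    have : m < ⌊𝒜.height j x⌋ + 1 := by exact_mod_cast h1.2
    omega
  exact ⟨m, le_antisymm (Int.ceil_le.1 h2) (Int.le_floor.1 h3)⟩

/-- If the centre lies on a hyperplane of the family, the interval allowed for the height contains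
no other integer. -/
theorem height_eq_of_mem_star {x y : Fin d → ℝ} (h : y ∈ 𝒜.star x) {j : Fin n}
    (hj : j ∈ 𝒜.support y) : 𝒜.height j y = 𝒜.height j x := by
  obtain ⟨m', hm'⟩ := 𝒜.mem_support_of_mem_star h hj
  obtain ⟨m, hm⟩ := hj
  have h1 := h j
  rw [hm, hm', Int.ceil_intCast, Int.floor_intCast] at h1
  have h2 : m' - 1 < m := by exact_mod_cast h1.1
  have h3 : m < m' + 1 := by exact_mod_cast h1.2
  rw [hm, hm']
  exact_mod_cast (by omega : m = m')

theorem mem_support_iff_of_mem_star {x y : Fin d → ℝ} (h : y ∈ 𝒜.star x) {j : Fin n}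
    (hj : j ∈ 𝒜.support x) : j ∈ 𝒜.support y ↔ 𝒜.height j y = 𝒜.height j x :=
  ⟨height_eq_of_mem_star h, fun h' => by obtain ⟨m, hm⟩ := hj; exact ⟨m, by rw [h', hm]⟩⟩

theorem SameFace.support_eq {x y : Fin d → ℝ} (h : 𝒜.SameFace x y) :
    𝒜.support x = 𝒜.support y :=
  Set.Subset.antisymm (fun _ => mem_support_of_mem_star h.symm.mem_star)
    fun _ => mem_support_of_mem_star h.mem_star

/-- Two points of a star lie in the same face if they lie on the same sides of the hyperplanes
through the centre. -/
theorem sameFace_of_mem_star {x y z : Fin d → ℝ} (hy : y ∈ 𝒜.star x) (hz : z ∈ 𝒜.star x)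
    (h : ∀ j ∈ 𝒜.support x, SignType.sign (𝒜.height j y - 𝒜.height j x) =
      SignType.sign (𝒜.height j z - 𝒜.height j x)) : 𝒜.SameFace y z := by
  rw [sameFace_iff_sign]
  intro j m
  have hy := hy j
  have hz := hz j
  -- A family through the centre stays strictly within one unit of its level, so only the hyperplane
  -- through the centre can distinguish the two points; a family missing the centre misses the whole
  -- star.
  by_cases hj : j ∈ 𝒜.support x
  · have h := h j hj
    obtain ⟨k, hk⟩ := hj
    rw [hk] at h hy hz
    simp only [Int.ceil_intCast, Int.floor_intCast] at hy hz
    rcases lt_trichotomy m k with hm | rfl | hm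
    · have : (m : ℝ) ≤ k - 1 := by exact_mod_cast (by omega : m ≤ k - 1)
      rw [sign_pos (by linarith), sign_pos (by linarith)]
    · exact h
    · have : (k : ℝ) + 1 ≤ m := by exact_mod_cast (by omega : k + 1 ≤ m)
      rw [sign_neg (by linarith), sign_neg (by linarith)]
  · rcases lt_or_ge (𝒜.height j x) m with hm | hm
    · have : (⌊𝒜.height j x⌋ : ℝ) + 1 ≤ m := by
        exact_mod_cast (by rw [Int.add_one_le_iff, Int.floor_lt]; exact hm :
          ⌊𝒜.height j x⌋ + 1 ≤ m)
      rw [sign_neg (by linarith), sign_neg (by linarith)]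
    · have hm : (m : ℝ) < 𝒜.height j x := lt_of_le_of_ne hm fun e => hj ⟨m, e.symm⟩
      have : (m : ℝ) ≤ ⌈𝒜.height j x⌉ - 1 := by
        exact_mod_cast (by rw [Int.le_sub_one_iff, Int.lt_ceil]; exact hm :
          m ≤ ⌈𝒜.height j x⌉ - 1)
      rw [sign_pos (by linarith), sign_pos (by linarith)]

theorem sameFace_of_mem_star_of_height_eq {x y : Fin d → ℝ} (hy : y ∈ 𝒜.star x)
    (h : ∀ j ∈ 𝒜.support x, 𝒜.height j y = 𝒜.height j x) : 𝒜.SameFace x y :=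
  sameFace_of_mem_star (𝒜.mem_star_self x) hy fun j hj => by rw [h j hj]

/-- The half-open segment towards the centre of a star stays in one face. -/
theorem sameFace_lineMap {x y : Fin d → ℝ} (hy : y ∈ 𝒜.star x) {t : ℝ} (h0 : 0 < t)
    (h1 : t ≤ 1) : 𝒜.SameFace y ((1 - t) • x + t • y) := by
  refine sameFace_of_mem_star hy (𝒜.convex_star x (𝒜.mem_star_self x) hy (by linarith) h0.le
    (by ring)) fun j _ => ?_
  rw [height_combo _ _ _ _ (by ring)]
  rw [show (1 - t) * 𝒜.height j x + t * 𝒜.height j y - 𝒜.height j x =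
    t * (𝒜.height j y - 𝒜.height j x) by ring, sign_mul, sign_pos h0, one_mul]

theorem eventually_mem_star (x w : Fin d → ℝ) {U : Set (Fin d → ℝ)} (hU : IsOpen U)
    (hx : x ∈ U) : ∃ ε > (0 : ℝ), ∀ t : ℝ, |t| ≤ ε → x + t • w ∈ U ∩ 𝒜.star x := by
  have h : Filter.Tendsto (fun t : ℝ => x + t • w) (nhds 0) (nhds x) := by
    have : Continuous fun t : ℝ => x + t • w := by fun_prop
    simpa using this.tendsto 0
  have := h ((hU.inter (𝒜.isOpen_star x)).mem_nhds ⟨hx, 𝒜.mem_star_self x⟩)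
  obtain ⟨ε, hε, h⟩ := Metric.mem_nhds_iff.1 (Filter.mem_map.1 this)
  refine ⟨ε / 2, by positivity, fun t ht => h ?_⟩
  simp only [Metric.mem_ball, dist_zero_right, Real.norm_eq_abs]
  linarith

/-- Inside the star, a hyperplane through the perturbed point already passes through the centre at
the same level, so the move is parallel to it. -/
theorem mem_support_perturb {x w : Fin d → ℝ} {t : ℝ} (ht : t ≠ 0) (h : x + t • w ∈ 𝒜.star x)
    {j : Fin n} : j ∈ 𝒜.support (x + t • w) ↔ j ∈ 𝒜.support x ∧ 𝒜.ell j w = 0 := by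
  constructor
  · intro hj
    have := height_eq_of_mem_star h hj
    rw [height_add, map_smul, smul_eq_mul] at this
    exact ⟨mem_support_of_mem_star h hj, by
      rcases mul_eq_zero.1 (by linarith : t * 𝒜.ell j w = 0) with h | h
      · exact absurd h ht
      · exact h⟩
  · rintro ⟨hj, hw⟩
    rw [mem_support_iff_of_mem_star h hj, height_add, map_smul, hw]
    simp

end EllipticArrangement

namespace EllipticArrangement
variable {d n : ℕ} (𝒜 : EllipticArrangement d n)
variable {𝒜}

/-! ### Generic points and galleries -/

variable (𝒜) in
/-- A point is generic for a direction `K` if every hyperplane through it is parallel to `K`. -/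
def IsGeneric (K : Submodule ℝ (Fin d → ℝ)) (x : Fin d → ℝ) : Prop :=
  ∀ i ∈ 𝒜.support x, K ≤ LinearMap.ker (𝒜.ell i)

variable (𝒜) in
theorem exists_generic_direction (K : Submodule ℝ (Fin d → ℝ)) :
    ∃ w ∈ K, ∀ i, ¬ K ≤ LinearMap.ker (𝒜.ell i) → 𝒜.ell i w ≠ 0 := by
  -- Finitely many proper subspaces do not cover `K`.
  obtain ⟨w, hw, h⟩ := Module.Dual.exists_forall_mem_ne_zero_of_forall_exists (p := K)
    (f := fun i : {i // ¬ K ≤ LinearMap.ker (𝒜.ell i)} => (𝒜.ell i.1 : Module.Dual ℝ _))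
    fun i => by
      obtain ⟨v, hv, h⟩ := SetLike.not_le_iff_exists.1 i.2
      exact ⟨v, hv, h⟩
  exact ⟨w, hw, fun i hi => h ⟨i, hi⟩⟩

theorem exists_isGeneric (K : Submodule ℝ (Fin d → ℝ)) {U : Set (Fin d → ℝ)} (hU : IsOpen U)
    {x : Fin d → ℝ} (hx : x ∈ U) :
    ∃ y ∈ U ∩ 𝒜.star x, y - x ∈ K ∧ 𝒜.IsGeneric K y := by
  obtain ⟨w, hw, h⟩ := 𝒜.exists_generic_direction K
  obtain ⟨ε, hε, hs⟩ := 𝒜.eventually_mem_star x w hU hx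
  have hs := hs ε (abs_of_pos hε).le
  refine ⟨_, hs, by simpa using K.smul_mem _ hw, fun i hi => ?_⟩
  by_contra hK
  exact h i hK ((mem_support_perturb hε.ne' hs.2).1 hi).2

/-- Forms on `K` with nested kernels are proportional. Consequently one sign decides the sides of
all hyperplanes through a point that is generic in a cut. -/
theorem exists_ell_proportional {K : Submodule ℝ (Fin d → ℝ)} {j : Fin n}
    (hj : ¬ K ≤ LinearMap.ker (𝒜.ell j)) {i : Fin n}
    (h : K ⊓ LinearMap.ker (𝒜.ell j) ≤ LinearMap.ker (𝒜.ell i)) :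
    ∃ c : ℝ, ∀ v ∈ K, 𝒜.ell i v = c * 𝒜.ell j v := by
  obtain ⟨w, hw, hjw⟩ := SetLike.not_le_iff_exists.1 hj
  have hjw : 𝒜.ell j w ≠ 0 := hjw
  refine ⟨𝒜.ell i w / 𝒜.ell j w, fun v hv => ?_⟩
  have : v - (𝒜.ell j v / 𝒜.ell j w) • w ∈ LinearMap.ker (𝒜.ell i) :=
    h ⟨K.sub_mem hv (K.smul_mem _ hw), by simp [hjw]⟩
  simp only [LinearMap.mem_ker, map_sub, map_smul, smul_eq_mul] at this
  field_simp at this ⊢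
  linarith

variable (𝒜) in
/-- The hyperplanes that cut the section of `U` by the affine subspace through `x` of
direction `K`. -/
def cuts (x : Fin d → ℝ) (K : Submodule ℝ (Fin d → ℝ)) (U : Set (Fin d → ℝ)) :
    Set (Fin n × ℤ) :=
  {p | ∃ y ∈ U, y - x ∈ K ∧ 𝒜.height p.1 y = p.2 ∧ ¬ K ≤ LinearMap.ker (𝒜.ell p.1)}

theorem cuts_mono {x : Fin d → ℝ} {K : Submodule ℝ (Fin d → ℝ)} {U U' : Set (Fin d → ℝ)}
    (h : U ⊆ U') : 𝒜.cuts x K U ⊆ 𝒜.cuts x K U' :=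
  fun _ ⟨y, hy, h'⟩ => ⟨y, h hy, h'⟩

theorem finite_cuts_star (x₀ x : Fin d → ℝ) (K : Submodule ℝ (Fin d → ℝ)) :
    (𝒜.cuts x₀ K (𝒜.star x)).Finite := by
  refine Set.Finite.subset (Set.Finite.biUnion Set.finite_univ fun j (_ : j ∈ Set.univ) =>
    (Set.finite_Icc ⌈𝒜.height j x⌉ ⌊𝒜.height j x⌋).image fun m : ℤ => (j, m)) ?_
  rintro ⟨j, m⟩ ⟨y, hy, -, hm, -⟩
  have h1 := hy j
  rw [hm] at h1
  simp only [Set.mem_iUnion, Set.mem_image, Set.mem_Icc]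
  refine ⟨j, trivial, m, ⟨?_, ?_⟩, rfl⟩
  · have : (⌈𝒜.height j x⌉ - 1 : ℤ) < m := by exact_mod_cast h1.1
    omega
  · have : m < ⌊𝒜.height j x⌋ + 1 := by exact_mod_cast h1.2
    omega

theorem isOpen_above {U : Set (Fin d → ℝ)} (hU : IsOpen U) (j : Fin n) (m : ℝ) :
    IsOpen (U ∩ {y | m < 𝒜.height j y}) :=
  hU.inter (isOpen_lt continuous_const (𝒜.continuous_height j))

theorem isOpen_below {U : Set (Fin d → ℝ)} (hU : IsOpen U) (j : Fin n) (m : ℝ) :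
    IsOpen (U ∩ {y | 𝒜.height j y < m}) :=
  hU.inter (isOpen_lt (𝒜.continuous_height j) continuous_const)

theorem convex_above {U : Set (Fin d → ℝ)} (hU : Convex ℝ U) (j : Fin n) (m : ℝ) :
    Convex ℝ (U ∩ {y | m < 𝒜.height j y}) :=
  hU.inter fun x hx y hy a b ha hb hab => by
    simp only [Set.mem_ofPred_eq] at *
    rw [height_combo _ _ _ _ hab]
    exact convex_Ioi m hx hy ha hb hab

theorem convex_below {U : Set (Fin d → ℝ)} (hU : Convex ℝ U) (j : Fin n) (m : ℝ) :
    Convex ℝ (U ∩ {y | 𝒜.height j y < m}) :=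
  hU.inter fun x hx y hy a b ha hb hab => by
    simp only [Set.mem_ofPred_eq] at *
    rw [height_combo _ _ _ _ hab]
    exact convex_Iio m hx hy ha hb hab

/-- The measure for the inductions below: an open half of `U` no longer meets the hyperplane along
which `U` was divided. -/
theorem ncard_cuts_lt {x : Fin d → ℝ} {K : Submodule ℝ (Fin d → ℝ)} {U U' : Set (Fin d → ℝ)}
    (hfin : (𝒜.cuts x K U).Finite) (h : U' ⊆ U) {j : Fin n} {m : ℤ}
    (hm : (j, m) ∈ 𝒜.cuts x K U) (hU' : ∀ y ∈ U', 𝒜.height j y ≠ m) :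
    (𝒜.cuts x K U').ncard < (𝒜.cuts x K U).ncard :=
  Set.ncard_lt_ncard ⟨cuts_mono h, fun hs => by
    obtain ⟨y, hy, -, h, -⟩ := hs hm
    exact hU' y hy h⟩ hfin

/-- Two generic points of a convex set that is not cut by any hyperplane lie in the same face. -/
theorem sameFace_of_cuts_eq_empty {x : Fin d → ℝ} {K : Submodule ℝ (Fin d → ℝ)}
    {U : Set (Fin d → ℝ)} (hU : Convex ℝ U) (h : 𝒜.cuts x K U = ∅) {y z : Fin d → ℝ}
    (hy : y ∈ U) (hz : z ∈ U) (hyK : y - x ∈ K) (hzK : z - x ∈ K) (hgy : 𝒜.IsGeneric K y)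
    (hgz : 𝒜.IsGeneric K z) : 𝒜.SameFace y z := by
  rw [sameFace_iff_sign]
  -- The height of a hyperplane parallel to `K` is constant on the section. Any other hyperplane
  -- weakly between the points would meet the segment joining them, by the intermediate value
  -- theorem, and would be a cut.
  have key : ∀ y z : Fin d → ℝ, y ∈ U → z ∈ U → y - x ∈ K → z - x ∈ K → 𝒜.IsGeneric K y →
      ∀ (j : Fin n) (m : ℤ), 𝒜.height j y ≤ m → (m : ℝ) ≤ 𝒜.height j z →
      𝒜.height j y = m ∧ 𝒜.height j z = m := by
    intro y z hy hz hyK hzK hgy j m h1 h2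
    have hyz : z - y ∈ K := by simpa using K.sub_mem hzK hyK
    by_cases hK : K ≤ LinearMap.ker (𝒜.ell j)
    · have h3 : 𝒜.ell j (z - y) = 0 := hK hyz
      have := 𝒜.height_sub_height j y z
      constructor <;> linarith
    · exfalso
      have hc : ContinuousOn (fun t : ℝ => 𝒜.height j ((1 - t) • y + t • z)) (Set.Icc 0 1) := by
        apply Continuous.continuousOn
        exact (𝒜.continuous_height j).comp (by fun_prop)
      have := intermediate_value_Icc (zero_le_one) hc
      obtain ⟨t, ⟨ht0, ht1⟩, ht⟩ := this (show (m : ℝ) ∈ _ by simpa using ⟨h1, h2⟩)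
      have hmem : (j, m) ∈ 𝒜.cuts x K U := by
        refine ⟨_, hU hy hz (by linarith) ht0 (by ring), ?_, ht, hK⟩
        have : (1 - t) • y + t • z - x = (y - x) + t • (z - y) := by
          rw [sub_smul, one_smul, smul_sub]; abel
        rw [this]
        exact K.add_mem hyK (K.smul_mem _ hyz)
      rw [h] at hmem
      exact hmem
  intro j m
  rcases lt_trichotomy (𝒜.height j y) m with h1 | h1 | h1
  · have h2 : 𝒜.height j z < m := by
      by_contra h2
      have := key y z hy hz hyK hzK hgy j m h1.le (not_lt.1 h2)
      linarith
    rw [sign_neg (by linarith), sign_neg (by linarith)]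
  · have h2 : 𝒜.height j z = m := by
      rcases le_total (𝒜.height j z) m with h2 | h2
      · exact (key z y hz hy hzK hyK hgz j m h2 h1.ge).1
      · exact (key y z hy hz hyK hzK hgy j m h1.le h2).2
    rw [h1, h2]
  · have h2 : (m : ℝ) < 𝒜.height j z := by
      by_contra h2
      have := key z y hz hy hzK hyK hgz j m (not_lt.1 h2) h1.le
      linarith
    rw [sign_pos (by linarith), sign_pos (by linarith)]

/-- Gallery connectedness: a function that is constant on faces and does not change across the
generic points of the cuts takes the same value at all generic points of a convex open set. -/
theorem eq_of_gallery {α : Type*} (κ : (Fin d → ℝ) → α)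
    (hκ : ∀ y z, 𝒜.SameFace y z → κ y = κ z) (x : Fin d → ℝ) (K : Submodule ℝ (Fin d → ℝ))
    {U : Set (Fin d → ℝ)} (hU : IsOpen U) (hUc : Convex ℝ U) (hfin : (𝒜.cuts x K U).Finite)
    (hcross : ∀ y ∈ U, y - x ∈ K → ∀ j ∈ 𝒜.support y, ¬ K ≤ LinearMap.ker (𝒜.ell j) →
      𝒜.IsGeneric (K ⊓ LinearMap.ker (𝒜.ell j)) y →
      ∀ z ∈ U ∩ 𝒜.star y, ∀ z' ∈ U ∩ 𝒜.star y, z - x ∈ K → z' - x ∈ K →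
      𝒜.IsGeneric K z → 𝒜.IsGeneric K z' → κ z = κ z')
    {z z' : Fin d → ℝ} (hz : z ∈ U) (hz' : z' ∈ U) (hzK : z - x ∈ K) (hzK' : z' - x ∈ K)
    (hg : 𝒜.IsGeneric K z) (hg' : 𝒜.IsGeneric K z') : κ z = κ z' := by
  -- Induction on the number of cuts: `U` is divided along one of them, and only the passage between
  -- the two halves remains.
  induction hN : (𝒜.cuts x K U).ncard using Nat.strong_induction_on generalizing U z z' with
  | _ N IH =>
  rcases Set.eq_empty_or_nonempty (𝒜.cuts x K U) with he | ⟨⟨j, m⟩, hjm⟩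
  · exact hκ _ _ (sameFace_of_cuts_eq_empty hUc he hz hz' hzK hzK' hg hg')
  obtain ⟨y₀, hy₀, hy₀K, hy₀m, hK⟩ := id hjm
  simp only at hy₀m hK
  have habove : ∀ z z', z ∈ U → z' ∈ U → z - x ∈ K → z' - x ∈ K → 𝒜.IsGeneric K z →
      𝒜.IsGeneric K z' → (m : ℝ) < 𝒜.height j z → (m : ℝ) < 𝒜.height j z' → κ z = κ z' := by
    intro z z' hz hz' hzK hzK' hg hg' h h'
    refine IH _ ?_ (isOpen_above hU j m) (convex_above hUc j m)
      (hfin.subset (cuts_mono Set.inter_subset_left)) ?_ ⟨hz, h⟩ ⟨hz', h'⟩ hzK hzK' hg hg' rfl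
    · rw [← hN]
      exact ncard_cuts_lt hfin Set.inter_subset_left hjm fun y hy => ne_of_gt hy.2
    · intro y hy hyK i hi hiK hgi w hw w' hw'
      exact hcross y hy.1 hyK i hi hiK hgi w ⟨hw.1.1, hw.2⟩ w' ⟨hw'.1.1, hw'.2⟩
  have hbelow : ∀ z z', z ∈ U → z' ∈ U → z - x ∈ K → z' - x ∈ K → 𝒜.IsGeneric K z →
      𝒜.IsGeneric K z' → 𝒜.height j z < m → 𝒜.height j z' < m → κ z = κ z' := by
    intro z z' hz hz' hzK hzK' hg hg' h h'
    refine IH _ ?_ (isOpen_below hU j m) (convex_below hUc j m)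
      (hfin.subset (cuts_mono Set.inter_subset_left)) ?_ ⟨hz, h⟩ ⟨hz', h'⟩ hzK hzK' hg hg' rfl
    · rw [← hN]
      exact ncard_cuts_lt hfin Set.inter_subset_left hjm fun y hy => ne_of_lt hy.2
    · intro y hy hyK i hi hiK hgi w hw w' hw'
      exact hcross y hy.1 hyK i hi hiK hgi w ⟨hw.1.1, hw.2⟩ w' ⟨hw'.1.1, hw'.2⟩
  -- The halves are joined at a point that is generic within the chosen cut, where `hcross` applies.
  obtain ⟨y, ⟨hyU, hys⟩, hyK, hyg⟩ := 𝒜.exists_isGeneric (K ⊓ LinearMap.ker (𝒜.ell j)) hU hy₀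
  have hyx : y - x ∈ K := by simpa using K.add_mem hyK.1 hy₀K
  have hym : 𝒜.height j y = m := by
    have h1 := 𝒜.height_sub_height j y₀ y
    rw [show 𝒜.ell j (y - y₀) = 0 from hyK.2] at h1
    linarith
  -- Small steps along `w` and `-w` lead to generic points on the two sides of the cut.
  obtain ⟨w, hw, hwg⟩ := 𝒜.exists_generic_direction K
  obtain ⟨ε, hε, hs⟩ := 𝒜.eventually_mem_star y w hU hyU
  have hjw := hwg j hK
  have hgen : ∀ t : ℝ, t ≠ 0 → |t| ≤ ε → y + t • w ∈ U ∩ 𝒜.star y ∧ y + t • w - x ∈ K ∧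
      𝒜.IsGeneric K (y + t • w) := by
    intro t ht hte
    refine ⟨hs t hte, ?_, fun i hi => ?_⟩
    · rw [add_sub_right_comm]
      exact K.add_mem hyx (K.smul_mem _ hw)
    · by_contra hK
      exact hwg i hK ((mem_support_perturb ht (hs t hte).2).1 hi).2
  have hp := hgen ε hε.ne' (abs_of_pos hε).le
  have hn := hgen (-ε) (by linarith) (by rw [abs_neg, abs_of_pos hε])
  have hpn := hcross y hyU hyx j ⟨m, hym⟩ hK hyg _ hp.1 _ hn.1 hp.2.1 hn.2.1 hp.2.2 hn.2.2
  have hne : ∀ z, z - x ∈ K → 𝒜.IsGeneric K z → 𝒜.height j z ≠ m := fun z _ hg e =>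
    hK (hg j ⟨m, e⟩)
  -- Which of the two points lies above depends on the sign of `ell j w`.
  have hbridge : ∃ a b : Fin d → ℝ, (a ∈ U ∧ a - x ∈ K ∧ 𝒜.IsGeneric K a) ∧
      (b ∈ U ∧ b - x ∈ K ∧ 𝒜.IsGeneric K b) ∧ (m : ℝ) < 𝒜.height j a ∧ 𝒜.height j b < m ∧
      κ a = κ b := by
    rcases lt_or_gt_of_ne hjw with hlt | hgt
    · refine ⟨_, _, ⟨hn.1.1, hn.2⟩, ⟨hp.1.1, hp.2⟩, ?_, ?_, hpn.symm⟩ <;>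
        rw [height_add, map_smul, smul_eq_mul, hym] <;> nlinarith
    · refine ⟨_, _, ⟨hp.1.1, hp.2⟩, ⟨hn.1.1, hn.2⟩, ?_, ?_, hpn⟩ <;>
        rw [height_add, map_smul, smul_eq_mul, hym] <;> nlinarith
  obtain ⟨a, b, ha, hb, ham, hbm, hab⟩ := hbridge
  rcases lt_or_gt_of_ne (hne z hzK hg) with h1 | h1 <;>
    rcases lt_or_gt_of_ne (hne z' hzK' hg') with h2 | h2
  · exact hbelow z z' hz hz' hzK hzK' hg hg' h1 h2
  · rw [hbelow z b hz hb.1 hzK hb.2.1 hg hb.2.2 h1 hbm, ← hab,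
      habove a z' ha.1 hz' ha.2.1 hzK' ha.2.2 hg' ham h2]
  · rw [habove z a hz ha.1 hzK ha.2.1 hg ha.2.2 h1 ham, hab,
      hbelow b z' hb.1 hz' hb.2.1 hzK' hb.2.2 hg' hbm h2]
  · exact habove z z' hz hz' hzK hzK' hg hg' h1 h2

end EllipticArrangement

namespace EllipticArrangement
variable {d n : ℕ} (𝒜 : EllipticArrangement d n)
variable {𝒜}

/-! ### Codimension of faces -/

variable (𝒜) in
/-- The direction of the affine span of the face of `x`. -/
def direction (x : Fin d → ℝ) : Submodule ℝ (Fin d → ℝ) :=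
  ⨅ j : 𝒜.support x, LinearMap.ker (𝒜.ell j)

theorem mem_direction {x w : Fin d → ℝ} :
    w ∈ 𝒜.direction x ↔ ∀ j ∈ 𝒜.support x, 𝒜.ell j w = 0 := by
  simp [direction, Submodule.mem_iInf]

/-- Heights in the support are constant on the face, and a small move that preserves them stays in
the face. Codimension can thus be read off from the support. -/
theorem vectorSpan_face (x : Fin d → ℝ) :
    vectorSpan ℝ {y | 𝒜.SameFace x y} = 𝒜.direction x := by
  apply le_antisymm
  · rw [vectorSpan, Submodule.span_le]
    rintro _ ⟨y, hy, z, hz, rfl⟩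
    rw [SetLike.mem_coe, mem_direction]
    intro j hj
    have h1 := (mem_support_iff_of_mem_star hy.mem_star hj).1 (hy.support_eq ▸ hj)
    have h2 := (mem_support_iff_of_mem_star hz.mem_star hj).1 (hz.support_eq ▸ hj)
    have := 𝒜.height_sub_height j z y
    simp only [vsub_eq_sub]
    linarith
  · intro w hw
    rw [mem_direction] at hw
    obtain ⟨ε, hε, h⟩ := 𝒜.eventually_mem_star x w isOpen_univ trivial
    have h := (h ε (abs_of_pos hε).le).2
    have hs : 𝒜.SameFace x (x + ε • w) := sameFace_of_mem_star_of_height_eq h fun j hj => by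
      rw [height_add, map_smul, hw j hj]; simp
    have := vsub_mem_vectorSpan ℝ (s := {y | 𝒜.SameFace x y}) hs (SameFace.refl x)
    rw [vsub_eq_sub, add_sub_cancel_left] at this
    simpa [smul_smul, hε.ne'] using Submodule.smul_mem _ ε⁻¹ this

theorem finrank_ker_ell (j : Fin n) : Module.finrank ℝ (LinearMap.ker (𝒜.ell j)) + 1 = d := by
  have := Module.Dual.finrank_ker_add_one_of_ne_zero (f := (𝒜.ell j : Module.Dual ℝ _))
    (𝒜.ell_ne_zero j)
  simpa using this

theorem finrank_inf_ker_ell {K : Submodule ℝ (Fin d → ℝ)} {j : Fin n}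
    (h : ¬ K ≤ LinearMap.ker (𝒜.ell j)) :
    Module.finrank ℝ (K ⊓ LinearMap.ker (𝒜.ell j) : Submodule ℝ (Fin d → ℝ)) + 1 =
      Module.finrank ℝ K := by
  have hne : (𝒜.ell j).domRestrict K ≠ 0 := by
    obtain ⟨v, hv, h⟩ := SetLike.not_le_iff_exists.1 h
    intro e
    exact h (LinearMap.congr_fun e ⟨v, hv⟩)
  have := Module.Dual.finrank_ker_add_one_of_ne_zero (f := ((𝒜.ell j).domRestrict K :
    Module.Dual ℝ K)) hne
  rw [← this, ← Submodule.finrank_map_subtype_eq, LinearMap.ker_domRestrict,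
    Submodule.map_comap_subtype]

theorem direction_eq_of_isGeneric {x : Fin d → ℝ} {j : Fin n} (hj : j ∈ 𝒜.support x)
    (h : 𝒜.IsGeneric (LinearMap.ker (𝒜.ell j)) x) : 𝒜.direction x = LinearMap.ker (𝒜.ell j) :=
  le_antisymm (fun _ hw => mem_direction.1 hw j hj) fun _ hw =>
    mem_direction.2 fun i hi => h i hi hw

theorem codim_zero_iff {x : Fin d → ℝ} :
    Module.finrank ℝ (𝒜.direction x) + 0 = d ↔ 𝒜.support x = ∅ := by
  constructor
  · intro h
    have : 𝒜.direction x = ⊤ := Submodule.eq_top_of_finrank_eq (by simpa using h)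
    by_contra hne
    obtain ⟨j, hj⟩ := Set.nonempty_iff_ne_empty.2 hne
    apply 𝒜.ell_ne_zero j
    exact LinearMap.ext fun v => mem_direction.1 (this ▸ Submodule.mem_top) j hj
  · intro h
    have : 𝒜.direction x = ⊤ := by
      rw [eq_top_iff]
      intro w _
      rw [mem_direction, h]
      simp
    rw [this]; simp

/-- Each form has a kernel of codimension one, so the intersection of the kernels has codimension
one exactly when there is a form in the support and all of them have the same kernel. -/
theorem codim_one_iff {x : Fin d → ℝ} : Module.finrank ℝ (𝒜.direction x) + 1 = d ↔
    ∃ j ∈ 𝒜.support x, 𝒜.IsGeneric (LinearMap.ker (𝒜.ell j)) x := by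
  constructor
  · intro h
    have hne : (𝒜.support x).Nonempty := by
      rw [Set.nonempty_iff_ne_empty]
      intro he
      have := codim_zero_iff.2 he
      omega
    obtain ⟨j, hj⟩ := hne
    refine ⟨j, hj, fun i hi => ?_⟩
    have key : ∀ i ∈ 𝒜.support x, 𝒜.direction x = LinearMap.ker (𝒜.ell i) := fun i hi => by
      apply Submodule.eq_of_le_of_finrank_eq (fun _ hw => mem_direction.1 hw i hi)
      have := 𝒜.finrank_ker_ell i
      omega
    rw [← key j hj, key i hi]
  · rintro ⟨j, hj, h⟩
    rw [direction_eq_of_isGeneric hj h, finrank_ker_ell]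

/-- Two independent forms cut out codimension two, and by genericity no other hyperplane through `x`
lowers the dimension. -/
theorem codim_two_of_isGeneric {x : Fin d → ℝ} {i j : Fin n} (hi : i ∈ 𝒜.support x)
    (hj : j ∈ 𝒜.support x) (hij : ¬ LinearMap.ker (𝒜.ell j) ≤ LinearMap.ker (𝒜.ell i))
    (h : 𝒜.IsGeneric (LinearMap.ker (𝒜.ell j) ⊓ LinearMap.ker (𝒜.ell i)) x) :
    Module.finrank ℝ (𝒜.direction x) + 2 = d := by
  have : 𝒜.direction x = LinearMap.ker (𝒜.ell j) ⊓ LinearMap.ker (𝒜.ell i) :=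
    le_antisymm (fun _ hw => ⟨mem_direction.1 hw j hj, mem_direction.1 hw i hi⟩) fun _ hw =>
      mem_direction.2 fun i hi => h i hi hw
  have h1 := finrank_inf_ker_ell hij
  have h2 := 𝒜.finrank_ker_ell j
  rw [this]; omega

theorem isGeneric_ker_of_mem_support {x : Fin d → ℝ} (h : Module.finrank ℝ (𝒜.direction x) + 1 = d)
    {j : Fin n} (hj : j ∈ 𝒜.support x) : 𝒜.IsGeneric (LinearMap.ker (𝒜.ell j)) x := by
  obtain ⟨i, hi, hg⟩ := codim_one_iff.1 h
  have h1 : LinearMap.ker (𝒜.ell i) = LinearMap.ker (𝒜.ell j) := by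
    apply Submodule.eq_of_le_of_finrank_eq (hg j hj)
    have := 𝒜.finrank_ker_ell i
    have := 𝒜.finrank_ker_ell j
    omega
  rwa [← h1]

/-! ### Lifted faces and their points -/

namespace LiftedFace

variable {c c' : ℕ}

/-- A point of a lifted face. -/
def pt (F : 𝒜.LiftedFace c) : Fin d → ℝ := F.2.1.choose

theorem eq_face (F : 𝒜.LiftedFace c) : F.1 = {y | 𝒜.SameFace F.pt y} := F.2.1.choose_spec

theorem mem_iff {F : 𝒜.LiftedFace c} {y : Fin d → ℝ} : y ∈ F.1 ↔ 𝒜.SameFace F.pt y := by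
  rw [F.eq_face]; rfl

theorem pt_mem (F : 𝒜.LiftedFace c) : F.pt ∈ F.1 := mem_iff.2 (SameFace.refl _)

theorem codim (F : 𝒜.LiftedFace c) : Module.finrank ℝ (𝒜.direction F.pt) + c = d := by
  rw [← vectorSpan_face, ← eq_face]; exact F.2.2

theorem sameFace {F : 𝒜.LiftedFace c} {x y : Fin d → ℝ} (hx : x ∈ F.1) (hy : y ∈ F.1) :
    𝒜.SameFace x y := (mem_iff.1 hx).symm.trans (mem_iff.1 hy)

theorem mem_of_sameFace {F : 𝒜.LiftedFace c} {x y : Fin d → ℝ} (hx : x ∈ F.1)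
    (h : 𝒜.SameFace x y) : y ∈ F.1 := mem_iff.2 ((mem_iff.1 hx).trans h)

theorem eq_of_mem {F G : 𝒜.LiftedFace c} {x : Fin d → ℝ} (hF : x ∈ F.1) (hG : x ∈ G.1) :
    F = G := by
  apply Subtype.ext
  ext y
  exact ⟨fun hy => mem_of_sameFace hG (sameFace hF hy),
    fun hy => mem_of_sameFace hF (sameFace hG hy)⟩

theorem support_eq {F : 𝒜.LiftedFace c} {x : Fin d → ℝ} (hx : x ∈ F.1) :
    𝒜.support x = 𝒜.support F.pt := (mem_iff.1 hx).support_eq.symm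

theorem star_eq {F : 𝒜.LiftedFace c} {x : Fin d → ℝ} (hx : x ∈ F.1) :
    𝒜.star x = 𝒜.star F.pt := (mem_iff.1 hx).star_eq.symm

theorem direction_eq {F : 𝒜.LiftedFace c} {x : Fin d → ℝ} (hx : x ∈ F.1) :
    𝒜.direction x = 𝒜.direction F.pt := by
  rw [direction, direction, support_eq hx]

/-- A lifted face lies in the star of a point as soon as one of its points does. -/
theorem pt_mem_star_iff {F : 𝒜.LiftedFace c} {x y : Fin d → ℝ} (hy : y ∈ F.1) :
    F.pt ∈ 𝒜.star x ↔ y ∈ 𝒜.star x :=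
  ⟨fun h => star_subset_star h (mem_iff.1 hy).mem_star,
    fun h => star_subset_star h (mem_iff.1 hy).symm.mem_star⟩

theorem subset_star {F : 𝒜.LiftedFace c} {x : Fin d → ℝ} (h : F.pt ∈ 𝒜.star x) :
    F.1 ⊆ 𝒜.star x := fun _ hy => (pt_mem_star_iff hy).1 h

/-- The star is open and contains a face as soon as it meets it; conversely, a segment towards the
centre remains in one face until its end. This turns the incidences in the definitions into
inequalities for heights. -/
theorem subset_closure_iff {F : 𝒜.LiftedFace c} {G : 𝒜.LiftedFace c'} :
    F.1 ⊆ closure G.1 ↔ G.pt ∈ 𝒜.star F.pt := by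
  constructor
  · intro h
    obtain ⟨y, hy, hyG⟩ := mem_closure_iff.1 (h F.pt_mem) _ (𝒜.isOpen_star F.pt)
      (𝒜.mem_star_self _)
    exact (pt_mem_star_iff hyG).2 hy
  · intro h x hx
    have hG : G.pt ∈ 𝒜.star x := star_eq hx ▸ h
    have hlim : Filter.Tendsto (fun t : ℝ => (1 - t) • x + t • G.pt) (nhdsWithin 0 (Set.Ioi 0))
        (nhds x) := by
      have : Continuous fun t : ℝ => (1 - t) • x + t • G.pt := by fun_prop
      simpa using (this.tendsto 0).mono_left nhdsWithin_le_nhds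
    refine mem_closure_of_tendsto hlim ?_
    filter_upwards [Ioc_mem_nhdsGT (zero_lt_one' ℝ)] with t ht
    exact mem_iff.2 (sameFace_lineMap hG ht.1 ht.2)

end LiftedFace

variable (𝒜) in
/-- The face of a point, as a lifted face of its codimension. -/
def faceAt (c : ℕ) (x : Fin d → ℝ) (h : Module.finrank ℝ (𝒜.direction x) + c = d) :
    𝒜.LiftedFace c :=
  ⟨{y | 𝒜.SameFace x y}, ⟨x, rfl⟩, by rw [vectorSpan_face, h]⟩

theorem mem_faceAt {c : ℕ} {x : Fin d → ℝ} (h : Module.finrank ℝ (𝒜.direction x) + c = d) :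
    x ∈ (𝒜.faceAt c x h).1 := SameFace.refl x

theorem support_chamber {C : 𝒜.LiftedFace 0} {x : Fin d → ℝ} (hx : x ∈ C.1) :
    𝒜.support x = ∅ := by
  rw [LiftedFace.support_eq hx]; exact codim_zero_iff.1 C.codim

theorem exists_chamber_of_support {x : Fin d → ℝ} (h : 𝒜.support x = ∅) :
    ∃ C : 𝒜.LiftedFace 0, x ∈ C.1 := ⟨_, mem_faceAt (codim_zero_iff.2 h)⟩

theorem isGeneric_top_iff {x : Fin d → ℝ} : 𝒜.IsGeneric ⊤ x ↔ 𝒜.support x = ∅ := by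
  constructor
  · intro hg
    rw [Set.eq_empty_iff_forall_notMem]
    intro j hj
    apply 𝒜.ell_ne_zero j
    exact LinearMap.ext fun v => hg j hj Submodule.mem_top
  · intro h i hi
    rw [h] at hi
    exact hi.elim

theorem exists_chamber_near (x : Fin d → ℝ) : ∃ C : 𝒜.LiftedFace 0, C.pt ∈ 𝒜.star x := by
  obtain ⟨y, hy, -, hg⟩ := exists_isGeneric (𝒜 := 𝒜) ⊤ isOpen_univ (Set.mem_univ x)
  obtain ⟨C, hC⟩ := exists_chamber_of_support (isGeneric_top_iff.1 hg)
  exact ⟨C, (LiftedFace.pt_mem_star_iff hC).2 hy.2⟩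

theorem exists_support_wall (W : 𝒜.LiftedFace 1) : ∃ j, j ∈ 𝒜.support W.pt := by
  obtain ⟨j, hj, -⟩ := codim_one_iff.1 W.codim
  exact ⟨j, hj⟩

theorem lt_height_of_mem_star {x y : Fin d → ℝ} (h : y ∈ 𝒜.star x) {j : Fin n} {m : ℤ}
    (hm : (m : ℝ) < 𝒜.height j x) : (m : ℝ) < 𝒜.height j y := by
  refine lt_of_le_of_lt ?_ (h j).1
  have : m ≤ ⌈𝒜.height j x⌉ - 1 := by rw [Int.le_sub_one_iff, Int.lt_ceil]; exact hm
  exact_mod_cast this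

theorem height_lt_of_mem_star {x y : Fin d → ℝ} (h : y ∈ 𝒜.star x) {j : Fin n} {m : ℤ}
    (hm : 𝒜.height j x < m) : 𝒜.height j y < m := by
  refine lt_of_lt_of_le (h j).2 ?_
  have : ⌊𝒜.height j x⌋ + 1 ≤ m := by rw [Int.add_one_le_iff, Int.floor_lt]; exact hm
  exact_mod_cast this

/-! ### The star of a wall -/

/-- All forms in the support of a wall are multiples of `ell j`, so the sign for `j` determines the
signs for the others. -/
theorem sameFace_of_sign_wall {W : 𝒜.LiftedFace 1} {j : Fin n} (hj : j ∈ 𝒜.support W.pt)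
    {y z : Fin d → ℝ} (hy : y ∈ 𝒜.star W.pt) (hz : z ∈ 𝒜.star W.pt)
    (h : SignType.sign (𝒜.height j y - 𝒜.height j W.pt) =
      SignType.sign (𝒜.height j z - 𝒜.height j W.pt)) : 𝒜.SameFace y z := by
  refine sameFace_of_mem_star hy hz fun i hi => ?_
  have hker := isGeneric_ker_of_mem_support W.codim hj i hi
  obtain ⟨c, hc⟩ := exists_ell_proportional (𝒜 := 𝒜) (K := ⊤) (j := j) (i := i)
    (fun h => 𝒜.ell_ne_zero j (LinearMap.ext fun v => h Submodule.mem_top)) (by simpa using hker)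
  rw [height_sub_height, height_sub_height, hc _ trivial, hc _ trivial, sign_mul, sign_mul,
    ← height_sub_height, ← height_sub_height, h]

/-- The star of a wall has at most one face for each sign of a form in the support. The wall takes
the sign zero, and two distinct chambers use up the other two. -/
theorem mem_or_mem_of_mem_star_wall {W : 𝒜.LiftedFace 1} {C C' : 𝒜.LiftedFace 0}
    (hC : C.pt ∈ 𝒜.star W.pt) (hC' : C'.pt ∈ 𝒜.star W.pt) (hne : C ≠ C')
    {y : Fin d → ℝ} (hy : y ∈ 𝒜.star W.pt) : y ∈ W.1 ∨ y ∈ C.1 ∨ y ∈ C'.1 := by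
  obtain ⟨j, hj⟩ := exists_support_wall W
  have key : ∀ D : 𝒜.LiftedFace 0, D.pt ∈ 𝒜.star W.pt →
      SignType.sign (𝒜.height j D.pt - 𝒜.height j W.pt) ≠ 0 := by
    intro D hD h
    rw [sign_eq_zero_iff, sub_eq_zero, ← mem_support_iff_of_mem_star hD hj,
      support_chamber D.pt_mem] at h
    exact h
  have hCC' : SignType.sign (𝒜.height j C.pt - 𝒜.height j W.pt) ≠
      SignType.sign (𝒜.height j C'.pt - 𝒜.height j W.pt) := fun h => hne
    (LiftedFace.eq_of_mem (LiftedFace.mem_of_sameFace C.pt_mem (sameFace_of_sign_wall hj hC hC' h))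
      C'.pt_mem)
  have h1 := key C hC
  have h2 := key C' hC'
  have hW : SignType.sign (𝒜.height j y - 𝒜.height j W.pt) = 0 → y ∈ W.1 := fun h =>
    LiftedFace.mem_of_sameFace W.pt_mem (sameFace_of_sign_wall hj (𝒜.mem_star_self _) hy
      (by rw [h, sub_self, sign_zero]))
  have hyC : SignType.sign (𝒜.height j y - 𝒜.height j W.pt) =
      SignType.sign (𝒜.height j C.pt - 𝒜.height j W.pt) → y ∈ C.1 := fun h =>
    LiftedFace.mem_of_sameFace C.pt_mem (sameFace_of_sign_wall hj hC hy h.symm)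
  have hyC' : SignType.sign (𝒜.height j y - 𝒜.height j W.pt) =
      SignType.sign (𝒜.height j C'.pt - 𝒜.height j W.pt) → y ∈ C'.1 := fun h =>
    LiftedFace.mem_of_sameFace C'.pt_mem (sameFace_of_sign_wall hj hC' hy h.symm)
  generalize SignType.sign (𝒜.height j y - 𝒜.height j W.pt) = s at *
  generalize SignType.sign (𝒜.height j C.pt - 𝒜.height j W.pt) = s₁ at *
  generalize SignType.sign (𝒜.height j C'.pt - 𝒜.height j W.pt) = s₂ at *
  cases s <;> cases s₁ <;> cases s₂ <;> simp_all

theorem chamber_not_wall {W : 𝒜.LiftedFace 1} {C : 𝒜.LiftedFace 0} {x : Fin d → ℝ}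
    (hC : x ∈ C.1) (hW : x ∈ W.1) : False := by
  obtain ⟨j, hj⟩ := exists_support_wall W
  rw [← LiftedFace.support_eq hW, support_chamber hC] at hj
  exact hj

theorem eq_or_eq_of_mem_star_wall {W : 𝒜.LiftedFace 1} {C C' D : 𝒜.LiftedFace 0}
    (hC : C.pt ∈ 𝒜.star W.pt) (hC' : C'.pt ∈ 𝒜.star W.pt) (hne : C ≠ C')
    (hD : D.pt ∈ 𝒜.star W.pt) : D = C ∨ D = C' := by
  rcases mem_or_mem_of_mem_star_wall hC hC' hne hD with h | h | h
  · exact (chamber_not_wall D.pt_mem h).elim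
  · exact Or.inl (LiftedFace.eq_of_mem D.pt_mem h)
  · exact Or.inr (LiftedFace.eq_of_mem D.pt_mem h)

namespace Orientation

variable (o : 𝒜.Orientation)

theorem tail_mem_star (W : 𝒜.LiftedFace 1) : (o.tail W).pt ∈ 𝒜.star W.pt :=
  LiftedFace.subset_closure_iff.1 (o.subset_closure_tail W)

theorem head_mem_star (W : 𝒜.LiftedFace 1) : (o.head W).pt ∈ 𝒜.star W.pt :=
  LiftedFace.subset_closure_iff.1 (o.subset_closure_head W)

theorem eq_tail_or_eq_head {W : 𝒜.LiftedFace 1} {D : 𝒜.LiftedFace 0}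
    (hD : D.pt ∈ 𝒜.star W.pt) : D = o.tail W ∨ D = o.head W :=
  eq_or_eq_of_mem_star_wall (o.tail_mem_star W) (o.head_mem_star W) (o.tail_ne_head W) hD

theorem mem_of_mem_star {W : 𝒜.LiftedFace 1} {y : Fin d → ℝ} (hy : y ∈ 𝒜.star W.pt) :
    y ∈ (o.tail W).1 ∪ W.1 ∪ (o.head W).1 := by
  rcases mem_or_mem_of_mem_star_wall (o.tail_mem_star W) (o.head_mem_star W) (o.tail_ne_head W)
    hy with h | h | h
  · exact Or.inl (Or.inr h)
  · exact Or.inl (Or.inl h)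
  · exact Or.inr h

/-- A hyperplane through a wall separates its two chambers. -/
theorem height_separates {W : 𝒜.LiftedFace 1} {j : Fin n} (hj : j ∈ 𝒜.support W.pt) :
    (𝒜.height j (o.tail W).pt < 𝒜.height j W.pt ∧ 𝒜.height j W.pt < 𝒜.height j (o.head W).pt) ∨
    (𝒜.height j (o.head W).pt < 𝒜.height j W.pt ∧
      𝒜.height j W.pt < 𝒜.height j (o.tail W).pt) := by
  have key : ∀ D : 𝒜.LiftedFace 0, D.pt ∈ 𝒜.star W.pt →
      𝒜.height j D.pt ≠ 𝒜.height j W.pt := by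
    intro D hD h
    rw [← mem_support_iff_of_mem_star hD hj, support_chamber D.pt_mem] at h
    exact h
  have hne : SignType.sign (𝒜.height j (o.tail W).pt - 𝒜.height j W.pt) ≠
      SignType.sign (𝒜.height j (o.head W).pt - 𝒜.height j W.pt) := fun h => o.tail_ne_head W
    (LiftedFace.eq_of_mem (LiftedFace.mem_of_sameFace (o.tail W).pt_mem (sameFace_of_sign_wall hj
      (o.tail_mem_star W) (o.head_mem_star W) h)) (o.head W).pt_mem)
  rcases lt_or_gt_of_ne (key _ (o.tail_mem_star W)) with h1 | h1 <;>
    rcases lt_or_gt_of_ne (key _ (o.head_mem_star W)) with h2 | h2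
  · exact absurd (by rw [sign_neg (by linarith), sign_neg (by linarith)]) hne
  · exact Or.inl ⟨h1, h2⟩
  · exact Or.inr ⟨h2, h1⟩
  · exact absurd (by rw [sign_pos (by linarith), sign_pos (by linarith)]) hne

end Orientation

/-- Chambers of a star are connected by the walls of the star. -/
theorem eq_of_eq_across_walls {α : Type*} (o : 𝒜.Orientation) (κ : 𝒜.LiftedFace 0 → α)
    (x : Fin d → ℝ) (h : ∀ W : 𝒜.LiftedFace 1, W.pt ∈ 𝒜.star x → κ (o.tail W) = κ (o.head W))
    {C C' : 𝒜.LiftedFace 0} (hC : C.pt ∈ 𝒜.star x) (hC' : C'.pt ∈ 𝒜.star x) : κ C = κ C' := by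
  classical
  -- Points outside the chambers get the value `none`; only generic points are compared in the end.
  let κ' : (Fin d → ℝ) → Option α := fun y =>
    if hy : 𝒜.support y = ∅ then some (κ (𝒜.faceAt 0 y (codim_zero_iff.2 hy))) else none
  have hκ' : ∀ (D : 𝒜.LiftedFace 0) (y : Fin d → ℝ), y ∈ D.1 → κ' y = some (κ D) := by
    intro D y hy
    simp only [κ', dif_pos (support_chamber hy)]
    rw [LiftedFace.eq_of_mem (mem_faceAt (codim_zero_iff.2 (support_chamber hy))) hy]
  have := eq_of_gallery κ' (fun y z hyz => ?_) x ⊤ (𝒜.isOpen_star x) (𝒜.convex_star x)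
    (finite_cuts_star x x ⊤) ?_ hC hC' trivial trivial
    (isGeneric_top_iff.2 (support_chamber C.pt_mem))
    (isGeneric_top_iff.2 (support_chamber C'.pt_mem))
  · rw [hκ' C _ C.pt_mem, hκ' C' _ C'.pt_mem] at this
    exact Option.some_injective _ this
  · by_cases hy : 𝒜.support y = ∅
    · obtain ⟨D, hD⟩ := exists_chamber_of_support hy
      rw [hκ' D y hD, hκ' D z (LiftedFace.mem_of_sameFace hD hyz)]
    · simp only [κ', dif_neg hy, dif_neg (hyz.support_eq ▸ hy : ¬ 𝒜.support z = ∅)]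
  · intro y hy _ j hj _ hg z hz z' hz' _ _ hgz hgz'
    rw [top_inf_eq] at hg
    -- A crossing point is generic in a hyperplane, so its face is a wall, and the generic points
    -- near it lie in the tail or the head of this wall.
    have hcod := codim_one_iff.2 ⟨j, hj, hg⟩
    set W := 𝒜.faceAt 1 y hcod
    have hyW : y ∈ W.1 := mem_faceAt hcod
    obtain ⟨D, hD⟩ := exists_chamber_of_support (isGeneric_top_iff.1 hgz)
    obtain ⟨D', hD'⟩ := exists_chamber_of_support (isGeneric_top_iff.1 hgz')
    rw [hκ' D z hD, hκ' D' z' hD']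
    have hWx := h W ((LiftedFace.pt_mem_star_iff hyW).2 hy)
    have hDW := o.eq_tail_or_eq_head ((LiftedFace.pt_mem_star_iff hD).2
      (LiftedFace.star_eq hyW ▸ hz.2))
    have hDW' := o.eq_tail_or_eq_head ((LiftedFace.pt_mem_star_iff hD').2
      (LiftedFace.star_eq hyW ▸ hz'.2))
    rcases hDW with rfl | rfl <;> rcases hDW' with rfl | rfl <;> simp [hWx]

end EllipticArrangement

namespace EllipticArrangement
variable {d n : ℕ} (𝒜 : EllipticArrangement d n)
variable {𝒜}

/-! ### Translations by the lattice -/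

/-- An integral vector as a real vector. -/
def intVec (v : Fin d → ℤ) : Fin d → ℝ := fun k => (v k : ℝ)

theorem intVec_neg (v : Fin d → ℤ) : intVec (-v) = -intVec v := by
  ext k; simp [intVec]

theorem intVec_zero : intVec (0 : Fin d → ℤ) = 0 := by
  ext k; simp [intVec]

theorem intVec_add (v w : Fin d → ℤ) : intVec (v + w) = intVec v + intVec w := by
  ext k; simp [intVec]

variable (𝒜) in
/-- The value of the `j`-th linear form on an integral vector. -/
def ellInt (j : Fin n) (v : Fin d → ℤ) : ℤ := ∑ k, 𝒜.A k j * v k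

theorem ell_intVec (j : Fin n) (v : Fin d → ℤ) : 𝒜.ell j (intVec v) = 𝒜.ellInt j v := by
  simp [ell_apply, ellInt, intVec]

theorem height_add_intVec (j : Fin n) (x : Fin d → ℝ) (v : Fin d → ℤ) :
    𝒜.height j (x + intVec v) = 𝒜.height j x + 𝒜.ellInt j v := by
  rw [height_add, ell_intVec]

theorem SameFace.add_intVec {x y : Fin d → ℝ} (h : 𝒜.SameFace x y) (v : Fin d → ℤ) :
    𝒜.SameFace (x + intVec v) (y + intVec v) := by
  rw [sameFace_iff] at h ⊢
  intro j
  simp [height_add_intVec, (h j).1, (h j).2]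

theorem add_intVec_mem_star {x y : Fin d → ℝ} (v : Fin d → ℤ) :
    y + intVec v ∈ 𝒜.star (x + intVec v) ↔ y ∈ 𝒜.star x := by
  refine forall_congr' fun j => ?_
  simp only [height_add_intVec, Int.ceil_add_intCast, Int.floor_add_intCast]
  push_cast
  constructor <;> rintro ⟨h1, h2⟩ <;> constructor <;> linarith

theorem support_add_intVec (x : Fin d → ℝ) (v : Fin d → ℤ) :
    𝒜.support (x + intVec v) = 𝒜.support x := by
  ext j
  simp only [support, Set.mem_ofPred_eq, height_add_intVec]
  constructor
  · rintro ⟨m, hm⟩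
    exact ⟨m - 𝒜.ellInt j v, by push_cast; linarith⟩
  · rintro ⟨m, hm⟩
    exact ⟨m + 𝒜.ellInt j v, by push_cast; linarith⟩

theorem proj_eq_iff {x y : Fin d → ℝ} : proj x = proj y ↔ ∃ v, y = x + intVec v := by
  constructor
  · intro h
    have h' : ∀ k, ∃ m : ℤ, y k = x k + m := fun k => by
      have hk : ((x k : ℝ) : UnitAddCircle) = (y k : ℝ) := congrFun h k
      rw [QuotientAddGroup.eq, AddSubgroup.mem_zmultiples_iff] at hk
      obtain ⟨m, hm⟩ := hk
      refine ⟨m, ?_⟩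
      simp at hm
      linarith
    choose v hv using h'
    exact ⟨v, funext hv⟩
  · rintro ⟨v, rfl⟩
    ext k
    change ((x k : ℝ) : UnitAddCircle) = ((x k + v k : ℝ) : UnitAddCircle)
    rw [QuotientAddGroup.eq, AddSubgroup.mem_zmultiples_iff]
    exact ⟨v k, by simp⟩

theorem proj_add_intVec (x : Fin d → ℝ) (v : Fin d → ℤ) : proj (x + intVec v) = proj x :=
  (proj_eq_iff.2 ⟨v, rfl⟩).symm

/-- The projection to the torus is injective on faces, since the arrangement is essential. -/
theorem eq_of_sameFace_of_proj_eq {x y : Fin d → ℝ} (h : 𝒜.SameFace x y)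
    (hp : proj x = proj y) : x = y := by
  obtain ⟨v, rfl⟩ := proj_eq_iff.1 hp
  -- A translation within a face leaves all floors unchanged, so every form vanishes on it.
  have : intVec v = 0 := 𝒜.eq_zero_of_ell_eq_zero fun j => by
    have := (𝒜.sameFace_iff.1 h j).1
    rw [height_add_intVec, Int.floor_add_intCast] at this
    rw [ell_intVec, show 𝒜.ellInt j v = 0 by omega, Int.cast_zero]
  rw [this, add_zero]

namespace LiftedFace

variable {c : ℕ}

/-- The translate of a lifted face by an integral vector. -/
def translate (F : 𝒜.LiftedFace c) (v : Fin d → ℤ) : 𝒜.LiftedFace c :=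
  ⟨(fun x k => x k + (v k : ℝ)) '' F.1, by
    have hF : (fun (x : Fin d → ℝ) k => x k + (v k : ℝ)) '' F.1 =
        {y | 𝒜.SameFace (F.pt + intVec v) y} := by
      ext y
      constructor
      · rintro ⟨x, hx, rfl⟩
        exact (mem_iff.1 hx).add_intVec v
      · intro hy
        refine ⟨y + intVec (-v), mem_iff.2 ?_, ?_⟩
        · have := SameFace.add_intVec hy (-v)
          rwa [intVec_neg, add_neg_cancel_right, ← intVec_neg] at this
        · ext k; simp [intVec]
    rw [hF, vectorSpan_face]
    refine ⟨⟨_, rfl⟩, ?_⟩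
    have := F.codim
    rwa [direction, support_add_intVec, ← direction]⟩

theorem add_mem_translate {F : 𝒜.LiftedFace c} {x : Fin d → ℝ} (hx : x ∈ F.1)
    (v : Fin d → ℤ) : x + intVec v ∈ (F.translate v).1 := ⟨x, hx, rfl⟩

theorem pt_translate_mem_star_iff {c' : ℕ} {F : 𝒜.LiftedFace c} {G : 𝒜.LiftedFace c'}
    {v : Fin d → ℤ} : (F.translate v).pt ∈ 𝒜.star (G.translate v).pt ↔ F.pt ∈ 𝒜.star G.pt := by
  rw [pt_mem_star_iff (add_mem_translate F.pt_mem v), ← star_eq (add_mem_translate G.pt_mem v),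
    add_intVec_mem_star]

theorem translate_translate (F : 𝒜.LiftedFace c) (v w : Fin d → ℤ) :
    (F.translate v).translate w = F.translate (v + w) := by
  refine eq_of_mem (add_mem_translate (add_mem_translate F.pt_mem v) w) ?_
  rw [add_assoc, ← intVec_add]
  exact add_mem_translate F.pt_mem _

theorem translate_zero (F : 𝒜.LiftedFace c) : F.translate 0 = F := by
  refine eq_of_mem (add_mem_translate F.pt_mem 0) ?_
  rw [intVec_zero, add_zero]
  exact F.pt_mem

theorem translate_translate_neg (F : 𝒜.LiftedFace c) (v : Fin d → ℤ) :
    (F.translate v).translate (-v) = F := by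
  rw [translate_translate, add_neg_cancel, translate_zero]

theorem translate_neg_translate (F : 𝒜.LiftedFace c) (v : Fin d → ℤ) :
    (F.translate (-v)).translate v = F := by
  rw [translate_translate, neg_add_cancel, translate_zero]

theorem proj_mem_toCell {F : 𝒜.LiftedFace c} {x : Fin d → ℝ} (hx : x ∈ F.1) :
    proj x ∈ F.toCell.1 := ⟨x, hx, rfl⟩

theorem toCell_eq_iff {F G : 𝒜.LiftedFace c} : F.toCell = G.toCell ↔ ∃ v, G = F.translate v := by
  constructor
  · intro h
    have h1 := proj_mem_toCell F.pt_mem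
    rw [h] at h1
    obtain ⟨y, hy, hxy⟩ := h1
    obtain ⟨v, rfl⟩ := proj_eq_iff.1 hxy.symm
    exact ⟨v, eq_of_mem hy (add_mem_translate F.pt_mem v)⟩
  · rintro ⟨v, rfl⟩
    apply Subtype.ext
    change proj '' _ = proj '' _
    ext p
    constructor
    · rintro ⟨x, hx, rfl⟩
      exact ⟨_, add_mem_translate hx v, proj_add_intVec x v⟩
    · rintro ⟨_, ⟨x, hx, rfl⟩, rfl⟩
      exact ⟨x, hx, (proj_add_intVec x v).symm⟩

theorem toCell_translate (F : 𝒜.LiftedFace c) (v : Fin d → ℤ) :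
    (F.translate v).toCell = F.toCell := (toCell_eq_iff.2 ⟨v, rfl⟩).symm

end LiftedFace

theorem Cell.lift_toCell {c : ℕ} (S : 𝒜.Cell c) : S.lift.toCell = S :=
  Subtype.ext S.2.choose_spec

theorem Cell.exists_lift_of_proj_mem {c : ℕ} {S : 𝒜.Cell c} {x : Fin d → ℝ}
    (hx : proj x ∈ S.1) : ∃ F : 𝒜.LiftedFace c, F.toCell = S ∧ x ∈ F.1 := by
  rw [← S.lift_toCell] at hx
  obtain ⟨y, hy, hxy⟩ := hx
  obtain ⟨v, rfl⟩ := proj_eq_iff.1 hxy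
  exact ⟨S.lift.translate v, by rw [LiftedFace.toCell_translate, S.lift_toCell],
    LiftedFace.add_mem_translate hy v⟩

theorem Cell.eq_of_mem {c : ℕ} {S S' : 𝒜.Cell c} {p : Fin d → UnitAddCircle} (h : p ∈ S.1)
    (h' : p ∈ S'.1) : S = S' := by
  rw [← S.lift_toCell] at h
  obtain ⟨x, hx, rfl⟩ := h
  obtain ⟨F, rfl, hF⟩ := Cell.exists_lift_of_proj_mem h'
  rw [← S.lift_toCell, LiftedFace.eq_of_mem hx hF]

theorem proj_mem_toricHypersurface {x : Fin d → ℝ} {j : Fin n} :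
    proj x ∈ 𝒜.toricHypersurface j ↔ j ∈ 𝒜.support x := by
  have h : ∑ k, 𝒜.A k j • proj x k = ((𝒜.ell j x : ℝ) : UnitAddCircle) := by
    rw [ell_apply]
    change _ = QuotientAddGroup.mk' _ (∑ k, (𝒜.A k j : ℝ) * x k)
    rw [map_sum]
    refine Finset.sum_congr rfl fun k _ => ?_
    rw [← zsmul_eq_mul, map_zsmul]
    rfl
  change ∑ k, 𝒜.A k j • proj x k = 𝒜.b j ↔ _
  rw [h, coe_eq_b_iff]
  refine exists_congr fun m => ?_
  rw [height, sub_eq_iff_eq_add']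

theorem LiftedFace.toCell_supp {c : ℕ} (F : 𝒜.LiftedFace c) :
    F.toCell.supp = 𝒜.support F.pt := by
  ext j
  constructor
  · intro h
    exact proj_mem_toricHypersurface.1 (h (LiftedFace.proj_mem_toCell F.pt_mem))
  · rintro h _ ⟨x, hx, rfl⟩
    exact proj_mem_toricHypersurface.2 (LiftedFace.support_eq hx ▸ h)

namespace Orientation

variable (o : 𝒜.Orientation)

theorem tail_translate (W : 𝒜.LiftedFace 1) (v : Fin d → ℤ) :
    o.tail (W.translate v) = (o.tail W).translate v :=
  Subtype.ext (o.translate v W (W.translate v) rfl).1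

theorem head_translate (W : 𝒜.LiftedFace 1) (v : Fin d → ℤ) :
    o.head (W.translate v) = (o.head W).translate v :=
  Subtype.ext (o.translate v W (W.translate v) rfl).2

theorem tailOf_toCell (W : 𝒜.LiftedFace 1) : o.tailOf W.toCell = (o.tail W).toCell := by
  obtain ⟨v, hv⟩ := LiftedFace.toCell_eq_iff.1 (W.toCell.lift_toCell)
  rw [tailOf]
  conv_rhs => rw [hv, tail_translate, LiftedFace.toCell_translate]

theorem headOf_toCell (W : 𝒜.LiftedFace 1) : o.headOf W.toCell = (o.head W).toCell := by
  obtain ⟨v, hv⟩ := LiftedFace.toCell_eq_iff.1 (W.toCell.lift_toCell)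
  rw [headOf]
  conv_rhs => rw [hv, head_translate, LiftedFace.toCell_translate]

theorem exists_lift_of_tail (a : 𝒜.Wall) {C : 𝒜.LiftedFace 0} (h : C.toCell = o.tailOf a) :
    ∃ W : 𝒜.LiftedFace 1, W.toCell = a ∧ o.tail W = C := by
  obtain ⟨v, rfl⟩ := LiftedFace.toCell_eq_iff.1 h.symm
  exact ⟨a.lift.translate v, by rw [LiftedFace.toCell_translate, a.lift_toCell],
    o.tail_translate _ _⟩

theorem exists_lift_of_head (a : 𝒜.Wall) {C : 𝒜.LiftedFace 0} (h : C.toCell = o.headOf a) :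
    ∃ W : 𝒜.LiftedFace 1, W.toCell = a ∧ o.head W = C := by
  obtain ⟨v, rfl⟩ := LiftedFace.toCell_eq_iff.1 h.symm
  exact ⟨a.lift.translate v, by rw [LiftedFace.toCell_translate, a.lift_toCell],
    o.head_translate _ _⟩

end Orientation

/-! ### Finiteness -/

theorem exists_height_bound (j : Fin n) :
    ∃ B : ℤ, ∀ x ∈ Set.Icc (0 : Fin d → ℝ) 1, ⌊𝒜.height j x⌋ ∈ Set.Icc (-B) B ∧
      ⌈𝒜.height j x⌉ ∈ Set.Icc (-B) B := by
  obtain ⟨M, hM⟩ := (isCompact_Icc (a := (0 : Fin d → ℝ)) (b := 1)).exists_bound_of_continuousOn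
    (𝒜.continuous_height j).continuousOn
  refine ⟨⌈M⌉ + 1, fun x hx => ?_⟩
  have h := abs_le.1 (hM x hx)
  have hM' := Int.le_ceil M
  simp only [Set.mem_Icc]
  refine ⟨⟨?_, ?_⟩, ?_, ?_⟩
  · rw [Int.le_floor]; push_cast; linarith
  · have := Int.floor_le (𝒜.height j x)
    exact_mod_cast (by linarith : (⌊𝒜.height j x⌋ : ℝ) ≤ ⌈M⌉ + 1)
  · have := Int.le_ceil (𝒜.height j x)
    exact_mod_cast (by linarith : -((⌈M⌉ : ℝ) + 1) ≤ ⌈𝒜.height j x⌉)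
  · rw [Int.ceil_le]; push_cast; linarith

/-- Every cell has a point over the unit cube. Heights are bounded there, so only finitely many
combinations of floors and ceilings occur, and these determine the cell. -/
instance finite_cell (c : ℕ) : Finite (𝒜.Cell c) := by
  have h1 : ∀ S : 𝒜.Cell c, ∃ x ∈ Set.Icc (0 : Fin d → ℝ) 1, proj x ∈ S.1 := by
    intro S
    refine ⟨S.lift.pt + intVec (fun k => -⌊S.lift.pt k⌋), ⟨fun k => ?_, fun k => ?_⟩, ?_⟩
    · have := Int.floor_le (S.lift.pt k)
      simp only [intVec, Pi.add_apply, Pi.zero_apply]; push_cast; linarith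
    · have := Int.lt_floor_add_one (S.lift.pt k)
      simp only [intVec, Pi.add_apply, Pi.one_apply]; push_cast; linarith
    · rw [proj_add_intVec]
      have := LiftedFace.proj_mem_toCell S.lift.pt_mem
      rwa [S.lift_toCell] at this
  choose x hx hxS using h1
  choose B hB using exists_height_bound (𝒜 := 𝒜)
  refine Finite.of_injective (β := ∀ j, Set.Icc (-B j) (B j) × Set.Icc (-B j) (B j))
    (fun S j => (⟨_, (hB j _ (hx S)).1⟩, ⟨_, (hB j _ (hx S)).2⟩)) fun S S' h => ?_
  have hs : 𝒜.SameFace (x S) (x S') := 𝒜.sameFace_iff.2 fun j => by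
    have := congrFun h j
    simpa using this
  obtain ⟨F, rfl, hF⟩ := Cell.exists_lift_of_proj_mem (hxS S)
  obtain ⟨F', rfl, hF'⟩ := Cell.exists_lift_of_proj_mem (hxS S')
  rw [LiftedFace.eq_of_mem (LiftedFace.mem_of_sameFace hF hs) hF']

instance finite_edge : Finite 𝒜.Edge := by
  refine Finite.of_surjective (α := (𝒜.Wall × 𝒜.Chamber) ⊕ (𝒜.Chamber × 𝒜.Wall))
    (fun s => s.elim (fun p => .fst p.1 p.2) fun p => .snd p.1 p.2) ?_
  rintro (⟨a, C⟩ | ⟨C, a⟩)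
  · exact ⟨.inl (a, C), rfl⟩
  · exact ⟨.inr (C, a), rfl⟩

theorem finite_relators (o : 𝒜.Orientation) (C₀ : 𝒜.Chamber) (T : Set 𝒜.Wall)
    (ord : ∀ p : 𝒜.Cell 2, CyclicOrder p) : (relators o C₀ T ord).Finite := by
  refine (Set.Finite.union ?_ ?_).union ?_
  · refine (Set.finite_range fun q : 𝒜.Wall × 𝒜.Wall =>
      (sym C₀ T (.snd (o.tailOf q.1) q.2) * sym C₀ T (.fst q.1 (o.headOf q.2))) *
      (sym C₀ T (.fst q.1 (o.tailOf q.2)) * sym C₀ T (.snd (o.headOf q.1) q.2))⁻¹).subset ?_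
    rintro _ ⟨a, b, -, rfl⟩
    exact ⟨(a, b), rfl⟩
  · refine (Set.finite_range fun q : 𝒜.Cell 2 × 𝒜.Chamber => (List.ofFn fun i =>
      sym C₀ T (.fst ((ord q.1).wall i).toCell q.2) ^ (ord q.1).exponent o i).prod).subset ?_
    rintro _ ⟨p, C, rfl⟩
    exact ⟨(p, C), rfl⟩
  · refine (Set.finite_range fun q : 𝒜.Cell 2 × 𝒜.Chamber => (List.ofFn fun i =>
      sym C₀ T (.snd q.2 ((ord q.1).wall i).toCell) ^ (ord q.1).exponent o i).prod).subset ?_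
    rintro _ ⟨p, C, rfl⟩
    exact ⟨(p, C), rfl⟩

end EllipticArrangement

/-! ### Telescoping products -/

theorem List.prod_ofFn_telescope {G : Type*} [Group G] {N : ℕ} (c : Fin (N + 1) → G)
    (a : Fin N → G) : (List.ofFn fun i => c i.castSucc * a i * (c i.succ)⁻¹).prod =
      c 0 * (List.ofFn a).prod * (c (Fin.last N))⁻¹ := by
  induction N with
  | zero => simp
  | succ N ih =>
    rw [List.ofFn_succ, List.prod_cons, List.ofFn_succ, List.prod_cons]
    have := ih (fun i => c i.succ) (fun i => a i.succ)
    simp only [Fin.succ_castSucc] at this ⊢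
    rw [this]
    simp [mul_assoc]

/-- The factors `c i` telescope once the sequence is closed up by repeating `c 0` at its end. This
compares the product around a cell with the jumps of a function on the chambers around it. -/
theorem List.prod_ofFn_cyclic {G : Type*} [Group G] {N : ℕ} (c a : Fin (N + 1) → G) :
    (List.ofFn fun i => c i * a i * (c (i + 1))⁻¹).prod =
      c 0 * (List.ofFn a).prod * (c 0)⁻¹ := by
  have h := List.prod_ofFn_telescope (Fin.snoc (α := fun _ => G) c (c 0)) a
  have h0 : (Fin.snoc (α := fun _ => G) c (c 0) : Fin (N + 2) → G) 0 = c 0 := by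
    exact Fin.snoc_castSucc (α := fun _ => G) (c 0) c 0
  have h1 : ∀ i : Fin (N + 1), (Fin.snoc (α := fun _ => G) c (c 0) : Fin (N + 2) → G) i.succ =
      c (i + 1) := by
    intro i
    induction i using Fin.lastCases with
    | last => rw [Fin.succ_last, Fin.snoc_last, Fin.last_add_one]
    | cast i => rw [Fin.succ_castSucc, Fin.snoc_castSucc, Fin.coeSucc_eq_succ]
  simpa only [Fin.snoc_castSucc, Fin.snoc_last, h0, h1] using h

theorem List.prod_ofFn_eq_of_ne {G : Type*} [Monoid G] {N : ℕ} (f : Fin N → G) (i₀ : Fin N)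
    (h : ∀ i, i ≠ i₀ → f i = 1) : (List.ofFn f).prod = f i₀ := by
  induction N with
  | zero => exact i₀.elim0
  | succ N ih =>
    rw [List.ofFn_succ, List.prod_cons]
    induction i₀ using Fin.cases with
    | zero =>
      rw [show (fun i : Fin N => f i.succ) = fun _ => 1 from
        funext fun i => h _ (Fin.succ_ne_zero i)]
      simp
    | succ i₀ =>
      rw [h 0 (Fin.succ_ne_zero i₀).symm, one_mul]
      exact ih (fun i => f i.succ) i₀ fun i hi => h _ (by simpa using hi)

theorem SignType.eq_of_ne {s s₁ s₂ : SignType} : s ≠ 0 → s₁ ≠ 0 → s₂ ≠ 0 → s₁ ≠ s₂ →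
    s ≠ s₂ → s = s₁ := by
  cases s <;> cases s₁ <;> cases s₂ <;> decide

namespace EllipticArrangement
variable {d n : ℕ} {𝒜 : EllipticArrangement d n}

/-! ### Cyclic orders -/

namespace CyclicOrder

variable {p : 𝒜.Cell 2} (s : CyclicOrder p) (o : 𝒜.Orientation)

theorem chamber_mem_star (i : Fin (s.len + 1)) : (s.chamber i).pt ∈ 𝒜.star (s.wall i).pt :=
  LiftedFace.subset_closure_iff.1 (s.subset_closure i)

theorem chamber_next_mem_star (i : Fin (s.len + 1)) :
    (s.chamber (i + 1)).pt ∈ 𝒜.star (s.wall i).pt :=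
  LiftedFace.subset_closure_iff.1 (s.subset_closure_next i)

theorem wall_mem_star (i : Fin (s.len + 1)) : (s.wall i).pt ∈ 𝒜.star s.face.pt := by
  have : s.wall i ∈ Set.range s.wall := ⟨i, rfl⟩
  rw [s.range_wall] at this
  exact LiftedFace.subset_closure_iff.1 this

theorem exists_wall_eq {W : 𝒜.LiftedFace 1} (h : W.pt ∈ 𝒜.star s.face.pt) :
    ∃ i, s.wall i = W := by
  have : W ∈ Set.range s.wall := by
    rw [s.range_wall]
    exact LiftedFace.subset_closure_iff.2 h
  exact this

theorem tail_head_exponent (i : Fin (s.len + 1)) :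
    (o.tail (s.wall i) = s.chamber i ∧ o.head (s.wall i) = s.chamber (i + 1) ∧
      s.exponent o i = 1) ∨
    (o.head (s.wall i) = s.chamber i ∧ o.tail (s.wall i) = s.chamber (i + 1) ∧
      s.exponent o i = -1) := by
  have h1 := o.eq_tail_or_eq_head (s.chamber_mem_star i)
  have h2 := o.eq_tail_or_eq_head (s.chamber_next_mem_star i)
  have h3 := s.chamber_ne_next i
  have h4 := o.tail_ne_head (s.wall i)
  rcases h1 with h1 | h1 <;> rcases h2 with h2 | h2
  · exact absurd (h1.trans h2.symm) h3
  · exact Or.inl ⟨h1.symm, h2.symm, by rw [exponent, if_pos h1.symm]⟩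
  · exact Or.inr ⟨h1.symm, h2.symm, by rw [exponent, if_neg (h1 ▸ h4)]⟩
  · exact absurd (h1.trans h2.symm) h3

/-- The exponent just compensates for the direction of crossing, so that the jump condition can be
stated along the orientation alone. -/
theorem mul_zpow_exponent_iff {G : Type*} [Group G] (ψ : 𝒜.LiftedFace 0 → G) (g : G)
    (i : Fin (s.len + 1)) : ψ (s.chamber i) * g ^ s.exponent o i = ψ (s.chamber (i + 1)) ↔
      ψ (o.tail (s.wall i)) * g = ψ (o.head (s.wall i)) := by
  rcases s.tail_head_exponent o i with ⟨h1, h2, h3⟩ | ⟨h1, h2, h3⟩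
  · rw [h1, h2, h3, zpow_one]
  · rw [h1, h2, h3, zpow_neg_one, mul_inv_eq_iff_eq_mul, eq_comm]

end CyclicOrder

/-- If a function on chambers jumps by `h` across all but one of the walls around a face of
codimension two, then it does so across the remaining one. This is the local consequence of the
relations that is needed for the existence of potentials. -/
def ClosesUp {G : Type*} [Group G] (o : 𝒜.Orientation) (h : 𝒜.LiftedFace 1 → G) : Prop :=
  ∀ (P : 𝒜.LiftedFace 2) (ψ : 𝒜.LiftedFace 0 → G) (W' : 𝒜.LiftedFace 1), W'.pt ∈ 𝒜.star P.pt →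
    (∀ W : 𝒜.LiftedFace 1, W.pt ∈ 𝒜.star P.pt → W ≠ W' → ψ (o.tail W) * h W = ψ (o.head W)) →
    ψ (o.tail W') * h W' = ψ (o.head W')

/-- If the jumps are right at all walls but one, the cyclic product telescopes and the relation
leaves only the factor of the remaining wall. The relation is given at one lift of each cell;
invariance under translations moves it to all lifts. -/
theorem closesUp_of_cyclicOrder {G : Type*} [Group G] (o : 𝒜.Orientation)
    (h : 𝒜.LiftedFace 1 → G) (hinv : ∀ W v, h (W.translate v) = h W)
    (ord : ∀ p : 𝒜.Cell 2, CyclicOrder p)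
    (hord : ∀ p, (List.ofFn fun i => h ((ord p).wall i) ^ (ord p).exponent o i).prod = 1) :
    ClosesUp o h := by
  have key : ∀ (p : 𝒜.Cell 2) (ψ : 𝒜.LiftedFace 0 → G) (W' : 𝒜.LiftedFace 1),
      W'.pt ∈ 𝒜.star (ord p).face.pt →
      (∀ W : 𝒜.LiftedFace 1, W.pt ∈ 𝒜.star (ord p).face.pt → W ≠ W' →
        ψ (o.tail W) * h W = ψ (o.head W)) → ψ (o.tail W') * h W' = ψ (o.head W') := by
    intro p ψ W' hW' hψ
    obtain ⟨i₀, rfl⟩ := (ord p).exists_wall_eq hW'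
    rw [← (ord p).mul_zpow_exponent_iff o]
    have h1 := List.prod_ofFn_cyclic (fun i => ψ ((ord p).chamber i))
      (fun i => h ((ord p).wall i) ^ (ord p).exponent o i)
    rw [hord, mul_one, mul_inv_cancel, List.prod_ofFn_eq_of_ne _ i₀] at h1
    · exact mul_inv_eq_one.1 h1
    · intro i hi
      rw [mul_inv_eq_one, (ord p).mul_zpow_exponent_iff o]
      exact hψ _ ((ord p).wall_mem_star i) fun e => hi ((ord p).wall_injective e)
  intro P ψ W' hW' hψ
  obtain ⟨v, hv⟩ := LiftedFace.toCell_eq_iff.1 (ord P.toCell).toCell_face.symm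
  have := key P.toCell (fun C => ψ (C.translate (-v))) (W'.translate v)
    (by rw [hv, LiftedFace.pt_translate_mem_star_iff]; exact hW') fun W hW hne => by
      have h1 := hψ (W.translate (-v)) (by
        rw [← LiftedFace.pt_translate_mem_star_iff (v := v), LiftedFace.translate_neg_translate,
          ← hv]
        exact hW) fun e => hne (by rw [← e, LiftedFace.translate_neg_translate])
      rwa [o.tail_translate, o.head_translate, hinv] at h1
  simpa only [o.tail_translate, o.head_translate, LiftedFace.translate_translate_neg, hinv]
    using this

/-! ### Existence of potentials -/

theorem exists_sameFace_mem {U : Set (Fin d → ℝ)} (hU : IsOpen U) {x y : Fin d → ℝ}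
    (hx : x ∈ U) (hy : y ∈ 𝒜.star x) : ∃ z ∈ U, 𝒜.SameFace y z := by
  obtain ⟨ε, hε, h⟩ := 𝒜.eventually_mem_star x (y - x) hU hx
  have ht : 0 < min ε 1 := lt_min hε one_pos
  refine ⟨_, (h (min ε 1) (by rw [abs_of_pos ht]; exact min_le_left _ _)).1, ?_⟩
  have := sameFace_lineMap hy ht (min_le_right _ _)
  convert this using 1
  rw [sub_smul, one_smul, smul_sub]; abel

theorem SameFace.lt_height_iff {x y : Fin d → ℝ} (h : 𝒜.SameFace x y) {j : Fin n} {m : ℤ} :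
    (m : ℝ) < 𝒜.height j x ↔ (m : ℝ) < 𝒜.height j y :=
  ⟨lt_height_of_mem_star h.mem_star, lt_height_of_mem_star h.symm.mem_star⟩

theorem SameFace.height_lt_iff {x y : Fin d → ℝ} (h : 𝒜.SameFace x y) {j : Fin n} {m : ℤ} :
    𝒜.height j x < m ↔ 𝒜.height j y < m :=
  ⟨height_lt_of_mem_star h.mem_star, height_lt_of_mem_star h.symm.mem_star⟩

/-! ### Gluing potentials along a hyperplane -/

section Glue

variable {G : Type*} [Group G] (o : 𝒜.Orientation) (h : 𝒜.LiftedFace 1 → G) (j : Fin n) (m : ℤ)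
  (φ φ' : 𝒜.LiftedFace 0 → G)

open Classical in
/-- The function on chambers that agrees with `φ` above a hyperplane and with `k * φ'` below. -/
def glue (k : G) (C : 𝒜.LiftedFace 0) : G :=
  if (m : ℝ) < 𝒜.height j C.pt then φ C else k * φ' C

open Classical in
/-- The constant for which the glued function has the right jump across the wall `W`. -/
def glueConst (W : 𝒜.LiftedFace 1) : G :=
  if (m : ℝ) < 𝒜.height j (o.tail W).pt then φ (o.tail W) * h W * (φ' (o.head W))⁻¹
  else φ (o.head W) * (h W)⁻¹ * (φ' (o.tail W))⁻¹

variable {j m}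

/-- The two chambers at such a wall lie on opposite sides of the hyperplane, so the jump condition
can be solved for the constant in exactly one way. -/
theorem glue_iff {W : 𝒜.LiftedFace 1} (hW : 𝒜.height j W.pt = m) (k : G) :
    glue j m φ φ' k (o.tail W) * h W = glue j m φ φ' k (o.head W) ↔
      k = glueConst o h j m φ φ' W := by
  rcases o.height_separates (W := W) (j := j) ⟨m, hW⟩ with ⟨h1, h2⟩ | ⟨h1, h2⟩ <;>
    rw [hW] at h1 h2
  · rw [glue, glue, glueConst, if_neg h1.not_gt, if_pos h2, if_neg h1.not_gt,
      eq_mul_inv_iff_mul_eq, eq_mul_inv_iff_mul_eq]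
  · rw [glue, glue, glueConst, if_neg h1.not_gt, if_pos h2, if_pos h2, eq_mul_inv_iff_mul_eq,
      eq_comm]

theorem glue_above {W : 𝒜.LiftedFace 1} (hW : (m : ℝ) < 𝒜.height j W.pt)
    (hφ : φ (o.tail W) * h W = φ (o.head W)) (k : G) :
    glue j m φ φ' k (o.tail W) * h W = glue j m φ φ' k (o.head W) := by
  rwa [glue, glue, if_pos (lt_height_of_mem_star (o.tail_mem_star W) hW),
    if_pos (lt_height_of_mem_star (o.head_mem_star W) hW)]

theorem glue_below {W : 𝒜.LiftedFace 1} (hW : 𝒜.height j W.pt < m)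
    (hφ : φ' (o.tail W) * h W = φ' (o.head W)) (k : G) :
    glue j m φ φ' k (o.tail W) * h W = glue j m φ φ' k (o.head W) := by
  rw [glue, glue, if_neg (height_lt_of_mem_star (o.tail_mem_star W) hW).not_gt,
    if_neg (height_lt_of_mem_star (o.head_mem_star W) hW).not_gt, mul_assoc, hφ]

end Glue

/-- Around a point of codimension two on a hyperplane there are at most two walls in this
hyperplane, so that the constants for two of them agree. -/
theorem glueConst_eq_of_codim_two {G : Type*} [Group G] {o : 𝒜.Orientation}
    {h : 𝒜.LiftedFace 1 → G} (hcl : ClosesUp o h) {U : Set (Fin d → ℝ)} (hU : IsOpen U)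
    {j : Fin n} {m : ℤ} {φ φ' : 𝒜.LiftedFace 0 → G}
    (hφ : ∀ W : 𝒜.LiftedFace 1, (W.1 ∩ (U ∩ {y | (m : ℝ) < 𝒜.height j y})).Nonempty →
      φ (o.tail W) * h W = φ (o.head W))
    (hφ' : ∀ W : 𝒜.LiftedFace 1, (W.1 ∩ (U ∩ {y | 𝒜.height j y < m})).Nonempty →
      φ' (o.tail W) * h W = φ' (o.head W))
    {y : Fin d → ℝ} (hyU : y ∈ U) (hym : 𝒜.height j y = m) {i : Fin n} (hi : i ∈ 𝒜.support y)
    (hij : ¬ LinearMap.ker (𝒜.ell j) ≤ LinearMap.ker (𝒜.ell i))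
    (hg : 𝒜.IsGeneric (LinearMap.ker (𝒜.ell j) ⊓ LinearMap.ker (𝒜.ell i)) y)
    {W W' : 𝒜.LiftedFace 1} (hW : W.pt ∈ 𝒜.star y) (hW' : W'.pt ∈ 𝒜.star y)
    (hWm : 𝒜.height j W.pt = m) (hWm' : 𝒜.height j W'.pt = m) :
    glueConst o h j m φ φ' W = glueConst o h j m φ φ' W' := by
  by_cases hne : W = W'
  · rw [hne]
  have hcod := codim_two_of_isGeneric hi ⟨m, hym⟩ hij hg
  have hyP := mem_faceAt hcod
  have hstar : 𝒜.star (𝒜.faceAt 2 y hcod).pt = 𝒜.star y := (LiftedFace.star_eq hyP).symm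
  have hsign : ∀ V : 𝒜.LiftedFace 1, 𝒜.height j V.pt = m → V.pt ∈ 𝒜.star y →
      SignType.sign (𝒜.height i V.pt - 𝒜.height i y) ≠ 0 := by
    intro V hVm hV h0
    rw [sign_eq_zero_iff, sub_eq_zero, ← mem_support_iff_of_mem_star hV hi] at h0
    exact hij (isGeneric_ker_of_mem_support V.codim ⟨m, hVm⟩ i h0)
  -- Inside the `j`-th hyperplane every form in the support of `y` is a multiple of the `i`-th, so
  -- the side of the `i`-th hyperplane determines the wall.
  have hsame : ∀ V V' : 𝒜.LiftedFace 1, 𝒜.height j V.pt = m → V.pt ∈ 𝒜.star y →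
      𝒜.height j V'.pt = m → V'.pt ∈ 𝒜.star y →
      SignType.sign (𝒜.height i V.pt - 𝒜.height i y) =
        SignType.sign (𝒜.height i V'.pt - 𝒜.height i y) → V = V' := by
    intro V V' hVm hV hVm' hV' hs
    refine LiftedFace.eq_of_mem (LiftedFace.mem_of_sameFace V.pt_mem
      (sameFace_of_mem_star hV hV' fun l hl => ?_)) V'.pt_mem
    obtain ⟨c, hc⟩ := exists_ell_proportional hij (hg l hl)
    have hk : ∀ x, 𝒜.height j x = m → x - y ∈ LinearMap.ker (𝒜.ell j) := fun x hx => by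
      rw [LinearMap.mem_ker, ← height_sub_height]; linarith
    rw [height_sub_height, height_sub_height, hc _ (hk _ hVm), hc _ (hk _ hVm'), sign_mul,
      sign_mul, ← height_sub_height, ← height_sub_height, hs]
  -- With the constant prescribed by `W`, the glued function has the right jumps at all walls around
  -- `y` other than `W'`; closing up yields the jump at `W'`.
  rw [← glue_iff o h φ φ' hWm']
  refine hcl (𝒜.faceAt 2 y hcod) _ W' (hstar ▸ hW') fun V hV hVne => ?_
  rw [hstar] at hV
  -- The jumps are known only for walls meeting the halves of `U`; a wall around `y` has points in
  -- `U` because it comes arbitrarily close to `y`.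
  obtain ⟨z, hzU, hz⟩ := exists_sameFace_mem hU hyU hV
  have hzV := LiftedFace.mem_of_sameFace V.pt_mem hz
  rcases lt_trichotomy (𝒜.height j V.pt) m with hlt | heq | hgt
  · exact glue_below o h φ φ' hlt (hφ' V ⟨z, hzV, hzU, hz.height_lt_iff.1 hlt⟩) _
  · have hVW : V = W := hsame V W heq hV hWm hW <| SignType.eq_of_ne (hsign V heq hV)
      (hsign W hWm hW) (hsign W' hWm' hW') (fun e => hne (hsame W W' hWm hW hWm' hW' e))
      fun e => hVne (hsame V W' heq hV hWm' hW' e)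
    rw [hVW, glue_iff o h φ φ' hWm]
  · exact glue_above o h φ φ' hgt (hφ V ⟨z, hzV, hzU, hz.lt_height_iff.1 hgt⟩) _

/-- Induction on the number of hyperplanes cutting `U`. One of them divides `U` into two convex
halves with potentials `φ` and `φ'`, and left multiplication of `φ'` by a constant does not affect
its jumps. Each wall in the dividing hyperplane prescribes this constant. Walls that meet at a face
of codimension two prescribe the same one, since jumps close up around that face, and a gallery
inside the hyperplane connects all its walls in `U` through such faces. -/
theorem exists_potential {G : Type*} [Group G] {o : 𝒜.Orientation} {h : 𝒜.LiftedFace 1 → G}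
    (hcl : ClosesUp o h) {U : Set (Fin d → ℝ)} (hU : IsOpen U) (hUc : Convex ℝ U)
    (hfin : (𝒜.cuts 0 ⊤ U).Finite) : ∃ φ : 𝒜.LiftedFace 0 → G,
      ∀ W : 𝒜.LiftedFace 1, (W.1 ∩ U).Nonempty → φ (o.tail W) * h W = φ (o.head W) := by
  classical
  induction hN : (𝒜.cuts 0 ⊤ U).ncard using Nat.strong_induction_on generalizing U with
  | _ N IH =>
  have hnot : ∀ i, ¬ (⊤ : Submodule ℝ (Fin d → ℝ)) ≤ LinearMap.ker (𝒜.ell i) := fun i hi =>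
    𝒜.ell_ne_zero i (LinearMap.ext fun v => hi Submodule.mem_top)
  rcases Set.eq_empty_or_nonempty (𝒜.cuts 0 ⊤ U) with he | ⟨⟨j, m⟩, hjm⟩
  · refine ⟨fun _ => 1, fun W ⟨x, hx, hxU⟩ => ?_⟩
    obtain ⟨i, hi⟩ := exists_support_wall W
    rw [← LiftedFace.support_eq hx] at hi
    obtain ⟨m, hm⟩ := hi
    have : (i, m) ∈ 𝒜.cuts 0 ⊤ U := ⟨x, hxU, trivial, hm, hnot i⟩
    rw [he] at this
    exact this.elim
  obtain ⟨y₀, hy₀, -, hy₀m, -⟩ := id hjm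
  simp only at hy₀m
  obtain ⟨φ, hφ⟩ := IH _ (hN ▸ ncard_cuts_lt hfin Set.inter_subset_left hjm fun y hy =>
    ne_of_gt hy.2) (isOpen_above hU j m) (convex_above hUc j m)
    (hfin.subset (cuts_mono Set.inter_subset_left)) rfl
  obtain ⟨φ', hφ'⟩ := IH _ (hN ▸ ncard_cuts_lt hfin Set.inter_subset_left hjm fun y hy =>
    ne_of_lt hy.2) (isOpen_below hU j m) (convex_below hUc j m)
    (hfin.subset (cuts_mono Set.inter_subset_left)) rfl
  have hon : ∀ y, y - y₀ ∈ LinearMap.ker (𝒜.ell j) ↔ 𝒜.height j y = m := fun y => by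
    rw [LinearMap.mem_ker, ← height_sub_height, hy₀m, sub_eq_zero]
  -- A point of some wall in the dividing hyperplane; the constant of this wall serves for all
  -- others.
  obtain ⟨w, ⟨hwU, -⟩, hwK, hwg⟩ := exists_isGeneric (𝒜 := 𝒜) (LinearMap.ker (𝒜.ell j)) hU hy₀
  have hcodw := codim_one_iff.2 ⟨j, ⟨m, (hon w).1 hwK⟩, hwg⟩
  let κ : (Fin d → ℝ) → Option G := fun y =>
    if hy : Module.finrank ℝ (𝒜.direction y) + 1 = d then
      some (glueConst o h j m φ φ' (𝒜.faceAt 1 y hy)) else none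
  have hκ : ∀ (W : 𝒜.LiftedFace 1) (y : Fin d → ℝ), y ∈ W.1 →
      κ y = some (glueConst o h j m φ φ' W) := by
    intro W y hy
    have hc := W.codim
    rw [← LiftedFace.direction_eq hy] at hc
    simp only [κ, dif_pos hc]
    rw [LiftedFace.eq_of_mem (mem_faceAt hc) hy]
  have hheight : ∀ (W : 𝒜.LiftedFace 1) (y : Fin d → ℝ), y ∈ W.1 → 𝒜.height j y = m →
      𝒜.height j W.pt = m := by
    intro W y hy hym
    have h1 := LiftedFace.mem_iff.1 hy
    rw [← hym, eq_comm]
    exact height_eq_of_mem_star h1.mem_star ⟨m, hym⟩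
  have hconst : ∀ (W : 𝒜.LiftedFace 1) (y : Fin d → ℝ), y ∈ W.1 → y ∈ U → 𝒜.height j y = m →
      glueConst o h j m φ φ' W = glueConst o h j m φ φ' (𝒜.faceAt 1 w hcodw) := by
    intro W y hy hyU hym
    have hgen : 𝒜.IsGeneric (LinearMap.ker (𝒜.ell j)) y :=
      isGeneric_ker_of_mem_support (LiftedFace.direction_eq hy ▸ W.codim) ⟨m, hym⟩
    have := eq_of_gallery κ (fun y z hyz => ?_) y₀ (LinearMap.ker (𝒜.ell j)) hU hUc
      (hfin.subset ?_) ?_ hyU hwU ((hon y).2 hym) hwK hgen hwg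
    · rw [hκ W y hy, hκ _ w (mem_faceAt hcodw)] at this
      exact Option.some_injective _ this
    · have hd : 𝒜.direction y = 𝒜.direction z := by rw [direction, direction, hyz.support_eq]
      by_cases hy : Module.finrank ℝ (𝒜.direction y) + 1 = d
      · rw [hκ _ y (mem_faceAt hy), hκ _ z (LiftedFace.mem_of_sameFace (mem_faceAt hy) hyz)]
      · simp only [κ, dif_neg hy, dif_neg (hd ▸ hy)]
    · rintro ⟨i, l⟩ ⟨x, hx, -, hxl, -⟩
      exact ⟨x, hx, trivial, hxl, hnot i⟩
    · intro y hyU hyK i hi hij hg z hz z' hz' hzK hzK' hgz hgz'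
      have hc := codim_one_iff.2 ⟨j, ⟨m, (hon z).1 hzK⟩, hgz⟩
      have hc' := codim_one_iff.2 ⟨j, ⟨m, (hon z').1 hzK'⟩, hgz'⟩
      rw [hκ _ z (mem_faceAt hc), hκ _ z' (mem_faceAt hc')]
      exact congrArg some (glueConst_eq_of_codim_two hcl hU hφ hφ' hyU ((hon y).1 hyK) hi hij hg
        ((LiftedFace.pt_mem_star_iff (mem_faceAt hc)).2 hz.2)
        ((LiftedFace.pt_mem_star_iff (mem_faceAt hc')).2 hz'.2)
        (hheight _ z (mem_faceAt hc) ((hon z).1 hzK))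
        (hheight _ z' (mem_faceAt hc') ((hon z').1 hzK')))
  refine ⟨glue j m φ φ' (glueConst o h j m φ φ' (𝒜.faceAt 1 w hcodw)), ?_⟩
  rintro W ⟨x, hx, hxU⟩
  have hWx := LiftedFace.mem_iff.1 hx
  rcases lt_trichotomy (𝒜.height j x) m with hlt | heq | hgt
  · exact glue_below o h φ φ' (hWx.height_lt_iff.2 hlt) (hφ' W ⟨x, hx, hxU, hlt⟩) _
  · rw [glue_iff o h φ φ' (hheight W x hx heq), hconst W x hx hxU heq]
  · exact glue_above o h φ φ' (hWx.lt_height_iff.2 hgt) (hφ W ⟨x, hx, hxU, hgt⟩) _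

/-- Potentials exist on stars. -/
theorem exists_potential_star {G : Type*} [Group G] {o : 𝒜.Orientation}
    {h : 𝒜.LiftedFace 1 → G} (hcl : ClosesUp o h) (x : Fin d → ℝ) :
    ∃ φ : 𝒜.LiftedFace 0 → G, ∀ W : 𝒜.LiftedFace 1, W.pt ∈ 𝒜.star x →
      φ (o.tail W) * h W = φ (o.head W) := by
  obtain ⟨φ, hφ⟩ := exists_potential hcl (𝒜.isOpen_star x) (𝒜.convex_star x)
    (finite_cuts_star 0 x ⊤)
  exact ⟨φ, fun W hW => hφ W ⟨_, W.pt_mem, hW⟩⟩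

/-- Potentials exist on products of stars, for weights of the edges of the product that commute. -/
theorem exists_potential_prod {G : Type*} [Group G] {o : 𝒜.Orientation}
    {h₁ : 𝒜.LiftedFace 1 → 𝒜.LiftedFace 0 → G} {h₂ : 𝒜.LiftedFace 0 → 𝒜.LiftedFace 1 → G}
    (hcl₁ : ∀ D, ClosesUp o fun W => h₁ W D) (hcl₂ : ∀ C, ClosesUp o fun W => h₂ C W)
    {x y : Fin d → ℝ}
    (hcomm : ∀ V W : 𝒜.LiftedFace 1, V.pt ∈ 𝒜.star x → W.pt ∈ 𝒜.star y →
      h₂ (o.tail V) W * h₁ V (o.head W) = h₁ V (o.tail W) * h₂ (o.head V) W) :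
    ∃ φ : 𝒜.LiftedFace 0 → 𝒜.LiftedFace 0 → G,
      (∀ (W : 𝒜.LiftedFace 1) (D : 𝒜.LiftedFace 0), W.pt ∈ 𝒜.star x → D.pt ∈ 𝒜.star y →
        φ (o.tail W) D * h₁ W D = φ (o.head W) D) ∧
      (∀ (C : 𝒜.LiftedFace 0) (W : 𝒜.LiftedFace 1), C.pt ∈ 𝒜.star x → W.pt ∈ 𝒜.star y →
        φ C (o.tail W) * h₂ C W = φ C (o.head W)) := by
  obtain ⟨C₀, hC₀⟩ := exists_chamber_near (𝒜 := 𝒜) x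
  choose α hα using fun D => exists_potential_star (hcl₁ D) x
  obtain ⟨β, hβ⟩ := exists_potential_star (hcl₂ C₀) y
  have h1 : ∀ (W : 𝒜.LiftedFace 1) (D : 𝒜.LiftedFace 0), W.pt ∈ 𝒜.star x →
      β D * (α D C₀)⁻¹ * α D (o.tail W) * h₁ W D = β D * (α D C₀)⁻¹ * α D (o.head W) := by
    intro W D hW
    rw [mul_assoc, hα D W hW]
  -- The potentials of the slices are normalised so as to agree with `β` over `C₀`.
  refine ⟨fun C D => β D * (α D C₀)⁻¹ * α D C, fun W D hW _ => h1 W D hW, ?_⟩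
  intro C W hC hW
  -- The jump condition in the second variable holds over `C₀`, and the commutation of the weights
  -- carries it across every wall of the first variable.
  have := eq_of_eq_across_walls o (fun C : 𝒜.LiftedFace 0 =>
    (β (o.tail W) * (α (o.tail W) C₀)⁻¹ * α (o.tail W) C * h₂ C W =
      β (o.head W) * (α (o.head W) C₀)⁻¹ * α (o.head W) C)) x (fun V hV => ?_) hC hC₀
  · simp only [eq_iff_iff] at this
    rw [this]
    simp [hβ W hW]
  · simp only [eq_iff_iff]
    rw [← h1 V _ hV, ← h1 V _ hV, mul_assoc _ (h₁ V _), ← hcomm V W hV hW, ← mul_assoc]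
    exact (mul_left_inj _).symm

/-- A function on pairs of chambers that does not change across walls is constant on products of
stars. -/
theorem eq_of_eq_across_walls_prod {α : Type*} (o : 𝒜.Orientation)
    (κ : 𝒜.LiftedFace 0 → 𝒜.LiftedFace 0 → α) {x y : Fin d → ℝ}
    (h₁ : ∀ (W : 𝒜.LiftedFace 1) (D : 𝒜.LiftedFace 0), W.pt ∈ 𝒜.star x → D.pt ∈ 𝒜.star y →
      κ (o.tail W) D = κ (o.head W) D)
    (h₂ : ∀ (C : 𝒜.LiftedFace 0) (W : 𝒜.LiftedFace 1), C.pt ∈ 𝒜.star x → W.pt ∈ 𝒜.star y →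
      κ C (o.tail W) = κ C (o.head W)) {C C' D D' : 𝒜.LiftedFace 0}
    (hC : C.pt ∈ 𝒜.star x) (hC' : C'.pt ∈ 𝒜.star x) (hD : D.pt ∈ 𝒜.star y)
    (hD' : D'.pt ∈ 𝒜.star y) : κ C D = κ C' D' :=
  (eq_of_eq_across_walls o (fun C => κ C D) x (fun W hW => h₁ W D hW hD) hC hC').trans
    (eq_of_eq_across_walls o (κ C') y (fun W hW => h₂ C' W hC' hW) hD hD')

end EllipticArrangement

/-! ### Transport along paths for a compatible family of local potentials -/

section Transport

variable {Y V G : Type*} [TopologicalSpace Y] [Group G] (S : Y → Set Y)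
  (near : Y → Set V) (φ : Y → V → G)

/-- The coordinate changes of the bundle of germs of potentials: its fibre is `G` with the discrete
topology, and it is trivialised over each `S p` by the potential `φ p`. -/
def potentialBundle [TopologicalSpace G] [DiscreteTopology G] (hopen : ∀ y, IsOpen (S y))
    (hself : ∀ y, y ∈ S y) (hne : ∀ y, (near y).Nonempty)
    (hsub : ∀ p, ∀ q ∈ S p, near q ⊆ near p)
    (hφ : ∀ p, ∀ q ∈ S p, ∀ c ∈ near q, ∀ c' ∈ near q,
      (φ p c)⁻¹ * φ p c' = (φ q c)⁻¹ * φ q c') : FiberBundleCore Y Y G where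
  baseSet := S
  isOpen_baseSet := hopen
  indexAt := id
  mem_baseSet_at := hself
  -- Over `S p ∩ S q` the two potentials differ by a left constant on `near x`, so the element at
  -- which it is evaluated does not matter.
  coordChange p q x v := v * (φ p (hne x).some * (φ q (hne x).some)⁻¹)
  coordChange_self p x _ v := by simp
  continuousOn_coordChange p q := by
    rintro ⟨x, v⟩ ⟨hx, -⟩
    -- The constant is locally constant in the base point because `near y` is contained in `near x`.
    have hconst : ∀ y ∈ S x, φ p (hne y).some * (φ q (hne y).some)⁻¹ =
        φ p (hne x).some * (φ q (hne x).some)⁻¹ := by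
      intro y hy
      have hy' := hsub x y hy (hne y).some_mem
      have h1 := hφ p x hx.1 _ (hne x).some_mem _ hy'
      have h2 := hφ q x hx.2 _ (hne x).some_mem _ hy'
      rw [eq_mul_inv_iff_mul_eq, inv_mul_eq_iff_eq_mul.1 h1, inv_mul_eq_iff_eq_mul.1 h2]
      group
    refine ContinuousWithinAt.congr_of_eventuallyEq (f := fun y : Y × G =>
      y.2 * (φ p (hne x).some * (φ q (hne x).some)⁻¹)) ?_ ?_ rfl
    · exact ((continuous_of_discreteTopology (f := fun v : G =>
        v * (φ p (hne x).some * (φ q (hne x).some)⁻¹))).comp continuous_snd).continuousWithinAt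
    · have : S x ×ˢ (Set.univ : Set G) ∈ nhds (x, v) :=
        ((hopen x).prod isOpen_univ).mem_nhds ⟨hself x, trivial⟩
      filter_upwards [mem_nhdsWithin_of_mem_nhds this] with y hy
      rw [hconst y.1 hy.1]
  coordChange_comp p q r x _ v := by simp [mul_assoc]

/-- Transport along homotopy classes of paths, determined by a family of local potentials that
agree up to constants. -/
theorem exists_transport (hopen : ∀ y, IsOpen (S y))
    (hself : ∀ y, y ∈ S y) (hne : ∀ y, (near y).Nonempty)
    (hsub : ∀ p, ∀ q ∈ S p, near q ⊆ near p)
    (hφ : ∀ p, ∀ q ∈ S p, ∀ c ∈ near q, ∀ c' ∈ near q,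
      (φ p c)⁻¹ * φ p c' = (φ q c)⁻¹ * φ q c') :
    ∃ M : ∀ {a b : Y}, Path.Homotopic.Quotient a b → G → G,
      (∀ a v, M (Path.Homotopic.Quotient.refl a) v = v) ∧
      (∀ {a b c : Y} (γ : Path.Homotopic.Quotient a b) (γ' : Path.Homotopic.Quotient b c) (v : G),
        M (γ.trans γ') v = M γ' (M γ v)) ∧
      ∀ (p : Y) {a b : Y} (γ : Path a b), (∀ t, γ t ∈ S p) → ∀ c ∈ near a, ∀ c' ∈ near b, ∀ v : G,
        M (Path.Homotopic.Quotient.mk γ) (v * (φ a c)⁻¹) * φ b c' =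
          v * (φ p c)⁻¹ * φ p c' := by
  -- A discrete fibre makes the bundle a covering, and transport is its monodromy.
  let _ : TopologicalSpace G := ⊥
  have _ : DiscreteTopology G := ⟨rfl⟩
  let Z := potentialBundle S near φ hopen hself hne hsub hφ
  have cov : IsCoveringMap (Bundle.TotalSpace.proj : Z.TotalSpace → Y) :=
    FiberBundle.isCoveringMap (F := G) (E := Z.Fiber)
  have hM : ∀ {a b : Y} (γ : Path.Homotopic.Quotient a b) (v : G),
      cov.monodromy γ ⟨(⟨a, v⟩ : Z.TotalSpace), rfl⟩ =
        ⟨(⟨b, (cov.monodromy γ ⟨(⟨a, v⟩ : Z.TotalSpace), rfl⟩).1.2⟩ : Z.TotalSpace), rfl⟩ := by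
    intro a b γ v
    obtain ⟨⟨b', w⟩, hw⟩ := cov.monodromy γ ⟨(⟨a, v⟩ : Z.TotalSpace), rfl⟩
    obtain rfl : b' = b := hw
    rfl
  refine ⟨fun {a b} γ v => (cov.monodromy γ ⟨(⟨a, v⟩ : Z.TotalSpace), rfl⟩).1.2, ?_, ?_, ?_⟩
  · intro a v
    have h : cov.monodromy (.refl a) ⟨(⟨a, v⟩ : Z.TotalSpace), rfl⟩ =
        ⟨(⟨a, v⟩ : Z.TotalSpace), rfl⟩ := congrFun cov.monodromy_refl _
    exact congrArg (fun e => (e.1.2 : G)) h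
  · intro a b c γ γ' v
    have h := cov.monodromy_trans_apply γ γ' ⟨(⟨a, v⟩ : Z.TotalSpace), rfl⟩
    exact congrArg (fun e => (e.1.2 : G))
      (h.trans (congrArg (fun e => cov.monodromy γ' e) (hM γ v)))
  · intro p a b γ hγ c hc c' hc' v
    have hcont : Continuous fun t =>
        (Z.localTriv p).toOpenPartialHomeomorph.symm (γ t, v * (φ p c)⁻¹) := by
      refine (Z.localTriv p).toOpenPartialHomeomorph.continuousOn_symm.comp_continuous
        (by fun_prop) fun t => ?_
      rw [(Z.localTriv p).mem_target]
      exact hγ t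
    have h0 := hγ 0
    have h1 := hγ 1
    rw [γ.source] at h0
    rw [γ.target] at h1
    -- The lift of `γ` that is constant in the trivialisation given by `φ p`; `e1` and `e2` express
    -- its ends through `φ a` and `φ b`.
    let δ : Path (⟨a, v * (φ p c)⁻¹ * (φ p (hne a).some * (φ a (hne a).some)⁻¹)⟩ : Z.TotalSpace)
        ⟨b, v * (φ p c)⁻¹ * (φ p (hne b).some * (φ b (hne b).some)⁻¹)⟩ :=
      { toFun := fun t => (Z.localTriv p).toOpenPartialHomeomorph.symm (γ t, v * (φ p c)⁻¹)
        continuous_toFun := hcont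
        source' := by rw [γ.source]; rfl
        target' := by rw [γ.target]; rfl }
    have hδ := cov.monodromy_map (Path.Homotopic.Quotient.mk δ)
    rw [← Path.Homotopic.Quotient.mk_map] at hδ
    have hmap : δ.map cov.continuous = γ := by ext t; rfl
    have e1 : v * (φ p c)⁻¹ * (φ p (hne a).some * (φ a (hne a).some)⁻¹) = v * (φ a c)⁻¹ := by
      have := hφ p a h0 c hc _ (hne a).some_mem
      rw [mul_assoc, ← mul_assoc _ (φ p _), this]
      group
    have e2 : v * (φ p c)⁻¹ * (φ p (hne b).some * (φ b (hne b).some)⁻¹) * φ b c' =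
        v * (φ p c)⁻¹ * φ p c' := by
      have := hφ p b h1 _ (hne b).some_mem c' hc'
      rw [mul_assoc _ _ (φ b c'), mul_assoc _ _ (φ b c'), ← this]
      group
    rw [← e2, ← e1]
    congr 1
    have h2 : cov.monodromy (Path.Homotopic.Quotient.mk γ) ⟨(⟨a, _⟩ : Z.TotalSpace), rfl⟩ =
      ⟨(⟨b, _⟩ : Z.TotalSpace), rfl⟩ := hδ
    exact congrArg (fun e => (e.1.2 : G)) h2

end Transport

namespace EllipticArrangement
variable {d n : ℕ} {𝒜 : EllipticArrangement d n}

/-! ### The covering of the complement by pairs of real vectors -/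

theorem real_combo_mem_lattice {s t : ℝ} :
    (s : ℂ) + 𝒜.ω * (t : ℂ) ∈ 𝒜.lattice ↔ (∃ m : ℤ, s = m) ∧ ∃ m : ℤ, t = m := by
  rw [lattice, AddSubgroup.mem_closure_pair]
  constructor
  · rintro ⟨a, b, h⟩
    have h1 := congrArg Complex.im h
    have h2 := congrArg Complex.re h
    simp at h1 h2
    have ht : t = b := by
      have : 𝒜.ω.im * (t - b) = 0 := by linarith
      rcases mul_eq_zero.1 this with h | h
      · exact absurd h 𝒜.ω_not_real
      · linarith
    subst ht
    exact ⟨⟨a, by linarith⟩, b, rfl⟩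
  · rintro ⟨⟨a, rfl⟩, b, rfl⟩
    exact ⟨a, b, by simp [mul_comm]⟩

theorem mk_real_combo_eq_iff {s t s' t' : ℝ} :
    (QuotientAddGroup.mk ((s : ℂ) + 𝒜.ω * (t : ℂ)) : 𝒜.Curve) =
      QuotientAddGroup.mk ((s' : ℂ) + 𝒜.ω * (t' : ℂ)) ↔
      (∃ m : ℤ, s' = s + m) ∧ ∃ m : ℤ, t' = t + m := by
  rw [QuotientAddGroup.eq, show -((s : ℂ) + 𝒜.ω * (t : ℂ)) + ((s' : ℂ) + 𝒜.ω * (t' : ℂ)) =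
    ((s' - s : ℝ) : ℂ) + 𝒜.ω * ((t' - t : ℝ) : ℂ) by push_cast; ring, real_combo_mem_lattice]
  simp only [sub_eq_iff_eq_add']

theorem point_eq_iff {x y x' y' : Fin d → ℝ} : 𝒜.point x y = 𝒜.point x' y' ↔
    (∃ v, x' = x + intVec v) ∧ ∃ w, y' = y + intVec w := by
  constructor
  · intro h
    have h' := fun k => mk_real_combo_eq_iff.1 (congrFun h k)
    choose v hv using fun k => (h' k).1
    choose w hw using fun k => (h' k).2
    exact ⟨⟨v, funext hv⟩, w, funext hw⟩
  · rintro ⟨⟨v, rfl⟩, w, rfl⟩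
    funext k
    exact mk_real_combo_eq_iff.2 ⟨⟨v k, rfl⟩, w k, rfl⟩

variable (𝒜) in
/-- The homomorphism `(x, y) ↦ x + ω y` onto the product of curves. -/
def pointHom : (Fin d → ℝ) × (Fin d → ℝ) →+ (Fin d → 𝒜.Curve) where
  toFun p := 𝒜.point p.1 p.2
  map_zero' := by
    funext k
    simp [point]
  map_add' p q := by
    funext k
    simp only [point, Prod.fst_add, Prod.snd_add, Pi.add_apply]
    rw [← QuotientAddGroup.mk_add]
    congr 1
    push_cast
    ring

theorem pointHom_apply (p : (Fin d → ℝ) × (Fin d → ℝ)) : 𝒜.pointHom p = 𝒜.point p.1 p.2 := rfl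

theorem sum_smul_point (j : Fin n) (x y : Fin d → ℝ) : ∑ k, 𝒜.A k j • 𝒜.point x y k =
    QuotientAddGroup.mk ((𝒜.ell j x : ℂ) + 𝒜.ω * (𝒜.ell j y : ℂ)) := by
  have h : ∀ k, 𝒜.A k j • 𝒜.point x y k = QuotientAddGroup.mk' 𝒜.lattice
      ((𝒜.A k j : ℂ) * ((x k : ℂ) + 𝒜.ω * (y k : ℂ))) := fun k => by
    rw [← zsmul_eq_mul, map_zsmul]; rfl
  simp only [h, ← map_sum]
  rw [QuotientAddGroup.mk'_apply]
  congr 1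
  simp only [ell_apply]
  push_cast
  rw [Finset.mul_sum, ← Finset.sum_add_distrib]
  exact Finset.sum_congr rfl fun k _ => by ring

/-- The equation separates into its coordinates along `1` and `ω`, so the hypersurface pulls back to
a product and the complement becomes disjointness of supports. -/
theorem point_mem_ellipticHypersurface {j : Fin n} {x y : Fin d → ℝ} :
    𝒜.point x y ∈ 𝒜.ellipticHypersurface j ↔ j ∈ 𝒜.support x ∧ j ∈ 𝒜.support y := by
  have h : 𝒜.point x y ∈ 𝒜.ellipticHypersurface j ↔ ∃ β : ℝ, (β : UnitAddCircle) = 𝒜.b j ∧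
    ∑ k, 𝒜.A k j • 𝒜.point x y k = QuotientAddGroup.mk ((β : ℂ) + 𝒜.ω * (β : ℂ)) := Iff.rfl
  rw [h, sum_smul_point]
  constructor
  · rintro ⟨β, hβ, hz⟩
    obtain ⟨m, rfl⟩ := (𝒜.coe_eq_b_iff j β).1 hβ
    obtain ⟨⟨a, ha⟩, b, hb⟩ := mk_real_combo_eq_iff.1 hz.symm
    exact ⟨⟨m + a, by rw [height, ha]; push_cast; ring⟩, m + b, by rw [height, hb]; push_cast; ring⟩
  · rintro ⟨⟨a, ha⟩, b, hb⟩
    rw [height, sub_eq_iff_eq_add'] at ha hb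
    exact ⟨𝒜.shift j, 𝒜.coe_shift j, (mk_real_combo_eq_iff.2 ⟨⟨a, ha⟩, b, hb⟩).symm⟩

variable (𝒜) in
/-- The map `(x, y) ↦ x + ω y` before passing to the quotient by the lattice. -/
def complexCombo : (Fin d → ℝ) × (Fin d → ℝ) →ₗ[ℝ] (Fin d → ℂ) where
  toFun p k := (p.1 k : ℂ) + 𝒜.ω * (p.2 k : ℂ)
  map_add' p q := by
    funext k
    simp only [Prod.fst_add, Prod.snd_add, Pi.add_apply]
    push_cast
    ring
  map_smul' c p := by
    funext k
    simp only [Prod.smul_fst, Prod.smul_snd, Pi.smul_apply, smul_eq_mul, RingHom.id_apply,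
      Complex.real_smul]
    push_cast
    ring

theorem complexCombo_surjective : Function.Surjective 𝒜.complexCombo := by
  intro z
  -- The coordinates of `z k` in the real basis `1`, `ω`.
  refine ⟨(fun k => (z k).re - 𝒜.ω.re * ((z k).im / 𝒜.ω.im), fun k => (z k).im / 𝒜.ω.im), ?_⟩
  have := 𝒜.ω_not_real
  funext k
  apply Complex.ext
  · simp [complexCombo]
  · simp [complexCombo]
    field_simp

theorem isQuotientMap_pointHom : Topology.IsQuotientMap 𝒜.pointHom := by
  have h1 : IsOpenQuotientMap 𝒜.complexCombo :=
    ⟨complexCombo_surjective, LinearMap.continuous_of_finiteDimensional _,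
      LinearMap.isOpenMap_of_finiteDimensional _ complexCombo_surjective⟩
  have h2 : IsOpenQuotientMap (Pi.map fun (_ : Fin d) => (QuotientAddGroup.mk : ℂ → 𝒜.Curve)) :=
    IsOpenQuotientMap.piMap fun _ => QuotientAddGroup.isOpenQuotientMap_mk
  exact (h2.comp h1).isQuotientMap

/-- Points of the kernel differ by pairs of integral vectors, and a nonzero integral vector has norm
at least one. -/
theorem isDiscrete_ker_pointHom : IsDiscrete (𝒜.pointHom.ker : Set ((Fin d → ℝ) × (Fin d → ℝ))) := by
  apply IsDiscrete.of_nhdsWithin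
  intro p hp
  rw [Filter.le_pure_iff, mem_nhdsWithin]
  refine ⟨Metric.ball p 1, Metric.isOpen_ball, Metric.mem_ball_self one_pos, ?_⟩
  rintro q ⟨hqp, hq⟩
  have hpq : 𝒜.point p.1 p.2 = 𝒜.point q.1 q.2 := by
    have h1 : 𝒜.pointHom p = 0 := hp
    have h2 : 𝒜.pointHom q = 0 := hq
    rw [← pointHom_apply, ← pointHom_apply, h1, h2]
  obtain ⟨⟨v, hv⟩, w, hw⟩ := point_eq_iff.1 hpq
  have hzero : ∀ (a b : Fin d → ℝ) (u : Fin d → ℤ), b = a + intVec u → dist b a < 1 → b = a := by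
    intro a b u hu hab
    funext k
    have h1 := (dist_le_pi_dist b a k).trans_lt hab
    rw [hu, Real.dist_eq] at h1
    simp only [Pi.add_apply, intVec, add_sub_cancel_left] at h1
    have h2 : u k = 0 := Int.abs_lt_one_iff.1 (by exact_mod_cast h1)
    simp [hu, intVec, h2]
  rw [Metric.mem_ball, Prod.dist_eq, max_lt_iff] at hqp
  exact Prod.ext (hzero _ _ v hv hqp.1) (hzero _ _ w hw hqp.2)

variable (𝒜) in
/-- The pairs of real vectors `(x, y)` for which `x + ω y` lies in the complement. -/
abbrev Cover : Type :=
  {p : (Fin d → ℝ) × (Fin d → ℝ) // ∀ j, 𝒜.point p.1 p.2 ∉ 𝒜.ellipticHypersurface j}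

/-- The covering map onto the complement. -/
def Cover.proj (p : 𝒜.Cover) : 𝒜.Complement := ⟨𝒜.point p.1.1 p.1.2, p.2⟩

theorem isCoveringMap_proj : IsCoveringMap (Cover.proj : 𝒜.Cover → 𝒜.Complement) :=
  (isQuotientMap_pointHom.isAddQuotientCoveringMap_of_isDiscrete_ker_addMonoidHom
    isDiscrete_ker_pointHom).isCoveringMap.restrictPreimage
      {z | ∀ j, z ∉ 𝒜.ellipticHypersurface j}

/-! ### Convex neighbourhoods in the cover and the action of the lattice -/

namespace Cover

theorem mem_iff {p : (Fin d → ℝ) × (Fin d → ℝ)} :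
    (∀ j, 𝒜.point p.1 p.2 ∉ 𝒜.ellipticHypersurface j) ↔
      𝒜.support p.1 ∩ 𝒜.support p.2 = ∅ := by
  simp only [point_mem_ellipticHypersurface, Set.eq_empty_iff_forall_notMem, Set.mem_inter_iff]

theorem support_inter (p : 𝒜.Cover) : 𝒜.support p.1.1 ∩ 𝒜.support p.1.2 = ∅ := mem_iff.1 p.2

/-- The product of the open stars of the two components. -/
def star (p : 𝒜.Cover) : Set 𝒜.Cover := {q | q.1.1 ∈ 𝒜.star p.1.1 ∧ q.1.2 ∈ 𝒜.star p.1.2}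

/-- Supports only shrink within a star, so disjointness persists. This is what provides the points
of the cover with convex open neighbourhoods. -/
theorem mem_of_mem_stars (p : 𝒜.Cover) {q : (Fin d → ℝ) × (Fin d → ℝ)}
    (hq : q ∈ 𝒜.star p.1.1 ×ˢ 𝒜.star p.1.2) :
    ∀ j, 𝒜.point q.1 q.2 ∉ 𝒜.ellipticHypersurface j := by
  rw [mem_iff, Set.eq_empty_iff_forall_notMem]
  rintro j ⟨h1, h2⟩
  have : j ∈ 𝒜.support p.1.1 ∩ 𝒜.support p.1.2 :=
    ⟨mem_support_of_mem_star hq.1 h1, mem_support_of_mem_star hq.2 h2⟩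
  rw [p.support_inter] at this
  exact this

theorem isOpen_star (p : 𝒜.Cover) : IsOpen p.star :=
  ((𝒜.isOpen_star p.1.1).prod (𝒜.isOpen_star p.1.2)).preimage continuous_subtype_val

theorem mem_star_self (p : 𝒜.Cover) : p ∈ p.star := ⟨𝒜.mem_star_self _, 𝒜.mem_star_self _⟩

theorem star_subset {p q : 𝒜.Cover} (h : q ∈ p.star) : q.star ⊆ p.star := fun _ hr =>
  ⟨star_subset_star h.1 hr.1, star_subset_star h.2 hr.2⟩

theorem convex_stars (p : 𝒜.Cover) : Convex ℝ (𝒜.star p.1.1 ×ˢ 𝒜.star p.1.2) :=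
  (𝒜.convex_star _).prod (𝒜.convex_star _)

/-- Two paths in the star of a point with the same ends are homotopic. -/
theorem homotopic_of_mem_star {p a b : 𝒜.Cover} (γ γ' : Path a b) (h : ∀ t, γ t ∈ p.star)
    (h' : ∀ t, γ' t ∈ p.star) : γ.Homotopic γ' := by
  let K := 𝒜.star p.1.1 ×ˢ 𝒜.star p.1.2
  have : ContractibleSpace K := p.convex_stars.contractibleSpace ⟨p.1, p.mem_star_self⟩
  let ι : C(K, 𝒜.Cover) := ⟨fun q => ⟨q.1, p.mem_of_mem_stars q.2⟩, by fun_prop⟩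
  have ha := h 0
  have hb := h 1
  rw [γ.source] at ha
  rw [γ.target] at hb
  let lift : ∀ δ : Path a b, (∀ t, δ t ∈ p.star) → Path (⟨a.1, ha⟩ : K) ⟨b.1, hb⟩ := fun δ hδ =>
    { toFun := fun t => ⟨(δ t).1, hδ t⟩
      continuous_toFun := by fun_prop
      source' := by simp
      target' := by simp }
  have := (SimplyConnectedSpace.paths_homotopic (lift γ h) (lift γ' h')).map ι
  exact this

/-- The straight path between two points of the star of a point. -/
def straight {p a b : 𝒜.Cover} (ha : a ∈ p.star) (hb : b ∈ p.star) : Path a b where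
  toFun t := ⟨(1 - t : ℝ) • a.1 + (t : ℝ) • b.1, p.mem_of_mem_stars
    (p.convex_stars ha hb (by linarith [t.2.2]) t.2.1 (by ring))⟩
  continuous_toFun := by fun_prop
  source' := Subtype.ext (by simp)
  target' := Subtype.ext (by simp)

theorem straight_mem {p a b : 𝒜.Cover} (ha : a ∈ p.star) (hb : b ∈ p.star) (t : I) :
    straight ha hb t ∈ p.star :=
  p.convex_stars ha hb (by linarith [t.2.2]) t.2.1 (by ring)

theorem trans_mem_star {p a b c : 𝒜.Cover} {γ : Path a b} {γ' : Path b c}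
    (h : ∀ t, γ t ∈ p.star) (h' : ∀ t, γ' t ∈ p.star) (t : I) : γ.trans γ' t ∈ p.star := by
  rw [Path.trans_apply]
  split_ifs
  · exact h _
  · exact h' _

/-- Translation by a pair of integral vectors. -/
def translate (p : 𝒜.Cover) (v w : Fin d → ℤ) : 𝒜.Cover :=
  ⟨(p.1.1 + intVec v, p.1.2 + intVec w), by
    rw [mem_iff, support_add_intVec, support_add_intVec]; exact p.support_inter⟩

theorem proj_translate (p : 𝒜.Cover) (v w : Fin d → ℤ) : (p.translate v w).proj = p.proj :=
  Subtype.ext (point_eq_iff.2 ⟨⟨v, rfl⟩, w, rfl⟩).symm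

theorem proj_eq_iff {p q : 𝒜.Cover} : p.proj = q.proj ↔ ∃ v w, q = p.translate v w := by
  constructor
  · intro h
    obtain ⟨⟨v, hv⟩, w, hw⟩ := point_eq_iff.1 (congrArg Subtype.val h)
    exact ⟨v, w, Subtype.ext (Prod.ext hv hw)⟩
  · rintro ⟨v, w, rfl⟩
    exact (p.proj_translate v w).symm

end Cover

end EllipticArrangement

/-! ### Spanning trees -/

/-- Weights on the edges of a forest are differences of a potential. -/
theorem exists_potential_of_forest {V E G : Type*} [Group G] [Finite E] (tail head : E → V)
    (T : Set E) (hT : ∀ e ∈ T,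
      ¬ Relation.EqvGen (fun x y => ∃ f ∈ T \ {e}, tail f = x ∧ head f = y) (tail e) (head e))
    (f : E → G) : ∃ ψ : V → G, ∀ e ∈ T, ψ (tail e) * f e = ψ (head e) := by
  classical
  induction T, T.toFinite using Set.Finite.induction_on with
  | empty => exact ⟨fun _ => 1, by simp⟩
  | @insert e T he _ ih =>
    obtain ⟨ψ, hψ⟩ := ih fun e' he' h => hT e' (Set.mem_insert_of_mem _ he')
      (h.mono fun x y ⟨g, hg, h⟩ => ⟨g, ⟨Set.mem_insert_of_mem _ hg.1, hg.2⟩, h⟩)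
    let R : V → V → Prop := fun x y => ∃ g ∈ T, tail g = x ∧ head g = y
    have hsep : ¬ Relation.EqvGen R (tail e) (head e) := fun h =>
      hT e (Set.mem_insert _ _) (h.mono fun x y ⟨g, hg, h⟩ =>
        ⟨g, ⟨Set.mem_insert_of_mem _ hg, fun e' => he (e' ▸ hg)⟩, h⟩)
    -- The component of `head e` is shifted by the constant that makes the new edge right; `tail e`
    -- lies in another component and is not affected.
    let k := ψ (tail e) * f e * (ψ (head e))⁻¹
    refine ⟨fun v => if Relation.EqvGen R v (head e) then k * ψ v else ψ v, ?_⟩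
    rintro g (rfl | hg)
    · beta_reduce
      rw [if_neg hsep, if_pos (Relation.EqvGen.refl _)]
      simp [k]
    · have hR : Relation.EqvGen R (tail g) (head g) := .rel _ _ ⟨g, hg, rfl, rfl⟩
      beta_reduce
      by_cases h : Relation.EqvGen R (head g) (head e)
      · rw [if_pos h, if_pos (hR.trans _ _ _ h), mul_assoc, hψ g hg]
      · rw [if_neg h, if_neg fun h' => h ((hR.symm _ _).trans _ _ _ h'), hψ g hg]

theorem Relation.EqvGen.lift' {α β : Type*} {r : α → α → Prop} {s : β → β → Prop} {x y : α}
    (f : α → β) (h : ∀ a b, r a b → Relation.EqvGen s (f a) (f b)) (hxy : Relation.EqvGen r x y) :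
    Relation.EqvGen s (f x) (f y) := by
  induction hxy with
  | rel _ _ hr => exact h _ _ hr
  | refl _ => exact .refl _
  | symm _ _ _ ih => exact ih.symm _ _
  | trans _ _ _ _ _ ih ih' => exact ih.trans _ _ _ ih'

/-! ### The tree in the product graph -/

namespace EllipticArrangement
variable {d n : ℕ} {𝒜 : EllipticArrangement d n}

theorem fst_mem_treeK {C₀ C : 𝒜.Chamber} {T : Set 𝒜.Wall} {a : 𝒜.Wall} :
    Edge.fst a C ∈ treeK C₀ T ↔ a ∈ T ∧ C = C₀ := by
  constructor
  · rintro (⟨t, ht, h⟩ | ⟨t, _, D, h⟩)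
    · obtain ⟨rfl, rfl⟩ := Edge.fst.inj h
      exact ⟨ht, rfl⟩
    · cases h
  · rintro ⟨ha, rfl⟩
    exact Or.inl ⟨a, ha, rfl⟩

theorem snd_mem_treeK {C₀ C : 𝒜.Chamber} {T : Set 𝒜.Wall} {a : 𝒜.Wall} :
    Edge.snd C a ∈ treeK C₀ T ↔ a ∈ T := by
  constructor
  · rintro (⟨t, ht, h⟩ | ⟨t, ht, D, h⟩)
    · cases h
    · obtain ⟨rfl, rfl⟩ := Edge.snd.inj h
      exact ht
  · exact fun ha => Or.inr ⟨a, ha, C, rfl⟩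

theorem generators_eq_compl (C₀ : 𝒜.Chamber) (T : Set 𝒜.Wall) :
    generators C₀ T = (treeK C₀ T)ᶜ := by
  ext e
  rw [Set.mem_compl_iff]
  constructor
  · rintro ((⟨a, ha, rfl⟩ | ⟨a, C, hC, rfl⟩) | ⟨C, a, ha, rfl⟩)
    · exact fun h => ha (fst_mem_treeK.1 h).1
    · exact fun h => hC (fst_mem_treeK.1 h).2
    · exact fun h => ha (snd_mem_treeK.1 h)
  · intro h
    cases e with
    | fst a C =>
      rw [fst_mem_treeK] at h
      by_cases hC : C = C₀
      · exact Or.inl (Or.inl ⟨a, fun ha => h ⟨ha, hC⟩, by rw [hC]⟩)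
      · exact Or.inl (Or.inr ⟨a, C, hC, rfl⟩)
    | snd C a => exact Or.inr ⟨C, a, fun ha => h (snd_mem_treeK.2 ha), rfl⟩

/-- The tree has a vertical copy of `T` over every chamber and one horizontal copy at `C₀` joining
them, which gives connectedness. A connection of the ends of an edge by other tree edges is excluded
by mapping back to `T`: for a horizontal edge by the first coordinate, for a vertical edge over `C`
by collapsing all other columns to `C₀`. The other tree edges then go to other edges of `T` or to
points. -/
theorem isSpanningTree_treeK (o : 𝒜.Orientation) (C₀ : 𝒜.Chamber) {T : Set 𝒜.Wall}
    (hT : IsSpanningTree o.tailOf o.headOf T) :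
    IsSpanningTree (Edge.tail o) (Edge.head o) (treeK C₀ T) := by
  classical
  constructor
  · have h1 : ∀ v : 𝒜.Vertex, Relation.EqvGen
        (fun x y => ∃ e ∈ treeK C₀ T, Edge.tail o e = x ∧ Edge.head o e = y) v (C₀, C₀) := by
      rintro ⟨C, D⟩
      refine Relation.EqvGen.trans _ (C, C₀) _ ?_ ?_
      · refine Relation.EqvGen.lift' (fun D => (C, D)) ?_ (hT.1 D C₀)
        rintro _ _ ⟨t, ht, rfl, rfl⟩
        exact .rel _ _ ⟨.snd C t, snd_mem_treeK.2 ht, rfl, rfl⟩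
      · refine Relation.EqvGen.lift' (fun C => (C, C₀)) ?_ (hT.1 C C₀)
        rintro _ _ ⟨t, ht, rfl, rfl⟩
        exact .rel _ _ ⟨.fst t C₀, fst_mem_treeK.2 ⟨ht, rfl⟩, rfl, rfl⟩
    exact fun u v => (h1 u).trans _ _ _ ((h1 v).symm _ _)
  · rintro (⟨a, C⟩ | ⟨C, a⟩) he h
    · obtain ⟨ha, rfl⟩ := fst_mem_treeK.1 he
      refine hT.2 a ha (Relation.EqvGen.lift' Prod.fst ?_ h)
      rintro _ _ ⟨(⟨t, C'⟩ | ⟨C', t⟩), ⟨ht, hne⟩, rfl, rfl⟩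
      · exact .rel _ _ ⟨t, ⟨(fst_mem_treeK.1 ht).1, fun e => hne (by
          rw [Set.mem_singleton_iff] at e ⊢; rw [e, (fst_mem_treeK.1 ht).2])⟩,
          rfl, rfl⟩
      · exact .refl _
    · have ha := snd_mem_treeK.1 he
      obtain ⟨r, hr, hr', hr₀⟩ : ∃ r : 𝒜.Vertex → 𝒜.Chamber, (∀ D, r (C, D) = D) ∧
          (∀ C' D, C' ≠ C → r (C', D) = C₀) ∧ ∀ C', r (C', C₀) = C₀ :=
        ⟨fun v => if v.1 = C then v.2 else C₀, fun D => if_pos rfl, fun C' D h => if_neg h,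
          fun C' => ite_self _⟩
      have := Relation.EqvGen.lift' (s := fun x y => ∃ f ∈ T \ {a}, o.tailOf f = x ∧
        o.headOf f = y) r ?_ h
      · rw [Edge.tail, Edge.head, hr, hr] at this
        exact hT.2 a ha this
      rintro _ _ ⟨(⟨t, C'⟩ | ⟨C', t⟩), ⟨ht, hne⟩, rfl, rfl⟩
      · obtain ⟨ht, rfl⟩ := fst_mem_treeK.1 ht
        rw [Edge.tail, Edge.head, hr₀, hr₀]
        exact .refl _
      · have ht := snd_mem_treeK.1 ht
        rw [Edge.tail, Edge.head]
        by_cases hC : C' = C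
        · subst hC
          rw [hr, hr]
          exact .rel _ _ ⟨t, ⟨ht, fun e => hne (by rw [Set.mem_singleton_iff] at e ⊢; rw [e])⟩,
            rfl, rfl⟩
        · rw [hr' _ _ hC, hr' _ _ hC]
          exact .refl _

end EllipticArrangement

/-! ### Holonomy in a space with base points -/

section Holonomy

open Path

/-- Paths in a path-connected space have values in the fundamental group which extend the classes
of loops, are multiplicative, and are trivial on a given forest of paths between base points. -/
theorem exists_holonomy {X V E : Type*} [TopologicalSpace X] [Finite E] (tail head : E → V)
    (T : Set E) (hT : ∀ e ∈ T,
      ¬ Relation.EqvGen (fun x y => ∃ f ∈ T \ {e}, tail f = x ∧ head f = y) (tail e) (head e))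
    (pt : V → X) (hpt : Function.Injective pt) (v₀ : V) (hX : ∀ x, Joined (pt v₀) x)
    (δ : ∀ e, Path (pt (tail e)) (pt (head e))) :
    ∃ hol : ∀ {x y : X}, Homotopic.Quotient x y → (FundamentalGroup X (pt v₀))ᵐᵒᵖ,
      (∀ γ : Homotopic.Quotient (pt v₀) (pt v₀), hol γ = MulOpposite.op (FundamentalGroup.fromPath γ)) ∧
      (∀ {x y z : X} (γ : Homotopic.Quotient x y) (γ' : Homotopic.Quotient y z),
        hol (γ.trans γ') = hol γ * hol γ') ∧
      ∀ e ∈ T, hol (Homotopic.Quotient.mk (δ e)) = 1 := by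
  obtain ⟨β, hβ⟩ : ∃ β : ∀ x, Homotopic.Quotient (pt v₀) x, β (pt v₀) = .refl _ :=
    ⟨fun x => (Homotopic.Quotient.mk (hX (pt v₀)).somePath).symm.trans (Homotopic.Quotient.mk (hX x).somePath),
      Homotopic.Quotient.symm_trans _⟩
  let hol₀ : ∀ {x y : X}, Homotopic.Quotient x y → (FundamentalGroup X (pt v₀))ᵐᵒᵖ := fun {x y} γ =>
    MulOpposite.op (FundamentalGroup.fromPath (((β x).trans γ).trans (β y).symm))
  have hmul : ∀ {x y z : X} (γ : Homotopic.Quotient x y) (γ' : Homotopic.Quotient y z),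
      hol₀ (γ.trans γ') = hol₀ γ * hol₀ γ' := by
    intro x y z γ γ'
    rw [← MulOpposite.op_mul]
    refine congrArg MulOpposite.op ?_
    refine Eq.trans ?_ FundamentalGroup.mul_def.symm
    change ((β x).trans (γ.trans γ')).trans (β z).symm =
      (((β x).trans γ).trans (β y).symm).trans (((β y).trans γ').trans (β z).symm)
    simp only [Homotopic.Quotient.trans_assoc]
    rw [← Homotopic.Quotient.trans_assoc (β y).symm, Homotopic.Quotient.symm_trans, Homotopic.Quotient.refl_trans]
  have hloop : ∀ γ : Homotopic.Quotient (pt v₀) (pt v₀),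
      hol₀ γ = MulOpposite.op (FundamentalGroup.fromPath γ) := by
    intro γ
    refine congrArg MulOpposite.op ?_
    change ((β _).trans γ).trans (β _).symm = γ
    rw [hβ, Homotopic.Quotient.refl_trans, ← Homotopic.Quotient.mk_refl, ← Homotopic.Quotient.mk_symm, Path.refl_symm,
      Homotopic.Quotient.mk_refl, Homotopic.Quotient.trans_refl]
  obtain ⟨ψ, hψ⟩ := exists_potential_of_forest tail head T hT fun e => hol₀ (Homotopic.Quotient.mk (δ e))
  -- A change of gauge that is trivial at `v₀`: it preserves multiplicativity and the values of
  -- loops, and it cancels the values on the forest. Its values away from the base points are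
  -- irrelevant.
  let k : X → (FundamentalGroup X (pt v₀))ᵐᵒᵖ :=
    Function.extend pt (fun v => (ψ v₀)⁻¹ * ψ v) fun _ => 1
  have hk : ∀ v, k (pt v) = (ψ v₀)⁻¹ * ψ v := fun v => hpt.extend_apply _ _ v
  refine ⟨fun {x y} γ => k x * hol₀ γ * (k y)⁻¹, fun γ => ?_, fun γ γ' => ?_, fun e he => ?_⟩
  · beta_reduce
    rw [hloop, hk]
    simp
  · beta_reduce
    rw [hmul]
    group
  · beta_reduce
    rw [hk, hk, mul_assoc _ (ψ _), hψ e he, mul_inv_cancel]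

variable {X H : Type*} [TopologicalSpace X] {hol : ∀ {x y : X}, Homotopic.Quotient x y → H}

theorem Path.Homotopic.Quotient.hol_refl [Group H] (hmul : ∀ {x y z : X} (γ : Homotopic.Quotient x y)
    (γ' : Homotopic.Quotient y z), hol (γ.trans γ') = hol γ * hol γ') (x : X) :
    hol (Homotopic.Quotient.refl x) = 1 := by
  have := hmul (Homotopic.Quotient.refl x) (Homotopic.Quotient.refl x)
  rwa [Homotopic.Quotient.refl_trans, left_eq_mul] at this

theorem Path.Homotopic.Quotient.hol_symm [Group H] (hmul : ∀ {x y z : X} (γ : Homotopic.Quotient x y)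
    (γ' : Homotopic.Quotient y z), hol (γ.trans γ') = hol γ * hol γ') {x y : X} (γ : Homotopic.Quotient x y) :
    hol γ.symm = (hol γ)⁻¹ := by
  rw [eq_inv_iff_mul_eq_one, ← hmul, Homotopic.Quotient.symm_trans, Homotopic.Quotient.hol_refl hmul]

theorem Path.Homotopic.Quotient.hol_congr {x y x' y' : X} {γ : Path x y} {γ' : Path x' y'}
    (h : ∀ t, γ t = γ' t) : hol (Homotopic.Quotient.mk γ) = hol (Homotopic.Quotient.mk γ') := by
  obtain rfl : x = x' := by simpa using h 0
  obtain rfl : y = y' := by simpa using h 1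
  rw [Path.ext (funext h)]

end Holonomy

/-- A property of homotopy classes of paths that is closed under concatenation holds for all
classes if it holds for the classes of paths in the members of an open cover. -/
theorem Path.Homotopic.Quotient.induction_of_open_cover {Y : Type*} [TopologicalSpace Y]
    {S : Y → Set Y} (hopen : ∀ p, IsOpen (S p)) (hself : ∀ p, p ∈ S p)
    {P : ∀ {a b : Y}, Path.Homotopic.Quotient a b → Prop}
    (htrans : ∀ {a b c : Y} (γ : Path.Homotopic.Quotient a b) (γ' : Path.Homotopic.Quotient b c),
      P γ → P γ' → P (γ.trans γ'))
    (hlocal : ∀ (p : Y) {a b : Y} (γ : Path a b), (∀ t, γ t ∈ S p) →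
      P (Path.Homotopic.Quotient.mk γ))
    {a b : Y} (γ : Path.Homotopic.Quotient a b) : P γ := by
  induction γ using Path.Homotopic.Quotient.ind with | mk γ
  -- A subdivision of the interval each part of which is mapped into a member of the cover.
  obtain ⟨t, h0, hmono, ⟨m, hm⟩, ht⟩ := exists_monotone_Icc_subset_open_cover_unitInterval
    (c := fun p => γ ⁻¹' S p) (fun p => (hopen p).preimage γ.continuous)
    fun s _ => Set.mem_iUnion.2 ⟨γ s, hself _⟩
  have hn : ∀ k, P (Path.Homotopic.Quotient.mk (γ.subpath 0 (t k))) := by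
    intro k
    induction k with
    | zero =>
      refine hlocal (γ 0) _ fun s => ?_
      rw [h0, Path.subpath_self]
      exact hself _
    | succ k ih =>
      obtain ⟨p, hp⟩ := ht k
      rw [← Path.Homotopic.Quotient.eq.2 ⟨Path.Homotopy.subpathTransSubpath γ 0 (t k) (t (k + 1))⟩,
        Path.Homotopic.Quotient.mk_trans]
      refine htrans _ _ ih (hlocal p _ fun s => ?_)
      have : (γ.subpath (t k) (t (k + 1))) s ∈ Set.range (γ.subpath (t k) (t (k + 1))) := ⟨s, rfl⟩
      rw [Path.range_subpath_of_le _ _ _ (hmono k.le_succ)] at this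
      obtain ⟨r, hr, e⟩ := this
      rw [← e]
      exact hp hr
  have := hn m
  rw [hm m le_rfl, Path.subpath_zero_one] at this
  have hcast : ∀ {a' b' : Y} (e : a' = a) (e' : b' = b),
      P (Path.Homotopic.Quotient.mk (γ.cast e e')) → P (Path.Homotopic.Quotient.mk γ) := by
    rintro _ _ rfl rfl h
    exact h
  exact hcast _ _ this

namespace EllipticArrangement
variable {d n : ℕ} {𝒜 : EllipticArrangement d n} (o : 𝒜.Orientation)

/-! ### Pairs of lifted chambers and lifted edges -/

variable (𝒜) in
/-- Pairs of lifted chambers. -/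
abbrev LiftedVertex : Type := 𝒜.LiftedFace 0 × 𝒜.LiftedFace 0

/-- The vertex covered by a pair of lifted chambers. -/
def LiftedVertex.toVertex (c : 𝒜.LiftedVertex) : 𝒜.Vertex := (c.1.toCell, c.2.toCell)

/-- Translation of a pair of lifted chambers. -/
def LiftedVertex.translate (c : 𝒜.LiftedVertex) (v w : Fin d → ℤ) : 𝒜.LiftedVertex :=
  (c.1.translate v, c.2.translate w)

variable (𝒜) in
/-- Pairs consisting of a lifted wall and a lifted chamber. -/
inductive LiftedEdge : Type
  | fst (W : 𝒜.LiftedFace 1) (D : 𝒜.LiftedFace 0)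
  | snd (C : 𝒜.LiftedFace 0) (W : 𝒜.LiftedFace 1)

/-- The pairs of lifted chambers whose closures contain the given point. -/
def Cover.near (p : 𝒜.Cover) : Set 𝒜.LiftedVertex :=
  {c | c.1.pt ∈ 𝒜.star p.1.1 ∧ c.2.pt ∈ 𝒜.star p.1.2}

theorem Cover.near_nonempty (p : 𝒜.Cover) : p.near.Nonempty := by
  obtain ⟨C, hC⟩ := exists_chamber_near (𝒜 := 𝒜) p.1.1
  obtain ⟨D, hD⟩ := exists_chamber_near (𝒜 := 𝒜) p.1.2
  exact ⟨(C, D), hC, hD⟩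

theorem Cover.near_subset {p q : 𝒜.Cover} (h : q ∈ p.star) : q.near ⊆ p.near :=
  fun _ hc => ⟨star_subset_star h.1 hc.1, star_subset_star h.2 hc.2⟩

namespace LiftedEdge

/-- The pair of lifted chambers at the tail of a lifted edge. -/
def tail : 𝒜.LiftedEdge → 𝒜.LiftedVertex
  | fst W D => (o.tail W, D)
  | snd C W => (C, o.tail W)

/-- The pair of lifted chambers at the head of a lifted edge. -/
def head : 𝒜.LiftedEdge → 𝒜.LiftedVertex
  | fst W D => (o.head W, D)
  | snd C W => (C, o.head W)

/-- The edge covered by a lifted edge. -/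
def toEdge : 𝒜.LiftedEdge → 𝒜.Edge
  | fst W D => .fst W.toCell D.toCell
  | snd C W => .snd C.toCell W.toCell

/-- Translation of a lifted edge. -/
def translate (E : 𝒜.LiftedEdge) (v w : Fin d → ℤ) : 𝒜.LiftedEdge :=
  match E with
  | fst W D => fst (W.translate v) (D.translate w)
  | snd C W => snd (C.translate v) (W.translate w)

/-- A point whose star contains the two ends of a lifted edge. -/
def center : 𝒜.LiftedEdge → 𝒜.Cover
  | fst W D => ⟨(W.pt, D.pt), Cover.mem_iff.2 (by
      rw [support_chamber D.pt_mem, Set.inter_empty])⟩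
  | snd C W => ⟨(C.pt, W.pt), Cover.mem_iff.2 (by
      rw [support_chamber C.pt_mem, Set.empty_inter])⟩

variable {o}

theorem tail_mem_near (E : 𝒜.LiftedEdge) : E.tail o ∈ E.center.near := by
  cases E with
  | fst W D => exact ⟨o.tail_mem_star W, 𝒜.mem_star_self _⟩
  | snd C W => exact ⟨𝒜.mem_star_self _, o.tail_mem_star W⟩

theorem head_mem_near (E : 𝒜.LiftedEdge) : E.head o ∈ E.center.near := by
  cases E with
  | fst W D => exact ⟨o.head_mem_star W, 𝒜.mem_star_self _⟩
  | snd C W => exact ⟨𝒜.mem_star_self _, o.head_mem_star W⟩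

theorem tail_toEdge (E : 𝒜.LiftedEdge) : E.toEdge.tail o = (E.tail o).toVertex := by
  cases E with
  | fst W D => exact Prod.ext (o.tailOf_toCell W) rfl
  | snd C W => exact Prod.ext rfl (o.tailOf_toCell W)

theorem head_toEdge (E : 𝒜.LiftedEdge) : E.toEdge.head o = (E.head o).toVertex := by
  cases E with
  | fst W D => exact Prod.ext (o.headOf_toCell W) rfl
  | snd C W => exact Prod.ext rfl (o.headOf_toCell W)

theorem tail_translate (E : 𝒜.LiftedEdge) (v w : Fin d → ℤ) :
    (E.translate v w).tail o = (E.tail o).translate v w := by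
  cases E with
  | fst W D => exact Prod.ext (o.tail_translate W v) rfl
  | snd C W => exact Prod.ext rfl (o.tail_translate W w)

theorem head_translate (E : 𝒜.LiftedEdge) (v w : Fin d → ℤ) :
    (E.translate v w).head o = (E.head o).translate v w := by
  cases E with
  | fst W D => exact Prod.ext (o.head_translate W v) rfl
  | snd C W => exact Prod.ext rfl (o.head_translate W w)

theorem exists_translate_of_toEdge_eq {E E' : 𝒜.LiftedEdge} (h : E.toEdge = E'.toEdge) :
    ∃ v w, E' = E.translate v w := by
  cases E with
  | fst W D =>
    cases E' with
    | fst W' D' =>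
      obtain ⟨h1, h2⟩ := Edge.fst.inj h
      obtain ⟨v, rfl⟩ := LiftedFace.toCell_eq_iff.1 h1
      obtain ⟨w, rfl⟩ := LiftedFace.toCell_eq_iff.1 h2
      exact ⟨v, w, rfl⟩
    | snd C' W' => cases h
  | snd C W =>
    cases E' with
    | fst W' D' => cases h
    | snd C' W' =>
      obtain ⟨h1, h2⟩ := Edge.snd.inj h
      obtain ⟨v, rfl⟩ := LiftedFace.toCell_eq_iff.1 h1
      obtain ⟨w, rfl⟩ := LiftedFace.toCell_eq_iff.1 h2
      exact ⟨v, w, rfl⟩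

theorem toEdge_surjective : Function.Surjective (toEdge : 𝒜.LiftedEdge → 𝒜.Edge)
  | .fst a C => ⟨fst a.lift C.lift, by rw [toEdge, Cell.lift_toCell, Cell.lift_toCell]⟩
  | .snd C a => ⟨snd C.lift a.lift, by rw [toEdge, Cell.lift_toCell, Cell.lift_toCell]⟩

/-- Combinatorial path lifting, by which words in the edges are realised by paths on the cover. -/
theorem exists_of_tail {e : 𝒜.Edge} {c : 𝒜.LiftedVertex} (h : c.toVertex = e.tail o) :
    ∃ E : 𝒜.LiftedEdge, E.toEdge = e ∧ E.tail o = c := by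
  obtain ⟨C, D⟩ := c
  cases e with
  | fst a A =>
    obtain ⟨h1, rfl⟩ := Prod.ext_iff.1 h
    obtain ⟨W, rfl, rfl⟩ := o.exists_lift_of_tail a h1
    exact ⟨fst W D, rfl, rfl⟩
  | snd A a =>
    obtain ⟨rfl, h1⟩ := Prod.ext_iff.1 h
    obtain ⟨W, rfl, rfl⟩ := o.exists_lift_of_tail a h1
    exact ⟨snd C W, rfl, rfl⟩

theorem exists_of_head {e : 𝒜.Edge} {c : 𝒜.LiftedVertex} (h : c.toVertex = e.head o) :
    ∃ E : 𝒜.LiftedEdge, E.toEdge = e ∧ E.head o = c := by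
  obtain ⟨C, D⟩ := c
  cases e with
  | fst a A =>
    obtain ⟨h1, rfl⟩ := Prod.ext_iff.1 h
    obtain ⟨W, rfl, rfl⟩ := o.exists_lift_of_head a h1
    exact ⟨fst W D, rfl, rfl⟩
  | snd A a =>
    obtain ⟨rfl, h1⟩ := Prod.ext_iff.1 h
    obtain ⟨W, rfl, rfl⟩ := o.exists_lift_of_head a h1
    exact ⟨snd C W, rfl, rfl⟩

end LiftedEdge

/-- Applied to quotients of two potentials, this yields their uniqueness up to a constant. -/
theorem Cover.eq_of_eq_across_edges {α : Type*} {κ : 𝒜.LiftedVertex → α} {p : 𝒜.Cover}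
    (h : ∀ E : 𝒜.LiftedEdge, E.center ∈ p.star → κ (E.tail o) = κ (E.head o))
    {c c' : 𝒜.LiftedVertex} (hc : c ∈ p.near) (hc' : c' ∈ p.near) : κ c = κ c' :=
  eq_of_eq_across_walls_prod o (fun C D => κ (C, D)) (fun W D hW hD => h (.fst W D) ⟨hW, hD⟩)
    (fun C W hC hW => h (.snd C W) ⟨hC, hW⟩) hc.1 hc'.1 hc.2 hc'.2

/-! ### Base points -/

variable (𝒜) in
/-- A base point over every vertex, with its lifts to the covering. -/
structure BasePoints where
  pt : 𝒜.Vertex → 𝒜.Complement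
  liesOver : ∀ v, LiesOver (pt v) v
  lift : 𝒜.LiftedVertex → 𝒜.Cover
  fst_mem : ∀ c, (lift c).1.1 ∈ c.1.1
  snd_mem : ∀ c, (lift c).1.2 ∈ c.2.1
  proj_lift : ∀ c, (lift c).proj = pt c.toVertex

theorem LiesOver.eq {z : 𝒜.Complement} {v v' : 𝒜.Vertex} (h : LiesOver z v)
    (h' : LiesOver z v') : v = v' := by
  obtain ⟨x, y, hx, hy, hz⟩ := h
  obtain ⟨x', y', hx', hy', hz'⟩ := h'
  obtain ⟨⟨a, rfl⟩, b, rfl⟩ := point_eq_iff.1 (hz.symm.trans hz')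
  rw [proj_add_intVec] at hx' hy'
  exact Prod.ext (Cell.eq_of_mem hx hx') (Cell.eq_of_mem hy hy')

theorem Cell.exists_mem_lift {c : ℕ} {F : 𝒜.LiftedFace c} {x : Fin d → ℝ}
    (hx : EllipticArrangement.proj x ∈ F.toCell.1) : ∃ v, x + intVec v ∈ F.1 := by
  obtain ⟨G, hG, hxG⟩ := Cell.exists_lift_of_proj_mem hx
  obtain ⟨v, rfl⟩ := LiftedFace.toCell_eq_iff.1 hG
  exact ⟨v, LiftedFace.add_mem_translate hxG v⟩

theorem LiesOver.exists_cover {z : 𝒜.Complement} {c : 𝒜.LiftedVertex}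
    (h : LiesOver z c.toVertex) : ∃ p : 𝒜.Cover, p.1.1 ∈ c.1.1 ∧ p.1.2 ∈ c.2.1 ∧ p.proj = z := by
  obtain ⟨x, y, hx, hy, hz⟩ := h
  obtain ⟨v, hv⟩ := Cell.exists_mem_lift hx
  obtain ⟨w, hw⟩ := Cell.exists_mem_lift hy
  let p : 𝒜.Cover := ⟨(x, y), fun j => hz ▸ z.2 j⟩
  exact ⟨p.translate v w, hv, hw, (p.proj_translate v w).trans (Subtype.ext hz.symm)⟩

theorem exists_liesOver (v : 𝒜.Vertex) : ∃ z : 𝒜.Complement, LiesOver z v := by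
  have hx := LiftedFace.proj_mem_toCell v.1.lift.pt_mem
  have hy := LiftedFace.proj_mem_toCell v.2.lift.pt_mem
  rw [Cell.lift_toCell] at hx hy
  let p : 𝒜.Cover := ⟨(v.1.lift.pt, v.2.lift.pt), Cover.mem_iff.2 (by
    rw [support_chamber v.1.lift.pt_mem, Set.empty_inter])⟩
  exact ⟨p.proj, v.1.lift.pt, v.2.lift.pt, hx, hy, rfl⟩

theorem exists_basePoints {z₀ : 𝒜.Complement} {v₀ : 𝒜.Vertex} (hz₀ : LiesOver z₀ v₀) :
    ∃ B : 𝒜.BasePoints, B.pt v₀ = z₀ := by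
  classical
  choose z hz using exists_liesOver (𝒜 := 𝒜)
  have hpt : ∀ v, LiesOver (Function.update z v₀ z₀ v) v := by
    intro v
    obtain rfl | h := eq_or_ne v v₀
    · rwa [Function.update_self]
    · rw [Function.update_of_ne h]
      exact hz v
  choose lift h1 h2 h3 using fun c : 𝒜.LiftedVertex => (hpt c.toVertex).exists_cover
  exact ⟨⟨_, hpt, lift, h1, h2, h3⟩, Function.update_self ..⟩

namespace BasePoints

variable (B : 𝒜.BasePoints)

theorem pt_injective : Function.Injective B.pt := fun v v' h =>
  (B.liesOver v).eq (h ▸ B.liesOver v')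

/-- The projection to the torus is injective on faces, so a pair of lifted chambers contains only
one point over the base point. -/
theorem eq_lift {p : 𝒜.Cover} {c : 𝒜.LiftedVertex} (h1 : p.1.1 ∈ c.1.1) (h2 : p.1.2 ∈ c.2.1)
    (h : p.proj = B.pt c.toVertex) : p = B.lift c := by
  rw [← B.proj_lift] at h
  obtain ⟨v, w, e⟩ := Cover.proj_eq_iff.1 h
  have e1 := congrArg (fun q : 𝒜.Cover => q.1.1) e
  have e2 := congrArg (fun q : 𝒜.Cover => q.1.2) e
  exact Subtype.ext (Prod.ext
    (eq_of_sameFace_of_proj_eq (LiftedFace.sameFace h1 (B.fst_mem c)) (proj_eq_iff.2 ⟨v, e1⟩))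
    (eq_of_sameFace_of_proj_eq (LiftedFace.sameFace h2 (B.snd_mem c)) (proj_eq_iff.2 ⟨w, e2⟩)))

theorem exists_eq_lift {p : 𝒜.Cover} {v : 𝒜.Vertex} (h : p.proj = B.pt v) :
    ∃ c : 𝒜.LiftedVertex, c.toVertex = v ∧ p = B.lift c := by
  obtain ⟨x, y, hx, hy, hz⟩ := B.liesOver v
  obtain ⟨⟨a, ha⟩, b, hb⟩ := point_eq_iff.1 ((congrArg Subtype.val h).trans hz)
  rw [ha, proj_add_intVec] at hx
  rw [hb, proj_add_intVec] at hy
  obtain ⟨C, hC, hxC⟩ := Cell.exists_lift_of_proj_mem hx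
  obtain ⟨D, hD, hyD⟩ := Cell.exists_lift_of_proj_mem hy
  have hv : LiftedVertex.toVertex (C, D) = v := Prod.ext hC hD
  exact ⟨(C, D), hv, B.eq_lift hxC hyD (hv ▸ h)⟩

theorem lift_translate (c : 𝒜.LiftedVertex) (v w : Fin d → ℤ) :
    B.lift (c.translate v w) = (B.lift c).translate v w := by
  refine (B.eq_lift (LiftedFace.add_mem_translate (B.fst_mem c) v)
    (LiftedFace.add_mem_translate (B.snd_mem c) w) ?_).symm
  rw [Cover.proj_translate, B.proj_lift]
  exact congrArg B.pt (Prod.ext (LiftedFace.toCell_translate _ _).symm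
    (LiftedFace.toCell_translate _ _).symm)

theorem lift_mem_star {p : 𝒜.Cover} {c : 𝒜.LiftedVertex} (h : c ∈ p.near) :
    B.lift c ∈ p.star :=
  ⟨LiftedFace.subset_star h.1 (B.fst_mem c), LiftedFace.subset_star h.2 (B.snd_mem c)⟩

theorem mem_near_lift (c : 𝒜.LiftedVertex) : c ∈ (B.lift c).near :=
  ⟨(LiftedFace.pt_mem_star_iff (B.fst_mem c)).2 (𝒜.mem_star_self _),
    (LiftedFace.pt_mem_star_iff (B.snd_mem c)).2 (𝒜.mem_star_self _)⟩

/-- The straight path between the base points of two pairs of chambers near a point. -/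
def segment {p : 𝒜.Cover} {c c' : 𝒜.LiftedVertex} (h : c ∈ p.near) (h' : c' ∈ p.near) :
    Path (B.lift c) (B.lift c') :=
  Cover.straight (B.lift_mem_star h) (B.lift_mem_star h')

/-- The straight path along a lifted edge. -/
def edgePath (E : 𝒜.LiftedEdge) : Path (B.lift (E.tail o)) (B.lift (E.head o)) :=
  B.segment E.tail_mem_near E.head_mem_near

/-- Two lifts of an edge differ by a lattice translation, which carries straight paths to straight
paths; so one path downstairs serves for all lifts. -/
theorem proj_edgePath_eq {E E' : 𝒜.LiftedEdge} (h : E.toEdge = E'.toEdge) (t : I) :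
    (B.edgePath o E t).proj = (B.edgePath o E' t).proj := by
  obtain ⟨v, w, rfl⟩ := LiftedEdge.exists_translate_of_toEdge_eq h
  rw [Cover.proj_eq_iff]
  refine ⟨v, w, Subtype.ext ?_⟩
  have h1 : ∀ a b x y : (Fin d → ℝ) × (Fin d → ℝ), x = a + (intVec v, intVec w) →
      y = b + (intVec v, intVec w) → (1 - t : ℝ) • x + (t : ℝ) • y =
        ((1 - t : ℝ) • a + (t : ℝ) • b) + (intVec v, intVec w) := by
    rintro a b _ _ rfl rfl
    module
  exact h1 _ _ _ _
    (congrArg Subtype.val ((congrArg B.lift (E.tail_translate v w)).trans (B.lift_translate ..)))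
    (congrArg Subtype.val ((congrArg B.lift (E.head_translate v w)).trans (B.lift_translate ..)))

theorem continuous_proj : Continuous (Cover.proj : 𝒜.Cover → 𝒜.Complement) :=
  isCoveringMap_proj.continuous

theorem mem_chamber_of_mem_star {C : 𝒜.LiftedFace 0} {x : Fin d → ℝ} (h : x ∈ 𝒜.star C.pt) :
    x ∈ C.1 :=
  LiftedFace.mem_iff.2 (sameFace_of_mem_star (𝒜.mem_star_self _) h fun j hj => by
    rw [support_chamber C.pt_mem] at hj
    exact hj.elim)

/-- Paths along the edges, between the base points. -/
theorem exists_edge_paths : ∃ δ : ∀ e : 𝒜.Edge, Path (B.pt (e.tail o)) (B.pt (e.head o)),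
    (∀ e, Traverses o e (δ e)) ∧
    ∀ (E : 𝒜.LiftedEdge) (t : I), δ E.toEdge t = (B.edgePath o E t).proj := by
  choose E hE using LiftedEdge.toEdge_surjective (𝒜 := 𝒜)
  let δ : ∀ e : 𝒜.Edge, Path (B.pt (e.tail o)) (B.pt (e.head o)) := fun e =>
    ((B.edgePath o (E e)).map continuous_proj).cast
      (by rw [B.proj_lift, ← LiftedEdge.tail_toEdge, hE])
      (by rw [B.proj_lift, ← LiftedEdge.head_toEdge, hE])
  refine ⟨δ, fun e => ?_, fun E' t => B.proj_edgePath_eq o (hE _) t⟩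
  have hmem := fun t => Cover.straight_mem (B.lift_mem_star ((E e).tail_mem_near (o := o)))
    (B.lift_mem_star ((E e).head_mem_near (o := o))) t
  let x : C(I, Fin d → ℝ) := ⟨fun t => (B.edgePath o (E e) t).1.1, by fun_prop⟩
  let y : C(I, Fin d → ℝ) := ⟨fun t => (B.edgePath o (E e) t).1.2, by fun_prop⟩
  have h0 : B.edgePath o (E e) 0 = B.lift ((E e).tail o) := Path.source _
  have h1 : B.edgePath o (E e) 1 = B.lift ((E e).head o) := Path.target _
  have hx : ∀ t, x t ∈ 𝒜.star (E e).center.1.1 := fun t => (hmem t).1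
  have hy : ∀ t, y t ∈ 𝒜.star (E e).center.1.2 := fun t => (hmem t).2
  have hx0 : x 0 ∈ ((E e).tail o).1.1 := by
    have := B.fst_mem ((E e).tail o)
    rwa [← h0] at this
  have hx1 : x 1 ∈ ((E e).head o).1.1 := by
    have := B.fst_mem ((E e).head o)
    rwa [← h1] at this
  have hy0 : y 0 ∈ ((E e).tail o).2.1 := by
    have := B.snd_mem ((E e).tail o)
    rwa [← h0] at this
  have hy1 : y 1 ∈ ((E e).head o).2.1 := by
    have := B.snd_mem ((E e).head o)
    rwa [← h1] at this
  have hδ : ∀ t, (δ e t).1 = 𝒜.point (x t) (y t) := fun t => rfl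
  have hEe := hE e
  clear_value x y δ
  generalize E e = E' at *
  subst hEe
  cases E' with
  | fst W D => exact ⟨W, D, rfl, rfl, x, y, hx0, hx1, fun t =>
      ⟨o.mem_of_mem_star (hx t), mem_chamber_of_mem_star (hy t), hδ t⟩⟩
  | snd C W => exact ⟨W, C, rfl, rfl, x, y, hy0, hy1, fun t =>
      ⟨o.mem_of_mem_star (hy t), mem_chamber_of_mem_star (hx t), hδ t⟩⟩

/-- If the base points are joined to each other, then the complement is path-connected. -/
theorem joined (v₀ : 𝒜.Vertex) {T : Set 𝒜.Edge} (hT : IsSpanningTree (Edge.tail o) (Edge.head o) T)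
    (x : 𝒜.Complement) : Joined (B.pt v₀) x := by
  obtain ⟨δ, -, -⟩ := B.exists_edge_paths o
  obtain ⟨p, hp⟩ : ∃ p : 𝒜.Cover, p.proj = x := by
    obtain ⟨⟨a, b⟩, h⟩ := isQuotientMap_pointHom.surjective x.1
    exact ⟨⟨(a, b), fun j => (show 𝒜.point a b = x.1 from h) ▸ x.2 j⟩, Subtype.ext h⟩
  obtain ⟨c, hc⟩ := p.near_nonempty
  have h1 : Joined (B.pt c.toVertex) x := by
    rw [← B.proj_lift, ← hp]
    exact ⟨(Cover.straight (B.lift_mem_star hc) p.mem_star_self).map continuous_proj⟩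
  have h2 : ∀ u v : 𝒜.Vertex, Relation.EqvGen (fun x y => ∃ e ∈ T, e.tail o = x ∧ e.head o = y)
      u v → Joined (B.pt u) (B.pt v) := by
    intro u v h
    induction h with
    | rel _ _ h =>
      obtain ⟨e, -, rfl, rfl⟩ := h
      exact ⟨δ e⟩
    | refl _ => exact Joined.refl _
    | symm _ _ _ ih => exact ih.symm
    | trans _ _ _ _ _ ih ih' => exact ih.trans ih'
  exact (h2 _ _ (hT.1 _ _)).trans h1

open Path in
/-- Walks in a tree of edges of trivial holonomy have trivial holonomy. -/
theorem exists_treeWalk {H : Type*} [Group H] (v₀ : 𝒜.Vertex) {T : Set 𝒜.Edge}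
    (hT : IsSpanningTree (Edge.tail o) (Edge.head o) T)
    {δ : ∀ e : 𝒜.Edge, Path (B.pt (e.tail o)) (B.pt (e.head o))}
    (hδ : ∀ e, Traverses o e (δ e))
    {hol : ∀ {x y : 𝒜.Complement}, Homotopic.Quotient x y → H}
    (hmul : ∀ {x y z : 𝒜.Complement} (γ : Homotopic.Quotient x y)
      (γ' : Homotopic.Quotient y z), hol (γ.trans γ') = hol γ * hol γ')
    (htree : ∀ e ∈ T, hol (Homotopic.Quotient.mk (δ e)) = 1) (v : 𝒜.Vertex) :
    ∃ γ : Path (B.pt v₀) (B.pt v), IsWalk o T v₀ v γ ∧ hol (Homotopic.Quotient.mk γ) = 1 := by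
  let P : 𝒜.Vertex → Prop := fun v =>
    ∃ γ : Path (B.pt v₀) (B.pt v), IsWalk o T v₀ v γ ∧ hol (Homotopic.Quotient.mk γ) = 1
  have h : ∀ u v : 𝒜.Vertex, Relation.EqvGen (fun x y => ∃ e ∈ T, e.tail o = x ∧ e.head o = y)
      u v → (P u ↔ P v) := by
    intro u v h
    induction h with
    | rel _ _ h =>
      obtain ⟨e, he, rfl, rfl⟩ := h
      constructor
      · rintro ⟨γ, hγ, h1⟩
        refine ⟨_, hγ.forward he (hδ e), ?_⟩
        rw [Homotopic.Quotient.mk_trans, hmul, h1, htree e he, mul_one]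
      · rintro ⟨γ, hγ, h1⟩
        refine ⟨_, hγ.backward he (hδ e), ?_⟩
        rw [Homotopic.Quotient.mk_trans, hmul, h1, Homotopic.Quotient.mk_symm,
          Homotopic.Quotient.hol_symm hmul, htree e he, inv_one, mul_one]
    | refl _ => exact Iff.rfl
    | symm _ _ _ ih => exact ih.symm
    | trans _ _ _ _ _ ih ih' => exact ih.trans ih'
  exact (h v₀ v (hT.1 _ _)).1 ⟨Path.refl _, .nil (B.liesOver v₀), by
    rw [Homotopic.Quotient.mk_refl, Homotopic.Quotient.hol_refl hmul]⟩

end BasePoints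

end EllipticArrangement

namespace EllipticArrangement
open Path (Homotopic)
variable {d n : ℕ} {𝒜 : EllipticArrangement d n} {o : 𝒜.Orientation} {G : Type*} [Group G]

/-! ### Weights of edges with local potentials -/

/-- Near every point the weights of the edges are differences of a potential. -/
def HasPotentials (o : 𝒜.Orientation) (w : 𝒜.Edge → G) : Prop :=
  ∀ p : 𝒜.Cover, ∃ φ : 𝒜.LiftedVertex → G, ∀ E : 𝒜.LiftedEdge, E.center ∈ p.star →
    φ (E.tail o) * w E.toEdge = φ (E.head o)

/-- The converse of the argument in `closesUp_of_cyclicOrder`: a function with the prescribed jumps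
makes the product telescope. -/
theorem CyclicOrder.prod_zpow_exponent_eq_one {p : 𝒜.Cell 2} (s : CyclicOrder p)
    {h : 𝒜.LiftedFace 1 → G} {ψ : 𝒜.LiftedFace 0 → G}
    (hψ : ∀ W : 𝒜.LiftedFace 1, W.pt ∈ 𝒜.star s.face.pt → ψ (o.tail W) * h W = ψ (o.head W)) :
    (List.ofFn fun i => h (s.wall i) ^ s.exponent o i).prod = 1 := by
  have h1 := List.prod_ofFn_cyclic (fun i => ψ (s.chamber i))
    (fun i => h (s.wall i) ^ s.exponent o i)
  have h2 : ∀ i, ψ (s.chamber i) * h (s.wall i) ^ s.exponent o i * (ψ (s.chamber (i + 1)))⁻¹ = 1 :=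
    fun i => by
      rw [mul_inv_eq_one, s.mul_zpow_exponent_iff o]
      exact hψ _ (s.wall_mem_star i)
  simp only [h2, List.ofFn_const, List.prod_replicate, one_pow] at h1
  exact (conj_eq_one_iff.1 h1.symm)

/-! ### Relations and local potentials -/

section Relations

variable {C₀ : 𝒜.Chamber} {T : Set 𝒜.Wall} {w : 𝒜.Edge → G}

theorem lift_sym (hw : ∀ e ∈ treeK C₀ T, w e = 1) (e : 𝒜.Edge) :
    FreeGroup.lift (fun e : generators C₀ T => w e.1) (sym C₀ T e) = w e := by
  by_cases he : e ∈ generators C₀ T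
  · rw [sym, dif_pos he, FreeGroup.lift_apply_of]
  · rw [sym, dif_neg he, map_one]
    rw [generators_eq_compl, Set.notMem_compl_iff] at he
    exact (hw e he).symm

/-- Weights that have local potentials satisfy the relations. -/
theorem HasPotentials.lift_relator (h : HasPotentials o w) (hw : ∀ e ∈ treeK C₀ T, w e = 1)
    {ord : ∀ p : 𝒜.Cell 2, CyclicOrder p} {r : FreeGroup (generators C₀ T)}
    (hr : r ∈ relators o C₀ T ord) :
    FreeGroup.lift (fun e : generators C₀ T => w e.1) r = 1 := by
  rcases hr with (⟨a, b, hab, rfl⟩ | ⟨p, C, rfl⟩) | ⟨p, C, rfl⟩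
  · obtain ⟨V, rfl⟩ : ∃ V : 𝒜.LiftedFace 1, V.toCell = a := ⟨_, a.lift_toCell⟩
    obtain ⟨W, rfl⟩ : ∃ W : 𝒜.LiftedFace 1, W.toCell = b := ⟨_, b.lift_toCell⟩
    rw [LiftedFace.toCell_supp, LiftedFace.toCell_supp] at hab
    simp only [map_mul, map_inv, lift_sym hw, o.tailOf_toCell, o.headOf_toCell]
    -- Disjointness of the supports is what places this point in the cover. The four edges of the
    -- square lie in its star, and both ways around lead to the same value of the potential.
    obtain ⟨φ, hφ⟩ := h ⟨(V.pt, W.pt), Cover.mem_iff.2 hab⟩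
    have hV := 𝒜.mem_star_self V.pt
    have hW := 𝒜.mem_star_self W.pt
    have h1 := hφ (.snd (o.tail V) W) ⟨o.tail_mem_star V, hW⟩
    have h2 := hφ (.fst V (o.head W)) ⟨hV, o.head_mem_star W⟩
    have h3 := hφ (.fst V (o.tail W)) ⟨hV, o.tail_mem_star W⟩
    have h4 := hφ (.snd (o.head V) W) ⟨o.head_mem_star V, hW⟩
    simp only [LiftedEdge.tail, LiftedEdge.head, LiftedEdge.toEdge] at h1 h2 h3 h4
    rw [mul_inv_eq_one, ← mul_right_inj (φ (o.tail V, o.tail W)), ← mul_assoc, h1, h2,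
      ← mul_assoc, h3, h4]
  · obtain ⟨D, rfl⟩ : ∃ D : 𝒜.LiftedFace 0, D.toCell = C := ⟨_, C.lift_toCell⟩
    simp only [map_list_prod, List.map_ofFn, Function.comp_def, map_zpow, lift_sym hw]
    obtain ⟨φ, hφ⟩ := h ⟨((ord p).face.pt, D.pt), Cover.mem_iff.2 (by
      rw [support_chamber D.pt_mem, Set.inter_empty])⟩
    exact (ord p).prod_zpow_exponent_eq_one (h := fun W => w (.fst W.toCell D.toCell))
      (ψ := fun C => φ (C, D)) fun W hW => hφ (.fst W D) ⟨hW, 𝒜.mem_star_self _⟩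
  · obtain ⟨D, rfl⟩ : ∃ D : 𝒜.LiftedFace 0, D.toCell = C := ⟨_, C.lift_toCell⟩
    simp only [map_list_prod, List.map_ofFn, Function.comp_def, map_zpow, lift_sym hw]
    obtain ⟨φ, hφ⟩ := h ⟨(D.pt, (ord p).face.pt), Cover.mem_iff.2 (by
      rw [support_chamber D.pt_mem, Set.empty_inter])⟩
    exact (ord p).prod_zpow_exponent_eq_one (h := fun W => w (.snd D.toCell W.toCell))
      (ψ := fun C => φ (D, C)) fun W hW => hφ (.snd D W) ⟨𝒜.mem_star_self _, hW⟩

/-- The edges, as elements of the presented group, have local potentials. -/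
theorem hasPotentials_presentedGroup (o : 𝒜.Orientation) (C₀ : 𝒜.Chamber) (T : Set 𝒜.Wall)
    (ord : ∀ p : 𝒜.Cell 2, CyclicOrder p) :
    HasPotentials o fun e => PresentedGroup.mk (relators o C₀ T ord) (sym C₀ T e) := by
  have hrel : ∀ r ∈ relators o C₀ T ord, PresentedGroup.mk (relators o C₀ T ord) r = 1 :=
    fun r hr => PresentedGroup.one_of_mem hr
  set w := fun e => PresentedGroup.mk (relators o C₀ T ord) (sym C₀ T e) with hw
  have hcl₁ : ∀ D : 𝒜.LiftedFace 0, ClosesUp o fun W => w (.fst W.toCell D.toCell) := by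
    refine fun D => closesUp_of_cyclicOrder o _
      (fun W v => by rw [LiftedFace.toCell_translate]) ord fun p => ?_
    have := hrel _ (Or.inl (Or.inr ⟨p, D.toCell, rfl⟩))
    simpa only [map_list_prod, List.map_ofFn, Function.comp_def, map_zpow] using this
  have hcl₂ : ∀ C : 𝒜.LiftedFace 0, ClosesUp o fun W => w (.snd C.toCell W.toCell) := by
    refine fun C => closesUp_of_cyclicOrder o _
      (fun W v => by rw [LiftedFace.toCell_translate]) ord fun p => ?_
    have := hrel _ (Or.inr ⟨p, C.toCell, rfl⟩)
    simpa only [map_list_prod, List.map_ofFn, Function.comp_def, map_zpow] using this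
  intro p
  obtain ⟨φ, h1, h2⟩ := exists_potential_prod (x := p.1.1) (y := p.1.2) hcl₁ hcl₂ (by
    intro V W hV hW
    -- Supports of walls in a star are contained in the support of the centre, so the commutation
    -- relation is available for all squares near a point of the cover.
    have hVW : V.toCell.supp ∩ W.toCell.supp = ∅ := by
      rw [LiftedFace.toCell_supp, LiftedFace.toCell_supp, Set.eq_empty_iff_forall_notMem]
      rintro j ⟨hj, hj'⟩
      have : j ∈ 𝒜.support p.1.1 ∩ 𝒜.support p.1.2 :=
        ⟨mem_support_of_mem_star hV hj, mem_support_of_mem_star hW hj'⟩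
      rw [p.support_inter] at this
      exact this
    have := hrel _ (Or.inl (Or.inl ⟨V.toCell, W.toCell, hVW, rfl⟩))
    simpa only [map_mul, map_inv, mul_inv_eq_one, o.tailOf_toCell, o.headOf_toCell] using this)
  refine ⟨fun c => φ c.1 c.2, ?_⟩
  rintro (⟨W, D⟩ | ⟨C, W⟩) hE
  · exact h1 W D hE.1 hE.2
  · exact h2 C W hE.1 hE.2

end Relations

/-! ### Transport and holonomy on the covering -/

/-- Weights with local potentials can be transported along paths. -/
theorem HasPotentials.exists_transport {w : 𝒜.Edge → G} (h : HasPotentials o w)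
    (B : 𝒜.BasePoints) :
    ∃ N : ∀ {c c' : 𝒜.LiftedVertex}, Homotopic.Quotient (B.lift c) (B.lift c') → G → G,
      (∀ c v, N (Homotopic.Quotient.refl (B.lift c)) v = v) ∧
      (∀ {c c' c'' : 𝒜.LiftedVertex} (γ : Homotopic.Quotient (B.lift c) (B.lift c'))
        (γ' : Homotopic.Quotient (B.lift c') (B.lift c'')) (v : G),
        N (γ.trans γ') v = N γ' (N γ v)) ∧
      ∀ (E : 𝒜.LiftedEdge) (v : G),
        N (Homotopic.Quotient.mk (B.edgePath o E)) v = v * w E.toEdge := by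
  choose φ hφ using h
  obtain ⟨M, hrefl, htrans, hM⟩ := _root_.exists_transport Cover.star Cover.near φ
    Cover.isOpen_star Cover.mem_star_self Cover.near_nonempty
    (fun p q hq => Cover.near_subset hq) (by
      intro p q hq c hc c' hc'
      -- Two potentials of the same weights differ by a left constant near `q`.
      have h1 := Cover.eq_of_eq_across_edges (κ := fun c => φ p c * (φ q c)⁻¹) o (p := q)
        (fun E hE => by
          rw [← hφ p E (Cover.star_subset hq hE), ← hφ q E hE]
          group) hc hc'
      have h2 : φ p c * (φ q c)⁻¹ * φ q c' = φ p c' := by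
        beta_reduce at h1
        rw [h1, inv_mul_cancel_right]
      rw [← h2]
      group)
  -- Fibres are identified with the group through the values of the potentials at the chambers of
  -- the base points, so that an edge acts by its weight.
  refine ⟨fun {c c'} γ v => M γ (v * (φ (B.lift c) c)⁻¹) * φ (B.lift c') c', ?_, ?_, ?_⟩
  · intro c v
    beta_reduce
    rw [hrefl, inv_mul_cancel_right]
  · intro c c' c'' γ γ' v
    beta_reduce
    rw [htrans, mul_inv_cancel_right]
  · intro E v
    have h1 := hM E.center (B.edgePath o E) (fun t => Cover.straight_mem
      (B.lift_mem_star E.tail_mem_near) (B.lift_mem_star E.head_mem_near) t) (E.tail o)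
      (B.mem_near_lift _) (E.head o) (B.mem_near_lift _) v
    refine h1.trans ?_
    rw [← hφ E.center E E.center.mem_star_self]
    group

variable {B : 𝒜.BasePoints} {hol : ∀ {p q : 𝒜.Cover}, Homotopic.Quotient p q → G}

/-- The values of a holonomy on segments are differences of a potential. -/
theorem exists_potential_segment
    (hmul : ∀ {p q r : 𝒜.Cover} (γ : Homotopic.Quotient p q) (γ' : Homotopic.Quotient q r),
      hol (γ.trans γ') = hol γ * hol γ')
    (p : 𝒜.Cover) : ∃ φ : 𝒜.LiftedVertex → G,
    ∀ {c c' : 𝒜.LiftedVertex} (h : c ∈ p.near) (h' : c' ∈ p.near),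
      φ c * hol (Homotopic.Quotient.mk (B.segment h h')) = φ c' := by
  classical
  obtain ⟨c₀, h₀⟩ := p.near_nonempty
  refine ⟨fun c => if h : c ∈ p.near then hol (Homotopic.Quotient.mk (B.segment h₀ h)) else 1,
    fun {c c'} h h' => ?_⟩
  beta_reduce
  rw [dif_pos h, dif_pos h', ← hmul, ← Homotopic.Quotient.mk_trans]
  exact congrArg hol (Homotopic.Quotient.eq.2 (Cover.homotopic_of_mem_star (p := p) _ _
    (Cover.trans_mem_star (Cover.straight_mem _ _) (Cover.straight_mem _ _))
    (Cover.straight_mem _ _)))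

/-- The holonomies of the edges have local potentials. -/
theorem hasPotentials_of_holonomy
    (hmul : ∀ {p q r : 𝒜.Cover} (γ : Homotopic.Quotient p q) (γ' : Homotopic.Quotient q r),
      hol (γ.trans γ') = hol γ * hol γ')
    {F : 𝒜.Edge → G}
    (hF : ∀ E, hol (Homotopic.Quotient.mk (B.edgePath o E)) = F E.toEdge) :
    HasPotentials o F := by
  intro p
  obtain ⟨φ, hφ⟩ := exists_potential_segment (B := B) hmul p
  refine ⟨φ, fun E hE => ?_⟩
  rw [← hF]
  exact hφ (Cover.near_subset hE E.tail_mem_near) (Cover.near_subset hE E.head_mem_near)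

/-- The holonomy of any path between base points lies in the subgroup generated by the holonomies
of the edges. -/
theorem holonomy_mem
    (hmul : ∀ {p q r : 𝒜.Cover} (γ : Homotopic.Quotient p q) (γ' : Homotopic.Quotient q r),
      hol (γ.trans γ') = hol γ * hol γ')
    {F : 𝒜.Edge → G}
    (hF : ∀ E, hol (Homotopic.Quotient.mk (B.edgePath o E)) = F E.toEdge)
    {K : Subgroup G} (hK : ∀ e, F e ∈ K) {c c' : 𝒜.LiftedVertex}
    (γ : Homotopic.Quotient (B.lift c) (B.lift c')) : hol γ ∈ K := by
  have hseg : ∀ (p : 𝒜.Cover) {c c' : 𝒜.LiftedVertex} (h : c ∈ p.near) (h' : c' ∈ p.near),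
      hol (Homotopic.Quotient.mk (B.segment h h')) ∈ K := by
    intro p c c' h h'
    obtain ⟨φ, hφ⟩ := exists_potential_segment (B := B) hmul p
    -- Membership holds at `c` and does not change across an edge, whose jump lies in `K`.
    have h1 := Cover.eq_of_eq_across_edges (κ := fun c' => (φ c)⁻¹ * φ c' ∈ K) o (p := p)
      (fun E hE => ?_) h h'
    · rw [← hφ h h', inv_mul_cancel_left, inv_mul_cancel, eq_iff_iff] at h1
      exact h1.1 K.one_mem
    · have h2 := hφ (Cover.near_subset hE (E.tail_mem_near (o := o)))
        (Cover.near_subset hE (E.head_mem_near (o := o)))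
      have h3 : φ (E.tail o) * F E.toEdge = φ (E.head o) := by rw [← h2, ← hF]; rfl
      rw [← h3, ← mul_assoc, eq_iff_iff]
      exact (K.mul_mem_cancel_right (hK _)).symm
  -- The pieces of a subdivided path have arbitrary ends; they are completed by straight segments to
  -- nearby base points, and the property passed along the subdivision concerns the completed
  -- pieces.
  let s : ∀ (p : 𝒜.Cover) {c : 𝒜.LiftedVertex}, c ∈ p.near → G := fun p c h =>
    hol (Homotopic.Quotient.mk (Cover.straight p.mem_star_self (B.lift_mem_star h)))
  have key := Path.Homotopic.Quotient.induction_of_open_cover Cover.isOpen_star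
    Cover.mem_star_self (P := fun {p q} γ => ∀ (c c' : 𝒜.LiftedVertex) (h : c ∈ p.near)
      (h' : c' ∈ q.near), (s p h)⁻¹ * hol γ * s q h' ∈ K)
    (fun {p q r} γ γ' hγ hγ' c c' h h' => by
      obtain ⟨c₁, h₁⟩ := q.near_nonempty
      have := K.mul_mem (hγ c c₁ h h₁) (hγ' c₁ c' h₁ h')
      rw [hmul]
      convert this using 1
      group)
    (fun r {p q} γ hγ c c' h h' => by
      have hp : p ∈ r.star := by simpa using hγ 0
      have hq : q ∈ r.star := by simpa using hγ 1
      -- Both sides are values of paths with common ends in the star of `r`.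
      have e : hol (Homotopic.Quotient.mk γ) * s q h' = s p h * hol (Homotopic.Quotient.mk
          (B.segment (Cover.near_subset hp h) (Cover.near_subset hq h'))) := by
        rw [← hmul, ← hmul, ← Homotopic.Quotient.mk_trans, ← Homotopic.Quotient.mk_trans]
        refine congrArg hol (Homotopic.Quotient.eq.2 (Cover.homotopic_of_mem_star (p := r) _ _
          (Cover.trans_mem_star hγ fun t => Cover.star_subset hq (Cover.straight_mem _ _ t))
          (Cover.trans_mem_star (fun t => Cover.star_subset hp (Cover.straight_mem _ _ t))
            (Cover.straight_mem _ _))))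
      rw [mul_assoc, e, inv_mul_cancel_left]
      exact hseg r _ _) γ c c' (B.mem_near_lift c) (B.mem_near_lift c')
  have hs : ∀ c, s (B.lift c) (B.mem_near_lift c) = 1 := by
    intro c
    rw [← Homotopic.Quotient.hol_refl hmul (B.lift c), ← Homotopic.Quotient.mk_refl]
    exact congrArg hol (Homotopic.Quotient.eq.2 (Cover.homotopic_of_mem_star (p := B.lift c) _ _
      (Cover.straight_mem _ _) fun _ => Cover.mem_star_self _))
  rwa [hs, hs, inv_one, one_mul, mul_one] at key

end EllipticArrangement

namespace EllipticArrangement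
open Path (Homotopic)
variable {d n : ℕ} {𝒜 : EllipticArrangement d n} {o : 𝒜.Orientation}

/-! ### The presentation -/

variable (𝒜) in
/-- The covering map as a bundled continuous map. -/
def projMap : C(𝒜.Cover, 𝒜.Complement) := ⟨Cover.proj, isCoveringMap_proj.continuous⟩

theorem hol_cast {X G : Type*} [TopologicalSpace X]
    {hol : ∀ {x y : X}, Homotopic.Quotient x y → G} {x y x' y' : X}
    (γ : Homotopic.Quotient x y) (hx : x' = x) (hy : y' = y) : hol (γ.cast hx hy) = hol γ := by
  subst hx hy
  rw [Homotopic.Quotient.cast_rfl_rfl]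

theorem eq_cast_of_cast_eq {X : Type*} [TopologicalSpace X] {x y x' y' : X}
    {γ : Homotopic.Quotient x y} {γ' : Homotopic.Quotient x' y'} {hx : x' = x} {hy : y' = y}
    (h : γ.cast hx hy = γ') : γ = γ'.cast hx.symm hy.symm := by
  subst hx hy h
  rw [Homotopic.Quotient.cast_rfl_rfl, Homotopic.Quotient.cast_rfl_rfl]

theorem refl_cast {X : Type*} [TopologicalSpace X] {x x' : X} (h h' : x' = x) :
    (Homotopic.Quotient.refl x).cast h h' = Homotopic.Quotient.refl x' := by
  subst h
  exact Homotopic.Quotient.cast_rfl_rfl _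

theorem BasePoints.lift_injective (B : 𝒜.BasePoints) : Function.Injective B.lift := fun c c' h =>
  Prod.ext (LiftedFace.eq_of_mem (B.fst_mem c) (h ▸ B.fst_mem c'))
    (LiftedFace.eq_of_mem (B.snd_mem c) (h ▸ B.snd_mem c'))

/-- Every element of the presented group is realized by paths on the covering, simultaneously as
a holonomy and as a transport. -/
theorem exists_path_realizing {H Γ ι : Type*} [Group H] [Group Γ] {B : 𝒜.BasePoints}
    {hol : ∀ {p q : 𝒜.Cover}, Homotopic.Quotient p q → H}
    (hmul : ∀ {p q r : 𝒜.Cover} (γ : Homotopic.Quotient p q) (γ' : Homotopic.Quotient q r),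
      hol (γ.trans γ') = hol γ * hol γ')
    {N : ∀ {c c' : 𝒜.LiftedVertex}, Homotopic.Quotient (B.lift c) (B.lift c') → Γ → Γ}
    (hrefl : ∀ c v, N (Homotopic.Quotient.refl (B.lift c)) v = v)
    (htrans : ∀ {c c' c'' : 𝒜.LiftedVertex} (γ : Homotopic.Quotient (B.lift c) (B.lift c'))
      (γ' : Homotopic.Quotient (B.lift c') (B.lift c'')) (v : Γ),
      N (γ.trans γ') v = N γ' (N γ v))
    {F : 𝒜.Edge → H} {w : 𝒜.Edge → Γ}
    (hF : ∀ E, hol (Homotopic.Quotient.mk (B.edgePath o E)) = F E.toEdge)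
    (hN : ∀ (E : 𝒜.LiftedEdge) (v : Γ),
      N (Homotopic.Quotient.mk (B.edgePath o E)) v = v * w E.toEdge)
    {S : Set 𝒜.Edge} (hS : IsSpanningTree (Edge.tail o) (Edge.head o) S)
    (hF1 : ∀ e ∈ S, F e = 1) (hw1 : ∀ e ∈ S, w e = 1) (f : ι → 𝒜.Edge) (r : FreeGroup ι)
    (c : 𝒜.LiftedVertex) (v : 𝒜.Vertex) :
    ∃ c' : 𝒜.LiftedVertex, c'.toVertex = v ∧ ∃ γ : Homotopic.Quotient (B.lift c) (B.lift c'),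
      hol γ = FreeGroup.lift (F ∘ f) r ∧ ∀ v, N γ v = v * FreeGroup.lift (w ∘ f) r := by
  -- Allowing every lift of `u` as the start makes the relation composable, although the lift of `v`
  -- at the end is not prescribed.
  let R : H → Γ → 𝒜.Vertex → 𝒜.Vertex → Prop := fun a g u v =>
    ∀ c : 𝒜.LiftedVertex, c.toVertex = u → ∃ c' : 𝒜.LiftedVertex, c'.toVertex = v ∧
      ∃ γ : Homotopic.Quotient (B.lift c) (B.lift c'), hol γ = a ∧ ∀ v, N γ v = v * g
  have hone : ∀ u, R 1 1 u u := fun u c hc => ⟨c, hc, Homotopic.Quotient.refl _,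
    Homotopic.Quotient.hol_refl hmul _, fun v => by rw [hrefl, mul_one]⟩
  have hcomp : ∀ {a b g h u v x}, R a g u v → R b h v x → R (a * b) (g * h) u x := by
    intro a b g h u v x h1 h2 c hc
    obtain ⟨c', hc', γ, ha, hg⟩ := h1 c hc
    obtain ⟨c'', hc'', γ', hb, hh⟩ := h2 c' hc'
    exact ⟨c'', hc'', γ.trans γ', by rw [hmul, ha, hb], fun v => by
      rw [htrans, hg, hh, mul_assoc]⟩
  have hedge : ∀ e, R (F e) (w e) (e.tail o) (e.head o) := by
    intro e c hc
    obtain ⟨E, rfl, rfl⟩ := LiftedEdge.exists_of_tail hc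
    exact ⟨E.head o, E.head_toEdge.symm, Homotopic.Quotient.mk (B.edgePath o E), hF E, hN E⟩
  have hedge' : ∀ e, R (F e)⁻¹ (w e)⁻¹ (e.head o) (e.tail o) := by
    intro e c hc
    obtain ⟨E, rfl, rfl⟩ := LiftedEdge.exists_of_head hc
    refine ⟨E.tail o, E.tail_toEdge.symm, (Homotopic.Quotient.mk (B.edgePath o E)).symm, ?_, ?_⟩
    · rw [Homotopic.Quotient.hol_symm hmul, hF]
    · intro v
      have h1 := hN E (v * (w E.toEdge)⁻¹)
      rw [inv_mul_cancel_right] at h1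
      rw [← h1, ← htrans, Homotopic.Quotient.trans_symm, hrefl, h1]
  have htree : ∀ u v, R 1 1 u v := by
    have h : ∀ u v, Relation.EqvGen (fun x y => ∃ e ∈ S, e.tail o = x ∧ e.head o = y) u v →
        R 1 1 u v ∧ R 1 1 v u := by
      intro u v h
      induction h with
      | rel _ _ h =>
        obtain ⟨e, he, rfl, rfl⟩ := h
        have h1 := hedge e
        have h2 := hedge' e
        rw [hF1 e he, hw1 e he] at h1 h2
        rw [inv_one, inv_one] at h2
        exact ⟨h1, h2⟩
      | refl _ => exact ⟨hone _, hone _⟩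
      | symm _ _ _ ih => exact ih.symm
      | trans _ _ _ _ _ ih ih' =>
        have h1 := hcomp ih.1 ih'.1
        have h2 := hcomp ih'.2 ih.2
        rw [mul_one, mul_one] at h1 h2
        exact ⟨h1, h2⟩
    exact fun u v => (h u v (hS.1 u v)).1
  -- Detours through the tree cost nothing, so the ends of an edge are immaterial and letters
  -- compose freely.
  have hany : ∀ {a g x y}, R a g x y → ∀ u v, R a g u v := by
    intro a g x y h u v
    have := hcomp (hcomp (htree u x) h) (htree y v)
    rwa [one_mul, one_mul, mul_one, mul_one] at this
  have key : ∀ u v, R (FreeGroup.lift (F ∘ f) r) (FreeGroup.lift (w ∘ f) r) u v := by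
    induction r using FreeGroup.induction_on with
    | C1 => rw [map_one, map_one]; exact htree
    | of i => rw [FreeGroup.lift_apply_of, FreeGroup.lift_apply_of]; exact hany (hedge (f i))
    | inv_of i _ =>
      rw [map_inv, map_inv, FreeGroup.lift_apply_of, FreeGroup.lift_apply_of]
      exact hany (hedge' (f i))
    | mul r s hr hs =>
      rw [map_mul, map_mul]
      exact fun u v => hcomp (hr u v) (hs v v)
  exact key _ v c rfl

end EllipticArrangement

end

open EllipticArrangement in
/-- The fundamental group is written with opposite multiplication because products in
`FundamentalGroup` are concatenations of loops in the reverse order. -/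
theorem mainTheorem3 {d n : ℕ} (𝒜 : EllipticArrangement d n) (o : 𝒜.Orientation)
    (C₀ : 𝒜.Chamber) (T : Set 𝒜.Wall) (hT : IsSpanningTree o.tailOf o.headOf T)
    (ord : ∀ p : 𝒜.Cell 2, CyclicOrder p)
    (z₀ : 𝒜.Complement) (hz₀ : LiesOver z₀ (C₀, C₀)) :
    IsSpanningTree (Edge.tail o) (Edge.head o) (treeK C₀ T) ∧
    generators C₀ T = (treeK C₀ T)ᶜ ∧
    (generators C₀ T).Finite ∧
    (relators o C₀ T ord).Finite ∧
    ∃ Φ : PresentedGroup (relators o C₀ T ord) ≃* (FundamentalGroup 𝒜.Complement z₀)ᵐᵒᵖ,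
      ∀ e : generators C₀ T, ∃ (z z' : 𝒜.Complement) (γ : Path z₀ z) (δ : Path z z')
        (ε : Path z₀ z'),
        IsWalk o (treeK C₀ T) (C₀, C₀) (e.1.tail o) γ ∧ Traverses o e.1 δ ∧
        IsWalk o (treeK C₀ T) (C₀, C₀) (e.1.head o) ε ∧
        Φ (PresentedGroup.of e) = MulOpposite.op
          (FundamentalGroup.fromPath
            (Path.Homotopic.Quotient.mk ((γ.trans δ).trans ε.symm))) := by
  have hS := isSpanningTree_treeK o C₀ hT
  refine ⟨hS, generators_eq_compl C₀ T, Set.toFinite _, finite_relators o C₀ T ord, ?_⟩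
  obtain ⟨B, rfl⟩ := exists_basePoints hz₀
  obtain ⟨δ, hδ, hδE⟩ := B.exists_edge_paths o
  obtain ⟨hol, hloop, hmul, htree⟩ := exists_holonomy (Edge.tail o) (Edge.head o) (treeK C₀ T)
    hS.2 B.pt B.pt_injective (C₀, C₀) (B.joined o _ hS) δ
  let F : 𝒜.Edge → (FundamentalGroup 𝒜.Complement (B.pt (C₀, C₀)))ᵐᵒᵖ := fun e =>
    hol (Path.Homotopic.Quotient.mk (δ e))
  let holC : ∀ {p q : 𝒜.Cover}, Path.Homotopic.Quotient p q →
    (FundamentalGroup 𝒜.Complement (B.pt (C₀, C₀)))ᵐᵒᵖ := fun γ => hol (γ.map 𝒜.projMap)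
  have hmulC : ∀ {p q r : 𝒜.Cover} (γ : Path.Homotopic.Quotient p q)
      (γ' : Path.Homotopic.Quotient q r), holC (γ.trans γ') = holC γ * holC γ' := by
    intro p q r γ γ'
    obtain ⟨γ⟩ := γ
    obtain ⟨γ'⟩ := γ'
    refine Eq.trans ?_ (hmul _ _)
    exact congrArg (fun γ => hol (Path.Homotopic.Quotient.mk γ))
      (Path.map_trans γ γ' 𝒜.projMap.continuous)
  have hFC : ∀ E, holC (Path.Homotopic.Quotient.mk (B.edgePath o E)) = F E.toEdge := fun E =>
    (Path.Homotopic.Quotient.hol_congr (hol := hol) (γ := δ E.toEdge)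
      (γ' := (B.edgePath o E).map 𝒜.projMap.continuous) (hδE E)).symm
  -- Holonomies of edges satisfy the relations, which makes `Φ` well defined.
  have hrel := fun r hr => (hasPotentials_of_holonomy hmulC hFC).lift_relator (ord := ord)
    (r := r) htree hr
  let w : 𝒜.Edge → PresentedGroup (relators o C₀ T ord) := fun e =>
    PresentedGroup.mk (relators o C₀ T ord) (sym C₀ T e)
  have hw1 : ∀ e ∈ treeK C₀ T, w e = 1 := by
    intro e he
    have : e ∉ generators C₀ T := by rw [generators_eq_compl]; exact fun h => h he
    change PresentedGroup.mk _ (sym C₀ T e) = 1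
    rw [sym, dif_neg this, map_one]
  have hwof : ∀ e : generators C₀ T, w e.1 = PresentedGroup.of e := by
    intro e
    change PresentedGroup.mk _ (sym C₀ T e) = _
    rw [sym, dif_pos e.2]
    rfl
  let Φ := PresentedGroup.toGroup hrel
  -- A word in the kernel is realised by a path on the cover whose projection is null-homotopic. The
  -- path is then a null-homotopic loop itself, and its transport, multiplication by the class of
  -- the word, is the identity.
  have hinj : Function.Injective Φ := by
    rw [injective_iff_map_eq_one]
    intro x hx
    obtain ⟨r, rfl⟩ := PresentedGroup.mk_surjective _ x
    obtain ⟨N, hN1, hN2, hN3⟩ :=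
      (hasPotentials_presentedGroup o C₀ T ord).exists_transport B
    obtain ⟨c₀, hc₀⟩ : ∃ c : 𝒜.LiftedVertex, c.toVertex = (C₀, C₀) :=
      ⟨(C₀.lift, C₀.lift), Prod.ext C₀.lift_toCell C₀.lift_toCell⟩
    obtain ⟨c', hc', γ, hγ1, hγ2⟩ := exists_path_realizing hmulC hN1 hN2 hFC hN3 hS htree hw1
      (fun e : generators C₀ T => e.1) r c₀ (C₀, C₀)
    have hp : (B.lift c₀).proj = B.pt (C₀, C₀) := by rw [B.proj_lift, hc₀]
    have hp' : (B.lift c').proj = B.pt (C₀, C₀) := by rw [B.proj_lift, hc']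
    have e1 : hol ((γ.map 𝒜.projMap).cast hp.symm hp'.symm) = 1 :=
      (hol_cast (hol := hol) _ _ _).trans (hγ1.trans hx)
    rw [hloop, MulOpposite.op_eq_one_iff] at e1
    have e2 : γ.map 𝒜.projMap = (Path.Homotopic.Quotient.refl _).cast hp hp' :=
      eq_cast_of_cast_eq e1
    -- A null-homotopic loop has trivial monodromy, so `γ` is closed.
    have e3 := isCoveringMap_proj.monodromy_eq_of_map_eq (ex := ⟨B.lift c₀, hp⟩)
      (ey := ⟨B.lift c', hp'⟩) γ e2
    rw [isCoveringMap_proj.monodromy_refl] at e3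
    obtain rfl := B.lift_injective (congrArg Subtype.val e3)
    have e4 : γ = Path.Homotopic.Quotient.refl _ :=
      isCoveringMap_proj.injective_path_homotopic_map _ _ (e2.trans (refl_cast _ _))
    have e5 := hγ2 1
    rw [e4, hN1, one_mul] at e5
    have e6 : FreeGroup.lift (w ∘ fun e : generators C₀ T => e.1) =
        PresentedGroup.mk (relators o C₀ T ord) := FreeGroup.ext_hom _ _ fun e => by
      rw [FreeGroup.lift_apply_of]
      exact hwof e
    rw [← e6]
    exact e5.symm
  -- A loop lifts to a path between lifted base points, and the holonomy of such a path is generated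
  -- by that of the edges.
  have hsurj : Function.Surjective Φ := by
    intro x
    obtain ⟨c₀, hc₀⟩ : ∃ c : 𝒜.LiftedVertex, c.toVertex = (C₀, C₀) :=
      ⟨(C₀.lift, C₀.lift), Prod.ext C₀.lift_toCell C₀.lift_toCell⟩
    have hp : (B.lift c₀).proj = B.pt (C₀, C₀) := by rw [B.proj_lift, hc₀]
    let γ : Path.Homotopic.Quotient (B.pt (C₀, C₀)) (B.pt (C₀, C₀)) := x.unop
    have e1 := isCoveringMap_proj.map_liftPathQuotient γ ⟨B.lift c₀, hp⟩
    generalize isCoveringMap_proj.liftPathQuotient γ ⟨B.lift c₀, hp⟩ = Γ at e1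
    generalize isCoveringMap_proj.monodromy γ ⟨B.lift c₀, hp⟩ = q at Γ e1
    obtain ⟨q, hq⟩ := q
    obtain ⟨c', -, rfl⟩ := B.exists_eq_lift hq
    have e2 : holC Γ = x := (congrArg hol e1).trans ((hol_cast _ _ _).trans (hloop γ))
    rw [← e2]
    refine holonomy_mem hmulC hFC (K := Φ.range) (fun e => ?_) Γ
    by_cases he : e ∈ generators C₀ T
    · exact ⟨PresentedGroup.of ⟨e, he⟩, PresentedGroup.toGroup.of hrel⟩
    · rw [generators_eq_compl, Set.notMem_compl_iff] at he
      rw [show F e = 1 from htree e he]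
      exact Φ.range.one_mem
  refine ⟨MulEquiv.ofBijective Φ ⟨hinj, hsurj⟩, fun e => ?_⟩
  obtain ⟨γ, hγ, hγ1⟩ := B.exists_treeWalk o (C₀, C₀) hS hδ hmul htree (e.1.tail o)
  obtain ⟨ε, hε, hε1⟩ := B.exists_treeWalk o (C₀, C₀) hS hδ hmul htree (e.1.head o)
  refine ⟨_, _, γ, δ e.1, ε, hγ, hδ e.1, hε, ?_⟩
  -- The walks in the tree have trivial holonomy, so the loop has the holonomy of the edge alone.
  rw [← hloop, Path.Homotopic.Quotient.mk_trans, Path.Homotopic.Quotient.mk_trans, hmul, hmul,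
    hγ1, Path.Homotopic.Quotient.mk_symm, Path.Homotopic.Quotient.hol_symm hmul, hε1, one_mul,
    inv_one, mul_one]
  exact PresentedGroup.toGroup.of hrel
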